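/- A lattice polygon is a two-dimensional convex polygon $P\subset\mathbb{R}^2$ with vertices in $\mathbb{Z}^2$; its genus is the number of lattice points in its interior, and $P$ is hyperelliptic if these points are collinear. Two lattice polygons are equivalent if a map $p\mapsto Ap+v$ with $A\in\mathrm{GL}_2(\mathbb{Z})$, $v\in\mathbb{Z}^2$ sends one onto the other. For a lattice polygon $P$ of genus $g\ge 2$ and a regular unimodular triangulation $\mathcal{T}$ of $P$ (using all lattice points of $P$), each height function $\omega:P\cap\mathbb{Z}^2\to\mathbb{R}$ inducing $\mathcal{T}$ defines a smooth tropical plane curve, given by $\min_{(a,b)\in P\cap\mathbb{Z}^2}(\omega(a,b)+ax+by)$ and dual to $\mathcal{T}$. Its skeleton is the metric graph obtained by removing all unbounded rays, successively removing all leaves, and smoothing over the vertices of degree $2$, where lengths of edges are lattice lengths and are added when edges are concatenated. Let $\mathbb{M}_{\mathcal{T}}$ be the closure of the set of edge-length vectors of these skeletons; it is a polyhedral cone in $\mathbb{R}^{3g-3}$. Let $\mathbb{M}_P=\bigcup_{\mathcal{T}}\mathbb{M}_{\mathcal{T}}$, so that $\dim(\mathbb{M}_P)=\max_{\mathcal{T}}\dim(\mathbb{M}_{\mathcal{T}})$,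 over all regular unimodular triangulations $\mathcal{T}$ of $P$. For $g\ge 2$ and integers $i,j,k\geq 0$, say that a lattice polygon is in - Class 1 if it is equivalent to $\mathrm{conv}\{(0,0),(i,0),(2g+1-i,2),(1,2)\}$ with $g\le i\le 2g$; - Class 2 if it is equivalent to $\mathrm{conv}\{(0,0),(i,0),(g+1,1),(1+j,2),(1,2)\}$ with (a) $0\le i\le g$ and $0\le j\le i$, or (b) $g<i\le 2g+1$ and $0\le j\le 2g-i+1$; - Class 3 if it is equivalent to $\mathrm{conv}\{(0,0),(i,0),(g+1,1),(k+j,2),(k,2),(0,1)\}$ with $0\le k\le g+1$ and (a) $0\le i\le g+1-k$ and $0\le j\le i$, or (b) $g+1-k<i\le 2g+2-2k$ and $0\le j\le 2g+2-i-2k$. **Proposition.** Let $P$ be a hyperelliptic lattice polygon of genus $g\ge 2$. Then $$\dim(\mathbb{M}_P)=\begin{cases}2g-1&\text{if $P$ is in Class 1},\\ \min(g+i+j,\,2g-1)&\text{if $P$ is in Class 2(a)},\\ 2g-1&\text{if $P$ is in Class 2(b)},\\ \min(g+i+j+1,\,2g-1)&\text{if $P$ is in Class 3(a) and }k\ne 0,\\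 \min(g+i+j,\,2g-1)&\text{if $P$ is in Class 3(a) and }k=0,\\ \min(g+i+j+1,\,2g-1)&\text{if $P$ is in Class 3(b)}.\end{cases}$$ -/

import Mathlib

noncomputable section

namespace TropicalModuli

/-! ### Lattice polygons -/

/-- The inclusion of the lattice `ℤ²` into the plane `ℝ²`. -/
def toPlane (z : ℤ × ℤ) : ℝ × ℝ := ((z.1 : ℝ), (z.2 : ℝ))

/-- The convex hull in the plane of a set of lattice points. -/
def latticeHull (S : Set (ℤ × ℤ)) : Set (ℝ × ℝ) := convexHull ℝ (toPlane '' S)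

/-- A two-dimensional convex lattice polygon. -/
def IsLatticePolygon (P : Set (ℝ × ℝ)) : Prop :=
  (∃ S : Set (ℤ × ℤ), S.Finite ∧ P = latticeHull S) ∧ (interior P).Nonempty

/-- The lattice points of `P`. -/
def latticePoints (P : Set (ℝ × ℝ)) : Set (ℤ × ℤ) := {z | toPlane z ∈ P}

/-- The lattice points in the interior of `P`. -/
def interiorLatticePoints (P : Set (ℝ × ℝ)) : Set (ℤ × ℤ) := {z | toPlane z ∈ interior P}

/-- The genus of a lattice polygon is its number of interior lattice points. -/
def genus (P : Set (ℝ × ℝ)) : ℕ := (interiorLatticePoints P).ncard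

/-- A polygon is hyperelliptic if all its interior lattice points are collinear. -/
def IsHyperelliptic (P : Set (ℝ × ℝ)) : Prop :=
  Collinear ℝ (toPlane '' interiorLatticePoints P)

/-- `P` and `Q` are equivalent if a unimodular transformation `p ↦ A p + v`, with
`A = (a b; c d)` an integer matrix of determinant `±1` and `v = (u, w)` an integer vector,
maps `P` onto `Q`. -/
def Equivalent (P Q : Set (ℝ × ℝ)) : Prop :=
  ∃ a b c d u w : ℤ, (a * d - b * c = 1 ∨ a * d - b * c = -1) ∧
    (fun p : ℝ × ℝ => ((a * p.1 + b * p.2 + u, c * p.1 + d * p.2 + w) : ℝ × ℝ)) '' P = Q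

/-! ### Tropical polynomials, dual subdivisions, lattice lengths -/

/-- The value at `v` of the term of the tropical polynomial with exponent `z` and
coefficient `ω z`. -/
def tropTerm (ω : ℤ × ℤ → ℝ) (v : ℝ × ℝ) (z : ℤ × ℤ) : ℝ :=
  ω z + z.1 * v.1 + z.2 * v.2

/-- The exponents at which the tropical polynomial `min_z (ω z + ⟨z, v⟩)`, where `z` runs over
the lattice points of `P`, attains its minimum at the point `v`.
Only the values of `ω` on `P ∩ ℤ²` matter. -/
def minimizers (P : Set (ℝ × ℝ)) (ω : ℤ × ℤ → ℝ) (v : ℝ × ℝ) : Set (ℤ × ℤ) :=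
  {z | z ∈ latticePoints P ∧ ∀ y ∈ latticePoints P, tropTerm ω v z ≤ tropTerm ω v y}

/-- The regular subdivision of `P` induced by the height function `ω`, given by its
two-dimensional cells. A face of the lower convex hull of the lifted points `(z, ω z)` is cut out
by an affine function, that is, it consists of the points over `minimizers P ω v` for some `v`. -/
def inducedSubdivision (P : Set (ℝ × ℝ)) (ω : ℤ × ℤ → ℝ) : Set (Set (ℤ × ℤ)) :=
  {t | ¬ Collinear ℝ (toPlane '' t) ∧ ∃ v, t = minimizers P ω v}

/-- The vertex set of a lattice triangle of area `1/2`. -/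
def IsUnimodularTriangle (t : Set (ℤ × ℤ)) : Prop :=
  ∃ p q r : ℤ × ℤ, t = {p, q, r} ∧
    |(q.1 - p.1) * (r.2 - p.2) - (q.2 - p.2) * (r.1 - p.1)| = 1

/-- `T` (a set of triangles, each given by its vertices) is a regular unimodular triangulation
of `P`. -/
def IsRegularUnimodularTriangulation (P : Set (ℝ × ℝ)) (T : Set (Set (ℤ × ℤ))) : Prop :=
  (∃ ω : ℤ × ℤ → ℝ, inducedSubdivision P ω = T) ∧ ∀ t ∈ T, IsUnimodularTriangle t

/-- The lattice length of a bounded line segment of rational slope: a subsegment from `a` to `b`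
has length `c ≥ 0` if `b - a = c • d` for a primitive integer vector `d`, and the length of the
whole segment is the largest such `c`. -/
def latticeLength (s : Set (ℝ × ℝ)) : ℝ :=
  sSup {c : ℝ | ∃ a ∈ s, ∃ b ∈ s, ∃ d : ℤ × ℤ, IsCoprime d.1 d.2 ∧ b - a = c • toPlane d}

/-- The edge, dual to the edge `e` of the induced subdivision, of the tropical curve whose tropical
polynomial has coefficients `ω`. -/
def dualEdge (P : Set (ℝ × ℝ)) (ω : ℤ × ℤ → ℝ) (e : Set (ℤ × ℤ)) : Set (ℝ × ℝ) :=
  {v | e ⊆ minimizers P ω v}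

/-! ### The skeleton

The tropical curve dual to `T` has one vertex for each triangle of `T` and one bounded edge for each
edge shared by two triangles of `T`. -/

/-- The bounded edges of a tropical curve dual to `T`: the edges shared by two triangles of `T`. -/
def boundedEdges (T : Set (Set (ℤ × ℤ))) : Set (Set (ℤ × ℤ)) :=
  {e | e.ncard = 2 ∧ ∃ t ∈ T, ∃ t' ∈ T, t ≠ t' ∧ e ⊆ t ∧ e ⊆ t'}

/-- The edges that remain once the rays and then, successively, all leaves have been removed: the
largest set of bounded edges such that no vertex (triangle of `T`) is incident to exactly one of
them. -/
def coreEdges (T : Set (Set (ℤ × ℤ))) : Set (Set (ℤ × ℤ)) :=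
  ⋃₀ {F | F ⊆ boundedEdges T ∧ ∀ e ∈ F, ∀ t ∈ T, e ⊆ t → ∃ e' ∈ F, e' ≠ e ∧ e' ⊆ t}

/-- Two remaining edges are concatenated when they meet at a vertex of degree two. -/
def Concatenated (T : Set (Set (ℤ × ℤ))) (e e' : coreEdges T) : Prop :=
  ∃ t ∈ T, e.1 ⊆ t ∧ e'.1 ⊆ t ∧ {f | f ∈ coreEdges T ∧ f ⊆ t}.ncard = 2

/-- The edges of the skeleton: classes of remaining edges under the equivalence relation generated
by concatenation at vertices of degree two. -/
def SkeletonEdge (T : Set (Set (ℤ × ℤ))) : Type := Quot (Concatenated T)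

/-- The edge lengths of the skeleton of the tropical curve with coefficients `ω`, dual to `T`: the
length of an edge of the skeleton is the sum of the lattice lengths of the edges of the tropical
curve that contribute to it. -/
def skeletonLength (P : Set (ℝ × ℝ)) (T : Set (Set (ℤ × ℤ))) (ω : ℤ × ℤ → ℝ) :
    SkeletonEdge T → ℝ :=
  fun c => ∑ᶠ e : {e : coreEdges T // Quot.mk (Concatenated T) e = c},
    latticeLength (dualEdge P ω e.1.1)

/-! ### Moduli spaces and their dimensions -/

/-- The moduli space `𝕄_T`: the closure of the set of skeleta (given by their edge lengths) of the
smooth tropical plane curves dual to `T`. -/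
def moduliSpace (P : Set (ℝ × ℝ)) (T : Set (Set (ℤ × ℤ))) : Set (SkeletonEdge T → ℝ) :=
  closure {L | ∃ ω : ℤ × ℤ → ℝ, inducedSubdivision P ω = T ∧ L = skeletonLength P T ω}

/-- The dimension of the polyhedral cone `𝕄_T`, i.e. of its affine hull. -/
def triangulationModuliDim (P : Set (ℝ × ℝ)) (T : Set (Set (ℤ × ℤ))) : ℕ :=
  Module.finrank ℝ (vectorSpan ℝ (moduliSpace P T))

/-- The dimension of `𝕄_P`, the union of the cones `𝕄_T` over the finitely many regular unimodular
triangulations `T` of `P`: the maximum of their dimensions. -/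
def moduliDim (P : Set (ℝ × ℝ)) : ℕ :=
  sSup {d | ∃ T, IsRegularUnimodularTriangulation P T ∧ d = triangulationModuliDim P T}

/-! ### The classification of hyperelliptic polygons of genus `g` -/

/-- Class 1, with parameter `i`. -/
def InClass1 (g i : ℕ) (P : Set (ℝ × ℝ)) : Prop :=
  g ≤ i ∧ i ≤ 2 * g ∧
    Equivalent P (latticeHull {(0, 0), ((i : ℤ), 0), (2 * (g : ℤ) + 1 - i, 2), (1, 2)})

/-- The polygon of Class 2 with parameters `i`, `j`. -/
def class2Polygon (g i j : ℕ) : Set (ℝ × ℝ) :=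
  latticeHull {(0, 0), ((i : ℤ), 0), ((g : ℤ) + 1, 1), (1 + (j : ℤ), 2), (1, 2)}

/-- Class 2(a). -/
def InClass2a (g i j : ℕ) (P : Set (ℝ × ℝ)) : Prop :=
  i ≤ g ∧ j ≤ i ∧ Equivalent P (class2Polygon g i j)

/-- Class 2(b); the last inequality is `j ≤ 2g - i + 1`. -/
def InClass2b (g i j : ℕ) (P : Set (ℝ × ℝ)) : Prop :=
  g < i ∧ i ≤ 2 * g + 1 ∧ i + j ≤ 2 * g + 1 ∧ Equivalent P (class2Polygon g i j)

/-- The polygon of Class 3 with parameters `i`, `j`, `k`. -/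
def class3Polygon (g i j k : ℕ) : Set (ℝ × ℝ) :=
  latticeHull {(0, 0), ((i : ℤ), 0), ((g : ℤ) + 1, 1), ((k : ℤ) + j, 2), ((k : ℤ), 2), (0, 1)}

/-- Class 3(a); the second inequality is `i ≤ g + 1 - k`. -/
def InClass3a (g i j k : ℕ) (P : Set (ℝ × ℝ)) : Prop :=
  k ≤ g + 1 ∧ i + k ≤ g + 1 ∧ j ≤ i ∧ Equivalent P (class3Polygon g i j k)

/-- Class 3(b); the inequalities on `i` and `j` are `g + 1 - k < i ≤ 2g + 2 - 2k` and
`j ≤ 2g + 2 - i - 2k`. -/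
def InClass3b (g i j k : ℕ) (P : Set (ℝ × ℝ)) : Prop :=
  k ≤ g + 1 ∧ g + 1 < i + k ∧ i + 2 * k ≤ 2 * g + 2 ∧ i + j + 2 * k ≤ 2 * g + 2 ∧
    Equivalent P (class3Polygon g i j k)

end TropicalModuli

end

noncomputable section

namespace TropicalModuli

/-! ### Lattice lengths of dual edges -/

/-! Unimodular maps change none of the data (`moduliDim_eq_of_equivalent`), and apart from that only
the lattice points of the polygon enter. So it suffices to treat three rows of lattice points in the
strip `0 ≤ y ≤ 2`, with interior points `(1, 1), …, (g, 1)` (`Rows`).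

For a fixed triangulation the edge lengths of the skeleton are linear in the height function, and a
height inducing a unimodular triangulation can be moved a little in any direction without changing
it (`exists_perturbation`). Hence the dimension of the cone is the rank of the linear map from
heights to lengths (`triangulationModuliDim_eq_finrank_range`).

All triangulations are found by sweeping a vertical line with first coordinate `X` through the dual
plane. Over `X` the tropical polynomial is the minimum of one term per row, and the middle row takes
part exactly when `Rows.gapHeight` is nonnegative. At the break between `(i, 1)` and `(i + 1, 1)`
the outer rows have unique minimizers. Either the segment between the two middle points is an edge
there, or it is replaced by the segment joining the two outer minimizers. This is the data of a
`Staircase` (`Rows.UnimodularOn.exists_staircase`). The skeleton then has `g` cycles, one around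
each interior point, and consecutive cycles either share an edge or are joined by one. The two arcs
of an inner cycle have the same length, because the lattice length of each of their pieces is its
horizontal extent and both arcs span the same interval of first coordinates. So the `3g - 3` lengths
reduce to `g - 1` links and `g` cycle lengths (`Staircase.lengths`).

Upper bounds. The rank is at most `2g - 1`, the number of functionals. It is also at most the number
of lattice points minus three, as affine heights give zero lengths. If the left end is a vertical
edge of length two, one of its three points never matters: either an outer corner is cut off by the
first gap, or the coefficient of `(0, 1)` in the first loop, `pos 0 0 + pos 2 0`, vanishes
(`Staircase.finrank_lengths_lt_points`).

Lower bounds. Heights that are convex in each row, with the outer rows lifted high, realize every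
monotone choice of outer vertices without replacing any middle edge
(`Rows.Profile.exists_staircase`). For such a triangulation, vanishing lengths force the heights at
the interior points into an arithmetic progression, which may be normalized to zero. Each rung then
says that its two outer vertices have heights of sum zero. Walking first along the bottom row and
then along the top row brings in one new outer point at a time, so these heights vanish one after
another (`Staircase.card_le_finrank`). Counting the points reached matches the upper bounds in every
class. -/

theorem tropTerm_eq_of_mem {P : Set (ℝ × ℝ)} {ω : ℤ × ℤ → ℝ} {v : ℝ × ℝ} {p q : ℤ × ℤ}
    (hp : p ∈ minimizers P ω v) (hq : q ∈ minimizers P ω v) :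
    tropTerm ω v p = tropTerm ω v q :=
  le_antisymm (hp.2 q hq.1) (hq.2 p hp.1)

/-- The dual edge of `{p, q}` runs from `vR` to `vL`; its lattice length is read off with any
integer vector `w` that completes `q - p` to a basis. -/
theorem latticeLength_dualEdge {P : Set (ℝ × ℝ)} {ω : ℤ × ℤ → ℝ} {p q w rL rR : ℤ × ℤ}
    {vL vR : ℝ × ℝ} (cL cR : ℤ)
    (hw : (q.1 - p.1) * w.2 - (q.2 - p.2) * w.1 = 1 ∨ (q.1 - p.1) * w.2 - (q.2 - p.2) * w.1 = -1)
    (hpL : p ∈ minimizers P ω vL) (hqL : q ∈ minimizers P ω vL) (hrL : rL ∈ minimizers P ω vL)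
    (hpR : p ∈ minimizers P ω vR) (hqR : q ∈ minimizers P ω vR) (hrR : rR ∈ minimizers P ω vR)
    (hL : rL = (p.1 - w.1 + cL * (q.1 - p.1), p.2 - w.2 + cL * (q.2 - p.2)))
    (hR : rR = (p.1 + w.1 + cR * (q.1 - p.1), p.2 + w.2 + cR * (q.2 - p.2))) :
    latticeLength (dualEdge P ω {p, q}) =
      w.1 * (vL.1 - vR.1) + w.2 * (vL.2 - vR.2) := by
  obtain ⟨δ, hδ, hdet⟩ : ∃ δ : ℤ, δ * δ = 1 ∧ (q.1 - p.1) * w.2 - (q.2 - p.2) * w.1 = δ := by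
    rcases hw with h | h
    · exact ⟨1, by norm_num, h⟩
    · exact ⟨-1, by norm_num, h⟩
  have hδR : (δ : ℝ) * δ = 1 := by exact_mod_cast hδ
  have hdetR : ((q.1 : ℝ) - p.1) * w.2 - (q.2 - p.2) * w.1 = δ := by exact_mod_cast hdet
  -- the direction of the dual edge is orthogonal to `q - p`
  have perp : ∀ a b : ℝ × ℝ, p ∈ minimizers P ω a → q ∈ minimizers P ω a →
      p ∈ minimizers P ω b → q ∈ minimizers P ω b →
      ((q.1 : ℝ) - p.1) * (b.1 - a.1) + (q.2 - p.2) * (b.2 - a.2) = 0 := by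
    intro a b h1 h2 h3 h4
    have e1 := tropTerm_eq_of_mem h1 h2
    have e2 := tropTerm_eq_of_mem h3 h4
    simp only [tropTerm] at e1 e2
    linear_combination e1 - e2
  -- Compared with `p`, the term of `rR` is bounded below along the dual edge, with equality at
  -- `vR`. Modulo `q - p`, which is constant there, the difference `rR - p` is `w`. So `vR`
  -- minimizes the pairing with `w`, and symmetrically `vL` maximizes it.
  have lower : ∀ v, p ∈ minimizers P ω v → q ∈ minimizers P ω v →
      (w.1 : ℝ) * vR.1 + w.2 * vR.2 ≤ w.1 * v.1 + w.2 * v.2 := by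
    intro v h1 h2
    have e1 := perp vR v hpR hqR h1 h2
    have e2 := tropTerm_eq_of_mem hpR hrR
    have e3 := h1.2 rR hrR.1
    simp only [tropTerm, hR] at e2 e3
    push_cast at e2 e3
    have e4 := congrArg (fun x => (cR : ℝ) * x) e1
    linarith
  have upper : ∀ v, p ∈ minimizers P ω v → q ∈ minimizers P ω v →
      (w.1 : ℝ) * v.1 + w.2 * v.2 ≤ w.1 * vL.1 + w.2 * vL.2 := by
    intro v h1 h2
    have e1 := perp vL v hpL hqL h1 h2
    have e2 := tropTerm_eq_of_mem hpL hrL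
    have e3 := h1.2 rL hrL.1
    simp only [tropTerm, hL] at e2 e3
    push_cast at e2 e3
    have e4 := congrArg (fun x => (cL : ℝ) * x) e1
    linarith
  have mem : ∀ v, v ∈ dualEdge P ω {p, q} ↔ p ∈ minimizers P ω v ∧ q ∈ minimizers P ω v := by
    intro v
    simp [dualEdge, Set.insert_subset_iff]
  refine IsGreatest.csSup_eq ⟨?_, ?_⟩
  -- The primitive direction is `q - p` turned by a right angle; the sign `δ` makes its pairing with
  -- `w` equal to `1`.
  · refine ⟨vR, (mem _).2 ⟨hpR, hqR⟩, vL, (mem _).2 ⟨hpL, hqL⟩,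
      (-(δ * (q.2 - p.2)), δ * (q.1 - p.1)), ?_, ?_⟩
    · exact ⟨w.1, w.2, by linear_combination δ * hdet + hδ⟩
    · have e1 := perp vR vL hpR hqR hpL hqL
      ext
      · simp only [Prod.fst_sub, Prod.smul_fst, toPlane, smul_eq_mul]
        push_cast
        linear_combination (δ * w.2 : ℝ) * e1 - (vL.1 - vR.1) * hδR - (vL.1 - vR.1) * δ * hdetR
      · simp only [Prod.snd_sub, Prod.smul_snd, toPlane, smul_eq_mul]
        push_cast
        linear_combination (-δ * w.1 : ℝ) * e1 - (vL.2 - vR.2) * hδR - (vL.2 - vR.2) * δ * hdetR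
  · rintro c ⟨a, ha, b, hb, d, ⟨m, n, hmn⟩, hc⟩
    rw [mem] at ha hb
    have e1 := perp a b ha.1 ha.2 hb.1 hb.2
    have c1 : b.1 - a.1 = c * d.1 := by simpa [toPlane] using congrArg Prod.fst hc
    have c2 : b.2 - a.2 = c * d.2 := by simpa [toPlane] using congrArg Prod.snd hc
    have la := lower a ha.1 ha.2
    have lb := lower b hb.1 hb.2
    have ua := upper a ha.1 ha.2
    have ub := upper b hb.1 hb.2
    rcases eq_or_ne c 0 with rfl | hc0
    · linarith
    have hperp : (q.1 - p.1) * d.1 + (q.2 - p.2) * d.2 = 0 := by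
      rw [c1, c2] at e1
      have : c * (((q.1 : ℝ) - p.1) * d.1 + (q.2 - p.2) * d.2) = 0 := by linear_combination e1
      have := (mul_eq_zero.1 this).resolve_left hc0
      exact_mod_cast this
    -- Since `q - p` and `w` form a basis, a primitive vector orthogonal to `q - p` pairs with `w`
    -- to a unit. Thus the length `c` is, up to sign, a difference of values of the functional
    -- bounded above.
    have hunit : (w.1 * d.1 + w.2 * d.2) *
        (δ * (-(m * (q.2 - p.2)) + n * (q.1 - p.1))) = 1 := by
      linear_combination (-(m * w.2 * δ) + n * w.1 * δ) * hperp
        + (m * d.1 + n * d.2) * δ * hdet + hδ * (m * d.1 + n * d.2) + hmn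
    have hval : (w.1 : ℝ) * (b.1 - a.1) + w.2 * (b.2 - a.2) = c * (w.1 * d.1 + w.2 * d.2 : ℤ) := by
      rw [c1, c2]; push_cast; ring
    rcases Int.isUnit_iff.1 (IsUnit.of_mul_eq_one _ hunit) with h | h
    · rw [h] at hval; push_cast at hval; linarith
    · rw [h] at hval; push_cast at hval; linarith

/-! ### Collinearity of lattice points -/

/-- Twice the signed area of the triangle `p q r`. -/
def area2 (p q r : ℤ × ℤ) : ℤ := (q.1 - p.1) * (r.2 - p.2) - (q.2 - p.2) * (r.1 - p.1)

theorem collinear_toPlane_iff {t : Set (ℤ × ℤ)} :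
    Collinear ℝ (toPlane '' t) ↔ ∀ p ∈ t, ∀ q ∈ t, ∀ r ∈ t, area2 p q r = 0 := by
  constructor
  · intro h p hp q hq r hr
    obtain ⟨u, hu⟩ := (collinear_iff_of_mem (Set.mem_image_of_mem toPlane hp)).1 h
    obtain ⟨a, ha⟩ := hu _ (Set.mem_image_of_mem _ hq)
    obtain ⟨b, hb⟩ := hu _ (Set.mem_image_of_mem _ hr)
    have a1 := congrArg Prod.fst ha
    have a2 := congrArg Prod.snd ha
    have b1 := congrArg Prod.fst hb
    have b2 := congrArg Prod.snd hb
    simp only [toPlane, vadd_eq_add, Prod.fst_add, Prod.snd_add, Prod.smul_fst, Prod.smul_snd,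
      smul_eq_mul] at a1 a2 b1 b2
    have : ((area2 p q r : ℤ) : ℝ) = 0 := by
      simp only [area2]
      push_cast
      rw [a1, a2, b1, b2]
      ring
    exact_mod_cast this
  · intro h
    rcases Set.subsingleton_or_nontrivial t with ht | ⟨p, hp, q, hq, hpq⟩
    · rcases ht.eq_empty_or_singleton with rfl | ⟨x, rfl⟩
      · simpa using collinear_empty ℝ (ℝ × ℝ)
      · simpa using collinear_singleton ℝ (toPlane x)
    rw [collinear_iff_of_mem (Set.mem_image_of_mem toPlane hp)]
    refine ⟨toPlane q - toPlane p, ?_⟩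
    rintro _ ⟨r, hr, rfl⟩
    have hz : ((q.1 : ℝ) - p.1) * (r.2 - p.2) - (q.2 - p.2) * (r.1 - p.1) = 0 := by
      exact_mod_cast h p hp q hq r hr
    by_cases h1 : q.1 = p.1
    · have h2 : q.2 ≠ p.2 := fun h2 => hpq (Prod.ext h1 h2).symm
      have h2' : (q.2 : ℝ) - p.2 ≠ 0 := sub_ne_zero.2 (by exact_mod_cast h2)
      refine ⟨(r.2 - p.2) / (q.2 - p.2), ?_⟩
      have h1' : (q.1 : ℝ) = p.1 := by exact_mod_cast h1
      rw [h1'] at hz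
      ext
      · simp only [toPlane, vadd_eq_add, Prod.fst_add, Prod.smul_fst, smul_eq_mul, Prod.fst_sub,
          h1']
        have : (q.2 - p.2 : ℝ) * (r.1 - p.1) = 0 := by linear_combination -hz
        have := (mul_eq_zero.1 this).resolve_left h2'
        linarith
      · simp only [toPlane, vadd_eq_add, Prod.snd_add, Prod.smul_snd, smul_eq_mul, Prod.snd_sub]
        field_simp
        ring
    · have h1' : (q.1 : ℝ) - p.1 ≠ 0 := sub_ne_zero.2 (by exact_mod_cast h1)
      refine ⟨(r.1 - p.1) / (q.1 - p.1), ?_⟩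
      ext
      · simp only [toPlane, vadd_eq_add, Prod.fst_add, Prod.smul_fst, smul_eq_mul, Prod.fst_sub]
        field_simp
        ring
      · simp only [toPlane, vadd_eq_add, Prod.snd_add, Prod.smul_snd, smul_eq_mul, Prod.snd_sub]
        field_simp
        linear_combination hz

theorem not_collinear_toPlane {t : Set (ℤ × ℤ)} {p q r : ℤ × ℤ} (hp : p ∈ t) (hq : q ∈ t)
    (hr : r ∈ t) (h : area2 p q r ≠ 0) : ¬ Collinear ℝ (toPlane '' t) :=
  fun hc => h (collinear_toPlane_iff.1 hc p hp q hq r hr)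

/-- A unimodular triangle consists of any three non-collinear points in it. -/
theorem IsUnimodularTriangle.eq_of_area2_ne_zero {t : Set (ℤ × ℤ)} (ht : IsUnimodularTriangle t)
    {p q r : ℤ × ℤ} (hp : p ∈ t) (hq : q ∈ t) (hr : r ∈ t) (h : area2 p q r ≠ 0) :
    t = {p, q, r} ∧ |area2 p q r| = 1 := by
  obtain ⟨a, b, c, rfl, habc⟩ := ht
  simp only [Set.mem_insert_iff, Set.mem_singleton_iff] at hp hq hr
  have e : ∀ x y : ℤ × ℤ, area2 x x y = 0 ∧ area2 x y x = 0 ∧ area2 y x x = 0 := by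
    intro x y; simp only [area2]; refine ⟨?_, ?_, ?_⟩ <;> ring
  have habc' : |area2 a b c| = 1 := habc
  have sw1 : area2 a c b = - area2 a b c := by simp only [area2]; ring
  have sw2 : area2 b a c = - area2 a b c := by simp only [area2]; ring
  have sw3 : area2 b c a = area2 a b c := by simp only [area2]; ring
  have sw4 : area2 c a b = area2 a b c := by simp only [area2]; ring
  have sw5 : area2 c b a = - area2 a b c := by simp only [area2]; ring
  rcases hp with rfl | rfl | rfl <;> rcases hq with rfl | rfl | rfl <;>
    rcases hr with rfl | rfl | rfl <;>
    first
    | exact absurd (e _ _).1 h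
    | exact absurd (e _ _).2.1 h
    | exact absurd (e _ _).2.2 h
    | (refine ⟨?_, ?_⟩
       · ext x; simp only [Set.mem_insert_iff, Set.mem_singleton_iff]; try tauto
       · simp only [sw1, sw2, sw3, sw4, sw5, abs_neg, habc'])

/-! ### Regular unimodular triangulations are stable under small perturbations -/

/-- The point at which the terms of `p`, `q`, `r` agree. -/
def meetingPoint (p q r : ℤ × ℤ) (ω : ℤ × ℤ → ℝ) : ℝ × ℝ :=
  (((ω p - ω q) * (r.2 - p.2) - (ω p - ω r) * (q.2 - p.2)) / area2 p q r,
    ((ω p - ω r) * (q.1 - p.1) - (ω p - ω q) * (r.1 - p.1)) / area2 p q r)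

theorem tropTerm_meetingPoint {p q r : ℤ × ℤ} (ω : ℤ × ℤ → ℝ) (h : area2 p q r ≠ 0) :
    tropTerm ω (meetingPoint p q r ω) q = tropTerm ω (meetingPoint p q r ω) p ∧
      tropTerm ω (meetingPoint p q r ω) r = tropTerm ω (meetingPoint p q r ω) p := by
  have h' : (area2 p q r : ℝ) ≠ 0 := by exact_mod_cast h
  have hd : (area2 p q r : ℝ) = (q.1 - p.1) * (r.2 - p.2) - (q.2 - p.2) * (r.1 - p.1) := by
    simp [area2]
  constructor
  · simp only [tropTerm, meetingPoint]
    field_simp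
    rw [hd]; ring
  · simp only [tropTerm, meetingPoint]
    field_simp
    rw [hd]; ring

theorem eq_meetingPoint {p q r : ℤ × ℤ} {ω : ℤ × ℤ → ℝ} {v : ℝ × ℝ} (h : area2 p q r ≠ 0)
    (hq : tropTerm ω v q = tropTerm ω v p) (hr : tropTerm ω v r = tropTerm ω v p) :
    v = meetingPoint p q r ω := by
  have h' : (area2 p q r : ℝ) ≠ 0 := by exact_mod_cast h
  have hd : (area2 p q r : ℝ) = (q.1 - p.1) * (r.2 - p.2) - (q.2 - p.2) * (r.1 - p.1) := by
    simp [area2]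
  simp only [tropTerm] at hq hr
  ext
  · simp only [meetingPoint]
    rw [eq_div_iff h', hd]
    linear_combination (r.2 - p.2 : ℝ) * hq - (q.2 - p.2 : ℝ) * hr
  · simp only [meetingPoint]
    rw [eq_div_iff h', hd]
    linear_combination (q.1 - p.1 : ℝ) * hr - (r.1 - p.1 : ℝ) * hq

/-- The vertex dual to a triangle depends continuously on the heights, so the finitely many strict
comparisons at these vertices survive a small move. Every old triangle persists. No new cell
appears: three non-collinear points minimal after the move were already minimal before it, hence
formed an old cell. -/
theorem exists_perturbation {P : Set (ℝ × ℝ)} (hfin : (latticePoints P).Finite)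
    {ω : ℤ × ℤ → ℝ} (hT : ∀ t ∈ inducedSubdivision P ω, IsUnimodularTriangle t)
    (δ : ℤ × ℤ → ℝ) :
    ∃ ε : ℝ, 0 < ε ∧ inducedSubdivision P (ω + ε • δ) = inducedSubdivision P ω := by
  -- The denominator `area2 p q r` is independent of `ε`, so continuity also holds for collinear
  -- triples, where the quotient is `0` by convention.
  have hcont : ∀ p q r y : ℤ × ℤ,
      Continuous fun ε : ℝ => tropTerm (ω + ε • δ) (meetingPoint p q r (ω + ε • δ)) y := by
    intro p q r y
    simp only [tropTerm, meetingPoint, Pi.add_apply, Pi.smul_apply, smul_eq_mul, div_eq_mul_inv]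
    fun_prop
  have hlt : ∀ p q r y y' : ℤ × ℤ,
      tropTerm ω (meetingPoint p q r ω) y < tropTerm ω (meetingPoint p q r ω) y' →
      ∀ᶠ ε in nhdsWithin (0 : ℝ) (Set.Ioi 0),
        tropTerm (ω + ε • δ) (meetingPoint p q r (ω + ε • δ)) y <
          tropTerm (ω + ε • δ) (meetingPoint p q r (ω + ε • δ)) y' := by
    intro p q r y y' h
    refine Filter.Eventually.filter_mono nhdsWithin_le_nhds ?_
    refine ((hcont p q r y).continuousAt.eventually_lt (hcont p q r y').continuousAt ?_)
    simpa using h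
  have hev : ∀ᶠ ε in nhdsWithin (0 : ℝ) (Set.Ioi 0), ∀ p ∈ latticePoints P,
      ∀ q ∈ latticePoints P, ∀ r ∈ latticePoints P, ∀ y ∈ latticePoints P,
      tropTerm ω (meetingPoint p q r ω) y < tropTerm ω (meetingPoint p q r ω) p ∨
      tropTerm ω (meetingPoint p q r ω) p < tropTerm ω (meetingPoint p q r ω) y →
      (tropTerm (ω + ε • δ) (meetingPoint p q r (ω + ε • δ)) y <
          tropTerm (ω + ε • δ) (meetingPoint p q r (ω + ε • δ)) p ↔
        tropTerm ω (meetingPoint p q r ω) y < tropTerm ω (meetingPoint p q r ω) p) ∧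
      (tropTerm (ω + ε • δ) (meetingPoint p q r (ω + ε • δ)) p <
          tropTerm (ω + ε • δ) (meetingPoint p q r (ω + ε • δ)) y ↔
        tropTerm ω (meetingPoint p q r ω) p < tropTerm ω (meetingPoint p q r ω) y) := by
    simp only [Filter.eventually_all_finite hfin]
    intro p _ q _ r _ y _
    by_cases h1 : tropTerm ω (meetingPoint p q r ω) y < tropTerm ω (meetingPoint p q r ω) p
    · filter_upwards [hlt p q r y p h1] with ε hε _
      exact ⟨iff_of_true hε h1, iff_of_false hε.not_gt h1.not_gt⟩
    by_cases h2 : tropTerm ω (meetingPoint p q r ω) p < tropTerm ω (meetingPoint p q r ω) y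
    · filter_upwards [hlt p q r p y h2] with ε hε _
      exact ⟨iff_of_false hε.not_gt h1, iff_of_true hε h2⟩
    · exact Filter.Eventually.of_forall fun ε h => absurd h (by tauto)
  obtain ⟨ε, hε, hpos⟩ := (hev.and self_mem_nhdsWithin).exists
  refine ⟨ε, hpos, ?_⟩
  set ω' := ω + ε • δ with hω'
  have persist : ∀ p q r : ℤ × ℤ, area2 p q r ≠ 0 →
      minimizers P ω (meetingPoint p q r ω) = {p, q, r} →
      minimizers P ω' (meetingPoint p q r ω') = {p, q, r} := by
    intro p q r hA hm
    have hp : p ∈ minimizers P ω (meetingPoint p q r ω) := by rw [hm]; simp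
    have hq : q ∈ minimizers P ω (meetingPoint p q r ω) := by rw [hm]; simp
    have hr : r ∈ minimizers P ω (meetingPoint p q r ω) := by rw [hm]; simp
    have key : ∀ y ∈ latticePoints P, y ∉ ({p, q, r} : Set (ℤ × ℤ)) →
        tropTerm ω' (meetingPoint p q r ω') p < tropTerm ω' (meetingPoint p q r ω') y := by
      intro y hy hyn
      have h1 : tropTerm ω (meetingPoint p q r ω) p < tropTerm ω (meetingPoint p q r ω) y := by
        refine lt_of_le_of_ne (hp.2 y hy) fun he => hyn ?_
        rw [← hm]
        exact ⟨hy, fun y' hy' => he ▸ hp.2 y' hy'⟩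
      exact ((hε p hp.1 q hq.1 r hr.1 y hy (Or.inr h1)).2).2 h1
    obtain ⟨eq', er'⟩ := tropTerm_meetingPoint ω' hA
    have hmin : ∀ y ∈ latticePoints P,
        tropTerm ω' (meetingPoint p q r ω') p ≤ tropTerm ω' (meetingPoint p q r ω') y := by
      intro y hy
      by_cases hyn : y ∈ ({p, q, r} : Set (ℤ × ℤ))
      · rcases hyn with rfl | rfl | rfl
        · exact le_rfl
        · exact eq'.ge
        · exact er'.ge
      · exact (key y hy hyn).le
    ext y
    constructor
    · rintro ⟨hy, hy'⟩
      by_contra hyn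
      exact absurd (hy' p hp.1) (not_le.2 (key y hy hyn))
    · rintro (rfl | rfl | rfl)
      · exact ⟨hp.1, hmin⟩
      · exact ⟨hq.1, fun y hy => eq'.trans_le (hmin y hy)⟩
      · exact ⟨hr.1, fun y hy => er'.trans_le (hmin y hy)⟩
  ext t
  constructor
  · rintro ⟨hnc, v, rfl⟩
    have h3 : ∃ p ∈ minimizers P ω' v, ∃ q ∈ minimizers P ω' v, ∃ r ∈ minimizers P ω' v,
        area2 p q r ≠ 0 := by
      by_contra hcon
      push Not at hcon
      exact hnc (collinear_toPlane_iff.2 hcon)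
    obtain ⟨p, hp, q, hq, r, hr, hA⟩ := h3
    have hv : v = meetingPoint p q r ω' :=
      eq_meetingPoint hA (tropTerm_eq_of_mem hq hp) (tropTerm_eq_of_mem hr hp)
    obtain ⟨eq0, er0⟩ := tropTerm_meetingPoint ω hA
    -- A point strictly below `p` at the old meeting point would still be strictly below it after
    -- the move, where `p` is minimal.
    have hmin : ∀ y ∈ latticePoints P,
        tropTerm ω (meetingPoint p q r ω) p ≤ tropTerm ω (meetingPoint p q r ω) y := by
      intro y hy
      by_contra hlt'
      rw [not_le] at hlt'
      have := ((hε p hp.1 q hq.1 r hr.1 y hy (Or.inl hlt')).1).2 hlt'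
      rw [← hv] at this
      exact absurd (hp.2 y hy) (not_le.2 this)
    have mp : p ∈ minimizers P ω (meetingPoint p q r ω) := ⟨hp.1, hmin⟩
    have mq : q ∈ minimizers P ω (meetingPoint p q r ω) :=
      ⟨hq.1, fun y hy => eq0.trans_le (hmin y hy)⟩
    have mr : r ∈ minimizers P ω (meetingPoint p q r ω) :=
      ⟨hr.1, fun y hy => er0.trans_le (hmin y hy)⟩
    have hcell : minimizers P ω (meetingPoint p q r ω) ∈ inducedSubdivision P ω :=
      ⟨not_collinear_toPlane mp mq mr hA, _, rfl⟩
    have heq := ((hT _ hcell).eq_of_area2_ne_zero mp mq mr hA).1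
    have := persist p q r hA heq
    rw [hv, this, ← heq]
    exact hcell
  · rintro ht
    obtain ⟨p, q, r, rfl, hA⟩ := hT t ht
    have hA' : area2 p q r ≠ 0 := by
      intro h
      change |area2 p q r| = 1 at hA
      rw [h] at hA
      simp at hA
    obtain ⟨hnc, v, hv⟩ := ht
    have hp : p ∈ minimizers P ω v := by rw [← hv]; simp
    have hq : q ∈ minimizers P ω v := by rw [← hv]; simp
    have hr : r ∈ minimizers P ω v := by rw [← hv]; simp
    have hv' : v = meetingPoint p q r ω :=
      eq_meetingPoint hA' (tropTerm_eq_of_mem hq hp) (tropTerm_eq_of_mem hr hp)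
    refine ⟨hnc, _, (persist p q r hA' ?_).symm⟩
    rw [← hv', hv]

/-! ### The dimension of the moduli space as a rank -/

/-- Several skeleton edges may carry the same functional, as the two arcs of a cycle do, so `F` may
list each length only once. The linear span of all values is closed because it has finite dimension,
which bounds the closure from above. Conversely, every direction of the range of `F` is a difference
of two skeleta, by perturbing the heights. -/
theorem triangulationModuliDim_eq_finrank_range {P : Set (ℝ × ℝ)}
    (hfin : (latticePoints P).Finite) {T : Set (Set (ℤ × ℤ))}
    (hT : IsRegularUnimodularTriangulation P T) {ι : Type} [Finite ι]
    (F : (ℤ × ℤ → ℝ) →ₗ[ℝ] (ι → ℝ))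
    (h₁ : ∀ c : SkeletonEdge T, ∃ l : ι, ∀ ω, inducedSubdivision P ω = T →
      skeletonLength P T ω c = F ω l)
    (h₂ : ∀ l : ι, ∃ c : SkeletonEdge T, ∀ ω, inducedSubdivision P ω = T →
      skeletonLength P T ω c = F ω l) :
    triangulationModuliDim P T = Module.finrank ℝ (LinearMap.range F) := by
  choose κ hκ using h₁
  choose e he using h₂
  have := Fintype.ofFinite ι
  let κ' : (ι → ℝ) →ₗ[ℝ] (SkeletonEdge T → ℝ) := LinearMap.funLeft ℝ ℝ κ
  let e' : (SkeletonEdge T → ℝ) →ₗ[ℝ] (ι → ℝ) := LinearMap.funLeft ℝ ℝ e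
  set W : Submodule ℝ (SkeletonEdge T → ℝ) := (LinearMap.range F).map κ' with hW
  have hWfin : FiniteDimensional ℝ W := inferInstance
  have hsub : moduliSpace P T ⊆ W := by
    refine closure_minimal ?_ (Submodule.closed_of_finiteDimensional W)
    rintro _ ⟨ω, hω, rfl⟩
    refine ⟨F ω, ⟨ω, rfl⟩, ?_⟩
    ext c
    exact (hκ c ω hω).symm
  have hspan : vectorSpan ℝ (moduliSpace P T) ≤ W := by
    rw [vectorSpan_def, Submodule.span_le]
    rintro _ ⟨a, ha, b, hb, rfl⟩
    exact W.sub_mem (hsub ha) (hsub hb)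
  have hfd : FiniteDimensional ℝ (vectorSpan ℝ (moduliSpace P T)) :=
    Submodule.finiteDimensional_of_le hspan
  refine le_antisymm ((Submodule.finrank_mono hspan).trans (Submodule.finrank_map_le _ _)) ?_
  obtain ⟨⟨ω, rfl⟩, hU⟩ := hT
  have hle : LinearMap.range F ≤ (vectorSpan ℝ (moduliSpace P _)).map e' := by
    rintro _ ⟨δ, rfl⟩
    obtain ⟨ε, hε, hω'⟩ := exists_perturbation hfin hU δ
    have h0 : skeletonLength P _ ω ∈ moduliSpace P (inducedSubdivision P ω) :=
      subset_closure ⟨ω, rfl, rfl⟩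
    have h1 : skeletonLength P _ (ω + ε • δ) ∈ moduliSpace P (inducedSubdivision P ω) :=
      subset_closure ⟨_, hω', rfl⟩
    -- The two skeleta differ by `ε • F δ`, read on the labels through `e'`.
    have h2 := Submodule.smul_mem _ ε⁻¹ (vsub_mem_vectorSpan ℝ h1 h0)
    refine ⟨_, h2, ?_⟩
    ext l
    simp only [e', LinearMap.funLeft_apply, Pi.smul_apply, vsub_eq_sub, Pi.sub_apply]
    rw [he l _ hω', he l _ rfl]
    simp only [map_add, map_smul, Pi.add_apply, Pi.smul_apply, smul_eq_mul]
    field_simp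
    ring
  exact (Submodule.finrank_mono hle).trans (Submodule.finrank_map_le _ _)

end TropicalModuli

end


noncomputable section

namespace TropicalModuli

/-! ### Polygons with three rows of lattice points -/

/-- The shape of the lattice points of a hyperelliptic polygon placed in the strip `0 ≤ y ≤ 2`,
with interior lattice points `(1, 1), …, (g, 1)`: in row `r` they run from `(lo r, r)` to
`(hi r, r)`. -/
structure Rows where
  g : ℤ
  lo : ℤ → ℤ
  hi : ℤ → ℤ
  two_le : 2 ≤ g
  lo_le_hi : ∀ r, r = 0 ∨ r = 2 → lo r ≤ hi r
  -- Either `(0, 1)` is a lattice point and convexity puts the midpoint of the left ends of the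
  -- outer rows at or to the right of it, or it is missing and the boundary crosses the middle row
  -- at `1/2`.
  left : (lo 1 = 0 ∧ 0 ≤ lo 0 + lo 2) ∨ (lo 1 = 1 ∧ lo 0 + lo 2 = 1)
  right : (hi 1 = g + 1 ∧ hi 0 + hi 2 ≤ 2 * g + 2) ∨ (hi 1 = g ∧ hi 0 + hi 2 = 2 * g + 1)

/-- The lattice points described by `R`. -/
def Rows.pts (R : Rows) : Set (ℤ × ℤ) :=
  {z | 0 ≤ z.2 ∧ z.2 ≤ 2 ∧ R.lo z.2 ≤ z.1 ∧ z.1 ≤ R.hi z.2}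

/-- The two rows that do not contain the interior points. -/
def Outer (r : ℤ) : Prop := r = 0 ∨ r = 2

/-- Combinatorial data of a unimodular triangulation: between `(i, 1)` and `(i + 1, 1)` lie the
vertices `(pos 0 i, 0)` and `(pos 2 i, 2)`; these two are joined to each other if `i ∈ split`,
and otherwise `(i, 1)` and `(i + 1, 1)` are. -/
structure Staircase (R : Rows) where
  pos : ℤ → ℤ → ℤ
  split : Set ℤ
  pos_neg_one : ∀ r, Outer r → pos r (-1) = R.lo r
  pos_last : ∀ r, Outer r → pos r (R.g + 1) = R.hi r
  pos_le_succ : ∀ r, Outer r → ∀ i, -1 ≤ i → i ≤ R.g → pos r i ≤ pos r (i + 1)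
  -- The triangles joining the bridge to `(i, 1)` and to `(i + 1, 1)` have doubled areas `|pos 0 i +
  -- pos 2 i - 2 * i|` and `|pos 0 i + pos 2 i - 2 * i - 2|`; both equal `1` for this sum only.
  split_sum : ∀ i, 0 ≤ i → i ≤ R.g → i ∈ split → pos 0 i + pos 2 i = 2 * i + 1
  -- Without `(0, 1)` the gap `0` lies partly outside the polygon, and its bridge is the boundary
  -- edge joining the ends of the outer rows. Declaring it split keeps all formulas uniform.
  left_absent : R.lo 1 = 1 → 0 ∈ split ∧ ∀ r, Outer r → pos r 0 = R.lo r
  right_absent : R.hi 1 = R.g → R.g ∈ split ∧ ∀ r, Outer r → pos r R.g = R.hi r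

/-- The triangle with apex `(i, 1)` over the edge from `(b, r)` to `(b + 1, r)`. -/
def fan (i r b : ℤ) : Set (ℤ × ℤ) := {(i, 1), (b, r), (b + 1, r)}

/-- The edge from `(i, 1)` to `(b, r)`. -/
def spoke (i r b : ℤ) : Set (ℤ × ℤ) := {(i, 1), (b, r)}

/-- The edge from `(i, 1)` to `(i + 1, 1)`. -/
def rung (i : ℤ) : Set (ℤ × ℤ) := {(i, 1), (i + 1, 1)}

/-- The edge from `(b, r)` to `(b + 1, r)`. -/
def rowEdge (r b : ℤ) : Set (ℤ × ℤ) := {(b, r), (b + 1, r)}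

namespace Staircase

variable {R : Rows} (S : Staircase R)

/-- The triangle on the edge from `(i, 1)` to `(i + 1, 1)`, with its third vertex in row `r`. -/
def flat (i r : ℤ) : Set (ℤ × ℤ) := {(i, 1), (i + 1, 1), (S.pos r i, r)}

/-- The triangle with vertex `(j, 1)` on the edge from `(pos 0 i, 0)` to `(pos 2 i, 2)`. -/
def wedge (i j : ℤ) : Set (ℤ × ℤ) := {(j, 1), (S.pos 0 i, 0), (S.pos 2 i, 2)}

/-- The edge from `(pos 0 i, 0)` to `(pos 2 i, 2)`. -/
def bridge (i : ℤ) : Set (ℤ × ℤ) := {(S.pos 0 i, 0), (S.pos 2 i, 2)}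

/-- The triangles of the triangulation. -/
inductive Cell : Set (ℤ × ℤ) → Prop
  | fan (i r b : ℤ) (hr : Outer r) (h0 : 0 ≤ i) (h1 : i ≤ R.g + 1) (hl : S.pos r (i - 1) ≤ b)
      (hu : b < S.pos r i) : Cell (fan i r b)
  | flat (i r : ℤ) (hr : Outer r) (h0 : 0 ≤ i) (h1 : i ≤ R.g) (hs : i ∉ S.split) :
      Cell (S.flat i r)
  | wedge (i j : ℤ) (h0 : 0 ≤ i) (h1 : i ≤ R.g) (hs : i ∈ S.split) (hj : j = i ∨ j = i + 1)
      (hlo : R.lo 1 ≤ j) (hhi : j ≤ R.hi 1) : Cell (S.wedge i j)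

/-- The triangulation given by the data `S`. -/
def triangulation : Set (Set (ℤ × ℤ)) := {t | S.Cell t}

/-- The edges dual to those of the skeleton. -/
inductive Core : Set (ℤ × ℤ) → Prop
  | spoke (i r b : ℤ) (hr : Outer r) (h0 : 1 ≤ i) (h1 : i ≤ R.g) (hl : S.pos r (i - 1) ≤ b)
      (hu : b ≤ S.pos r i) : Core (spoke i r b)
  | rung (i : ℤ) (h0 : 0 ≤ i) (h1 : i ≤ R.g) (hs : i ∉ S.split) : Core (rung i)
  | bridge (i : ℤ) (h0 : 1 ≤ i) (h1 : i ≤ R.g - 1) (hs : i ∈ S.split) : Core (S.bridge i)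

variable {S}

theorem pos_mono {r : ℤ} (hr : Outer r) {i j : ℤ} (hi : -1 ≤ i) (hij : i ≤ j)
    (hj : j ≤ R.g + 1) : S.pos r i ≤ S.pos r j := by
  induction j, hij using Int.leInduction with
  | base => exact le_rfl
  | succ n hn ih =>
    exact (ih (by omega)).trans (S.pos_le_succ r hr n (by omega) (by omega))

theorem lo_one_eq (R : Rows) : R.lo 1 = 0 ∨ R.lo 1 = 1 := by
  rcases R.left with h | h
  · exact Or.inl h.1
  · exact Or.inr h.1

theorem hi_one_eq (R : Rows) : R.hi 1 = R.g ∨ R.hi 1 = R.g + 1 := by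
  rcases R.right with h | h
  · exact Or.inr h.1
  · exact Or.inl h.1

/-! ### Incidences -/

theorem spoke_subset_fan {i r b i' r' b' : ℤ} (hr : Outer r) (hr' : Outer r') :
    spoke i r b ⊆ fan i' r' b' ↔ i = i' ∧ r = r' ∧ (b = b' ∨ b = b' + 1) := by
  rcases hr with rfl | rfl <;> rcases hr' with rfl | rfl <;>
    simp [spoke, TropicalModuli.fan, Set.insert_subset_iff]

theorem spoke_subset_flat {i r b i' r' : ℤ} (hr : Outer r) (hr' : Outer r') :
    spoke i r b ⊆ S.flat i' r' ↔ (i = i' ∨ i = i' + 1) ∧ r = r' ∧ b = S.pos r' i' := by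
  rcases hr with rfl | rfl <;> rcases hr' with rfl | rfl <;>
    simp [TropicalModuli.spoke, flat, Set.insert_subset_iff]

theorem spoke_subset_wedge {i r b i' j : ℤ} (hr : Outer r) :
    spoke i r b ⊆ S.wedge i' j ↔ i = j ∧ b = S.pos r i' := by
  rcases hr with rfl | rfl <;> simp [TropicalModuli.spoke, wedge, Set.insert_subset_iff]

theorem not_rung_subset_fan {i i' r b : ℤ} (hr : Outer r) : ¬ rung i ⊆ fan i' r b := by
  rcases hr with rfl | rfl <;>
    simp [TropicalModuli.rung, TropicalModuli.fan, Set.insert_subset_iff] <;> omega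

theorem rung_subset_flat {i i' r : ℤ} (hr : Outer r) : rung i ⊆ S.flat i' r ↔ i = i' := by
  rcases hr with rfl | rfl <;>
    simp [TropicalModuli.rung, flat, Set.insert_subset_iff] <;> omega

theorem not_rung_subset_wedge {i i' j : ℤ} : ¬ rung i ⊆ S.wedge i' j := by
  simp [TropicalModuli.rung, wedge, Set.insert_subset_iff]; omega

theorem not_bridge_subset_fan {i i' r b : ℤ} (hr : Outer r) : ¬ S.bridge i ⊆ fan i' r b := by
  rcases hr with rfl | rfl <;> simp [bridge, TropicalModuli.fan, Set.insert_subset_iff]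

theorem not_bridge_subset_flat {i i' r : ℤ} (hr : Outer r) : ¬ S.bridge i ⊆ S.flat i' r := by
  rcases hr with rfl | rfl <;> simp [bridge, flat, Set.insert_subset_iff]

theorem bridge_subset_wedge {i i' j : ℤ} :
    S.bridge i ⊆ S.wedge i' j ↔ S.pos 0 i = S.pos 0 i' ∧ S.pos 2 i = S.pos 2 i' := by
  simp [bridge, wedge, Set.insert_subset_iff]

theorem rowEdge_subset_fan {r b i r' b' : ℤ} (hr : Outer r) (hr' : Outer r') :
    rowEdge r b ⊆ fan i r' b' ↔ r = r' ∧ b = b' := by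
  rcases hr with rfl | rfl <;> rcases hr' with rfl | rfl <;>
    simp [rowEdge, TropicalModuli.fan, Set.insert_subset_iff] <;> omega

theorem not_rowEdge_subset_flat {r b i r' : ℤ} (hr : Outer r) (hr' : Outer r') :
    ¬ rowEdge r b ⊆ S.flat i r' := by
  rcases hr with rfl | rfl <;> rcases hr' with rfl | rfl <;>
    simp [rowEdge, flat, Set.insert_subset_iff] <;> omega

theorem not_rowEdge_subset_wedge {r b i j : ℤ} (hr : Outer r) :
    ¬ rowEdge r b ⊆ S.wedge i j := by
  rcases hr with rfl | rfl <;> simp [rowEdge, wedge, Set.insert_subset_iff] <;> omega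

theorem ncard_spoke {i r b : ℤ} (hr : Outer r) : (spoke i r b).ncard = 2 :=
  Set.ncard_pair (by rcases hr with rfl | rfl <;> simp)

theorem ncard_rung {i : ℤ} : (rung i).ncard = 2 := Set.ncard_pair (by simp)

theorem ncard_bridge {i : ℤ} : (S.bridge i).ncard = 2 := Set.ncard_pair (by simp)

theorem spoke_inj {i r b i' r' b' : ℤ} (hr : Outer r) (hr' : Outer r') :
    spoke i r b = spoke i' r' b' ↔ i = i' ∧ r = r' ∧ b = b' := by
  rcases hr with rfl | rfl <;> rcases hr' with rfl | rfl <;>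
    simp [TropicalModuli.spoke, Set.pair_eq_pair_iff]

theorem spoke_ne_rung {i r b i' : ℤ} (hr : Outer r) : spoke i r b ≠ rung i' := by
  rcases hr with rfl | rfl <;>
    simp [TropicalModuli.spoke, TropicalModuli.rung, Set.pair_eq_pair_iff]

theorem spoke_ne_bridge {i r b i' : ℤ} : spoke i r b ≠ S.bridge i' := by
  simp [TropicalModuli.spoke, bridge, Set.pair_eq_pair_iff]

theorem pair_of_subset_triple {α : Type*} {e : Set α} {p q r : α} (he : e.ncard = 2)
    (h : e ⊆ {p, q, r}) : e = {p, q} ∨ e = {p, r} ∨ e = {q, r} := by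
  obtain ⟨x, y, hxy, rfl⟩ := Set.ncard_eq_two.1 he
  rw [Set.insert_subset_iff, Set.singleton_subset_iff] at h
  simp only [Set.mem_insert_iff, Set.mem_singleton_iff] at h
  obtain ⟨h1, h2⟩ := h
  rcases h1 with rfl | rfl | rfl <;> rcases h2 with rfl | rfl | rfl <;>
    simp_all [Set.pair_comm]

theorem outer_zero : Outer 0 := Or.inl rfl

theorem outer_two : Outer 2 := Or.inr rfl

theorem outer_mirror {r : ℤ} (hr : Outer r) : Outer (2 - r) := by
  rcases hr with rfl | rfl
  · exact Or.inr rfl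
  · exact Or.inl rfl

/-- The sum `2 * i + 1` of the first coordinates recovers the gap from the bridge. -/
theorem split_inj {i i' : ℤ} (h0 : 0 ≤ i) (h1 : i ≤ R.g) (hs : i ∈ S.split) (h0' : 0 ≤ i')
    (h1' : i' ≤ R.g) (hs' : i' ∈ S.split) (e0 : S.pos 0 i = S.pos 0 i')
    (e2 : S.pos 2 i = S.pos 2 i') : i = i' := by
  have := S.split_sum i h0 h1 hs
  have := S.split_sum i' h0' h1' hs'
  omega

/-- By monotonicity the half-open intervals from `pos r (i - 1)` to `pos r i` are disjoint, so an
edge of an outer row has only one apex. -/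
theorem fan_index_unique {r b i i' : ℤ} (hr : Outer r) (h0 : 0 ≤ i) (h1 : i ≤ R.g + 1)
    (hl : S.pos r (i - 1) ≤ b) (hu : b < S.pos r i) (h0' : 0 ≤ i') (h1' : i' ≤ R.g + 1)
    (hl' : S.pos r (i' - 1) ≤ b) (hu' : b < S.pos r i') : i = i' := by
  rcases lt_trichotomy i i' with h | h | h
  · have := S.pos_mono hr (i := i) (j := i' - 1) (by omega) (by omega) (by omega)
    omega
  · exact h
  · have := S.pos_mono hr (i := i') (j := i - 1) (by omega) (by omega) (by omega)
    omega

/-- The triangles containing a given spoke. -/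
theorem cell_of_spoke_subset {i r b : ℤ} (hr : Outer r) {t : Set (ℤ × ℤ)} (ht : S.Cell t)
    (h : spoke i r b ⊆ t) :
    (t = fan i r b ∧ 0 ≤ i ∧ i ≤ R.g + 1 ∧ S.pos r (i - 1) ≤ b ∧ b < S.pos r i) ∨
    (t = fan i r (b - 1) ∧ 0 ≤ i ∧ i ≤ R.g + 1 ∧ S.pos r (i - 1) ≤ b - 1 ∧ b - 1 < S.pos r i) ∨
    (∃ k, (i = k ∨ i = k + 1) ∧ t = S.flat k r ∧ 0 ≤ k ∧ k ≤ R.g ∧ k ∉ S.split ∧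
      b = S.pos r k) ∨
    (∃ k, (i = k ∨ i = k + 1) ∧ t = S.wedge k i ∧ 0 ≤ k ∧ k ≤ R.g ∧ k ∈ S.split ∧
      b = S.pos r k) := by
  cases ht with
  | fan i' r' b' hr' h0 h1 hl hu =>
    obtain ⟨rfl, rfl, rfl | rfl⟩ := (spoke_subset_fan hr hr').1 h
    · exact Or.inl ⟨rfl, h0, h1, hl, hu⟩
    · refine Or.inr (Or.inl ⟨?_, h0, h1, ?_, ?_⟩)
      · simp
      · simpa using hl
      · simpa using hu
  | flat i' r' hr' h0 h1 hs =>
    obtain ⟨hi, rfl, hb⟩ := (spoke_subset_flat hr hr').1 h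
    exact Or.inr (Or.inr (Or.inl ⟨i', hi, rfl, h0, h1, hs, hb⟩))
  | wedge i' j h0 h1 hs hj hlo hhi =>
    obtain ⟨rfl, hb⟩ := (spoke_subset_wedge hr).1 h
    exact Or.inr (Or.inr (Or.inr ⟨i', hj, rfl, h0, h1, hs, hb⟩))

/-- The triangle to the right of a spoke, with its third vertex. -/
theorem exists_cell_right {i r b : ℤ} (hr : Outer r) (h0 : 1 ≤ i) (h1 : i ≤ R.g)
    (hl : S.pos r (i - 1) ≤ b) (hu : b ≤ S.pos r i) :
    ∃ x, S.Cell {(i, 1), (b, r), x} ∧ ((x = (b + 1, r) ∧ b < S.pos r i) ∨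
      (x = (i + 1, 1) ∧ b = S.pos r i ∧ i ∉ S.split) ∨
      (x = (2 * i + 1 - b, 2 - r) ∧ b = S.pos r i ∧ i ∈ S.split)) := by
  rcases hu.lt_or_eq with hu | rfl
  · exact ⟨_, Cell.fan i r b hr (by omega) (by omega) hl hu, Or.inl ⟨rfl, hu⟩⟩
  by_cases hs : i ∈ S.split
  · refine ⟨_, ?_, Or.inr (Or.inr ⟨rfl, rfl, hs⟩)⟩
    have hsum := S.split_sum i (by omega) h1 hs
    have hlo : R.lo 1 ≤ i := by rcases lo_one_eq R with h | h <;> omega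
    have hhi : i ≤ R.hi 1 := by rcases hi_one_eq R with h | h <;> omega
    convert Cell.wedge (S := S) i i (by omega) h1 hs (Or.inl rfl) hlo hhi using 1
    rcases hr with rfl | rfl
    · rw [show 2 * i + 1 - S.pos 0 i = S.pos 2 i by omega]; rfl
    · rw [show 2 * i + 1 - S.pos 2 i = S.pos 0 i by omega, wedge, Set.pair_comm (S.pos 2 i, 2)]
      rfl
  · refine ⟨_, ?_, Or.inr (Or.inl ⟨rfl, rfl, hs⟩)⟩
    convert Cell.flat (S := S) i r hr (by omega) h1 hs using 1
    rw [flat, Set.pair_comm (i + 1, 1)]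

/-- The triangle to the left of a spoke, with its third vertex. -/
theorem exists_cell_left {i r b : ℤ} (hr : Outer r) (h0 : 1 ≤ i) (h1 : i ≤ R.g)
    (hl : S.pos r (i - 1) ≤ b) (hu : b ≤ S.pos r i) :
    ∃ x, S.Cell {(i, 1), (b, r), x} ∧ ((x = (b - 1, r) ∧ S.pos r (i - 1) < b) ∨
      (x = (i - 1, 1) ∧ b = S.pos r (i - 1) ∧ i - 1 ∉ S.split) ∨
      (x = (2 * i - 1 - b, 2 - r) ∧ b = S.pos r (i - 1) ∧ i - 1 ∈ S.split)) := by
  rcases hl.lt_or_eq with hl | rfl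
  · refine ⟨_, ?_, Or.inl ⟨rfl, hl⟩⟩
    convert Cell.fan (S := S) i r (b - 1) hr (by omega) (by omega) (by omega) (by omega) using 1
    rw [TropicalModuli.fan, sub_add_cancel, Set.pair_comm (b, r)]
  by_cases hs : i - 1 ∈ S.split
  · refine ⟨_, ?_, Or.inr (Or.inr ⟨rfl, rfl, hs⟩)⟩
    have hsum := S.split_sum (i - 1) (by omega) (by omega) hs
    have hlo : R.lo 1 ≤ i := by rcases lo_one_eq R with h | h <;> omega
    have hhi : i ≤ R.hi 1 := by rcases hi_one_eq R with h | h <;> omega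
    convert Cell.wedge (S := S) (i - 1) i (by omega) (by omega) hs (Or.inr (by omega)) hlo hhi
      using 1
    rcases hr with rfl | rfl
    · rw [show 2 * i - 1 - S.pos 0 (i - 1) = S.pos 2 (i - 1) by omega]; rfl
    · rw [show 2 * i - 1 - S.pos 2 (i - 1) = S.pos 0 (i - 1) by omega, wedge,
        Set.pair_comm (S.pos 2 (i - 1), 2)]
      rfl
  · refine ⟨_, ?_, Or.inr (Or.inl ⟨rfl, rfl, hs⟩)⟩
    convert Cell.flat (S := S) (i - 1) r hr (by omega) (by omega) hs using 1
    rw [flat, sub_add_cancel]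
    ext x; simp only [Set.mem_insert_iff, Set.mem_singleton_iff]; tauto

/-! ### The core -/

/-- Each edge has a triangle on either side; the two are told apart by their third vertices. -/
theorem Core.mem_boundedEdges {e : Set (ℤ × ℤ)} (he : S.Core e) :
    e ∈ boundedEdges S.triangulation := by
  cases he with
  | spoke i r b hr h0 h1 hl hu =>
    obtain ⟨x, hx, hx'⟩ := S.exists_cell_right hr h0 h1 hl hu
    obtain ⟨y, hy, hy'⟩ := S.exists_cell_left hr h0 h1 hl hu
    refine ⟨ncard_spoke hr, _, hx, _, hy, ?_, ?_, ?_⟩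
    · intro heq
      have hmem : x ∈ ({(i, 1), (b, r), y} : Set (ℤ × ℤ)) := by rw [← heq]; simp
      simp only [Set.mem_insert_iff, Set.mem_singleton_iff] at hmem
      rcases hr with rfl | rfl <;>
      rcases hx' with ⟨rfl, -⟩ | ⟨rfl, -⟩ | ⟨rfl, -⟩ <;>
      rcases hy' with ⟨rfl, -⟩ | ⟨rfl, -⟩ | ⟨rfl, -⟩ <;>
      simp only [Prod.mk.injEq] at hmem <;> omega
    · simp [TropicalModuli.spoke, Set.insert_subset_iff]
    · simp [TropicalModuli.spoke, Set.insert_subset_iff]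
  | rung i h0 h1 hs =>
    refine ⟨ncard_rung, _, Cell.flat i 0 outer_zero h0 h1 hs, _, Cell.flat i 2 outer_two h0 h1 hs,
      ?_, (rung_subset_flat outer_zero).2 rfl, (rung_subset_flat outer_two).2 rfl⟩
    intro heq
    have : (S.pos 0 i, (0 : ℤ)) ∈ S.flat i 2 := by rw [← heq]; simp [flat]
    simp [flat] at this
  | bridge i h0 h1 hs =>
    have hlo : R.lo 1 ≤ i := by rcases lo_one_eq R with h | h <;> omega
    have hhi : i + 1 ≤ R.hi 1 := by rcases hi_one_eq R with h | h <;> omega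
    refine ⟨ncard_bridge,
      _, Cell.wedge i i (by omega) (by omega) hs (Or.inl rfl) hlo (by omega),
      _, Cell.wedge i (i + 1) (by omega) (by omega) hs (Or.inr rfl) (by omega) hhi,
      ?_, bridge_subset_wedge.2 ⟨rfl, rfl⟩, bridge_subset_wedge.2 ⟨rfl, rfl⟩⟩
    intro heq
    have : (i, (1 : ℤ)) ∈ S.wedge i (i + 1) := by rw [← heq]; simp [wedge]
    simp [wedge] at this

/-- The outer vertex of a gap is an extreme position in the fans of both neighbouring middle points,
so its spokes belong to the core whenever these points are interior. -/
theorem core_spoke_of_wedge {i j r : ℤ} (hr : Outer r) (hj : j = i ∨ j = i + 1) (h0 : 1 ≤ j)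
    (h1 : j ≤ R.g) : S.Core (spoke j r (S.pos r i)) := by
  refine Core.spoke j r _ hr h0 h1 ?_ ?_
  · rcases hj with rfl | rfl
    · exact S.pos_mono hr (by omega) (by omega) (by omega)
    · simp
  · rcases hj with rfl | rfl
    · exact le_rfl
    · exact S.pos_mono hr (by omega) (by omega) (by omega)

/-- The proposed core has no leaves. In a fan the other spoke continues, in a flat triangle the rung
does, and in a wedge the spoke to the opposite row does. -/
theorem Core.exists_other {e t : Set (ℤ × ℤ)} (he : S.Core e) (ht : S.Cell t) (h : e ⊆ t) :
    ∃ e', S.Core e' ∧ e' ≠ e ∧ e' ⊆ t := by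
  cases he with
  | spoke i r b hr h0 h1 hl hu =>
    rcases S.cell_of_spoke_subset hr ht h with ⟨rfl, -, -, hl', hu'⟩ | ⟨rfl, -, -, hl', hu'⟩ |
      ⟨k, hk, rfl, hk0, hk1, hs, rfl⟩ | ⟨k, hk, rfl, hk0, hk1, hs, rfl⟩
    · refine ⟨_, Core.spoke i r (b + 1) hr h0 h1 (by omega) (by omega), ?_, ?_⟩
      · rw [Ne, spoke_inj hr hr]; omega
      · rw [spoke_subset_fan hr hr]; omega
    · refine ⟨_, Core.spoke i r (b - 1) hr h0 h1 (by omega) (by omega), ?_, ?_⟩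
      · rw [Ne, spoke_inj hr hr]; omega
      · rw [spoke_subset_fan hr hr]; omega
    · exact ⟨_, Core.rung k hk0 hk1 hs, (spoke_ne_rung hr).symm, (rung_subset_flat hr).2 rfl⟩
    · refine ⟨_, core_spoke_of_wedge (outer_mirror hr) hk h0 h1, ?_, ?_⟩
      · rw [Ne, spoke_inj (outer_mirror hr) hr]
        rcases hr with rfl | rfl <;> omega
      · rw [spoke_subset_wedge (outer_mirror hr)]; exact ⟨rfl, rfl⟩
  | rung i h0 h1 hs =>
    cases ht with
    | fan i' r' b' hr' _ _ _ _ => exact absurd h (not_rung_subset_fan hr')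
    | flat i' r' hr' h0' h1' hs' =>
      obtain rfl := (rung_subset_flat hr').1 h
      by_cases hi : 1 ≤ i
      · exact ⟨_, core_spoke_of_wedge hr' (Or.inl rfl) hi h1, spoke_ne_rung hr',
          (spoke_subset_flat hr' hr').2 ⟨Or.inl rfl, rfl, rfl⟩⟩
      · have := R.two_le
        exact ⟨_, core_spoke_of_wedge hr' (Or.inr rfl) (by omega) (by omega), spoke_ne_rung hr',
          (spoke_subset_flat hr' hr').2 ⟨Or.inr rfl, rfl, rfl⟩⟩
    | wedge i' j _ _ _ _ _ _ => exact absurd h not_rung_subset_wedge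
  | bridge i h0 h1 hs =>
    cases ht with
    | fan i' r' b' hr' _ _ _ _ => exact absurd h (not_bridge_subset_fan hr')
    | flat i' r' hr' _ _ _ => exact absurd h (not_bridge_subset_flat hr')
    | wedge i' j h0' h1' hs' hj _ _ =>
      obtain ⟨e0, e2⟩ := bridge_subset_wedge.1 h
      obtain rfl := split_inj (by omega) (by omega) hs h0' h1' hs' e0 e2
      exact ⟨_, core_spoke_of_wedge outer_zero hj (by omega) (by omega), spoke_ne_bridge,
        (spoke_subset_wedge outer_zero).2 ⟨rfl, rfl⟩⟩

variable (S) in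
/-- A set of bounded edges without leaves. -/
structure Leafless (F : Set (Set (ℤ × ℤ))) : Prop where
  bounded : F ⊆ boundedEdges S.triangulation
  other : ∀ e ∈ F, ∀ t ∈ S.triangulation, e ⊆ t → ∃ e' ∈ F, e' ≠ e ∧ e' ⊆ t

/-- Edges of an outer row lie on the boundary of the polygon: they have a single triangle and are
dual to rays. -/
theorem rowEdge_notMem {F : Set (Set (ℤ × ℤ))} (hF : S.Leafless F)
    {r b : ℤ} (hr : Outer r) : rowEdge r b ∉ F := by
  intro h
  obtain ⟨-, t, ht, t', ht', hne, hs, hs'⟩ := hF.bounded h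
  cases ht with
  | flat i' r' hr' _ _ _ => exact not_rowEdge_subset_flat hr hr' hs
  | wedge i' j _ _ _ _ _ _ => exact not_rowEdge_subset_wedge hr hs
  | fan i₁ r₁ b₁ hr₁ h0 h1 hl hu =>
    cases ht' with
    | flat i' r' hr' _ _ _ => exact not_rowEdge_subset_flat hr hr' hs'
    | wedge i' j _ _ _ _ _ _ => exact not_rowEdge_subset_wedge hr hs'
    | fan i₂ r₂ b₂ hr₂ h0' h1' hl' hu' =>
      obtain ⟨rfl, rfl⟩ := (rowEdge_subset_fan hr hr₁).1 hs
      obtain ⟨rfl, rfl⟩ := (rowEdge_subset_fan hr hr₂).1 hs'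
      exact hne (by rw [fan_index_unique hr h0 h1 hl hu h0' h1' hl' hu'])

/-- The third edge of a fan triangle is dual to a ray, so a leafless set contains both of its spokes
or neither. -/
theorem edge_of_mem_fan {F : Set (Set (ℤ × ℤ))} (hF : S.Leafless F)
    {i r b : ℤ} (hr : Outer r) (ht : S.Cell (fan i r b)) {e : Set (ℤ × ℤ)}
    (he : e ∈ F) (h : e ⊆ fan i r b) : spoke i r b ∈ F ∧ spoke i r (b + 1) ∈ F := by
  have key : ∀ e ∈ F, e ⊆ TropicalModuli.fan i r b → e = spoke i r b ∨ e = spoke i r (b + 1) := by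
    intro e he h
    rcases pair_of_subset_triple (hF.bounded he).1 h with h | h | h
    · exact Or.inl h
    · exact Or.inr h
    · exact absurd (h ▸ he) (rowEdge_notMem hF hr)
  obtain ⟨e', he', hne, h'⟩ := hF.other e he _ ht h
  rcases key e he h with rfl | rfl <;> rcases key e' he' h' with rfl | rfl
  · exact absurd rfl hne
  · exact ⟨he, he'⟩
  · exact ⟨he', he⟩
  · exact absurd rfl hne

/-- The spokes at the boundary point `(0, 1)` form a tail. A spoke shared by two triangles must have
the fan to its left as one of them, so a leafless set containing it contains the previous spoke as
well; this descends past the end of the row. -/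
theorem spoke_zero_notMem {F : Set (Set (ℤ × ℤ))} (hF : S.Leafless F)
    {r b : ℤ} (hr : Outer r) : spoke 0 r b ∉ F := by
  have step : ∀ b, spoke 0 r b ∈ F → R.lo r ≤ b - 1 ∧ spoke 0 r (b - 1) ∈ F := by
    intro b h
    have hcell : S.Cell (fan 0 r (b - 1)) ∧ R.lo r ≤ b - 1 := by
      obtain ⟨-, t, ht, t', ht', hne, hs, hs'⟩ := hF.bounded h
      have hlo := S.pos_neg_one r hr
      rcases S.cell_of_spoke_subset hr ht hs with ⟨rfl, -, -, hl, hu⟩ | ⟨rfl, -, -, hl, hu⟩ |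
        ⟨k, hk, rfl, hk0, hk1, hsk, rfl⟩ | ⟨k, hk, rfl, hk0, hk1, hsk, rfl⟩ <;>
      rcases S.cell_of_spoke_subset hr ht' hs' with ⟨rfl, -, -, hl', hu'⟩ |
        ⟨rfl, -, -, hl', hu'⟩ |
        ⟨k', hk', rfl, hk0', hk1', hsk', hb⟩ | ⟨k', hk', rfl, hk0', hk1', hsk', hb⟩ <;>
      first
      | exact ⟨ht, by rw [← hlo]; simpa using hl⟩
      | exact ⟨ht', by rw [← hlo]; simpa using hl'⟩
      -- Without the left fan there is only one candidate: the next fan needs `b < pos r 0`, the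
      -- other cells need `b = pos r 0`, and a flat triangle and a wedge exclude each other.
      | (exfalso
         try obtain rfl : k = 0 := by omega
         try obtain rfl : k' = 0 := by omega
         first
         | exact hne rfl
         | exact hsk hsk'
         | exact hsk' hsk
         | omega)
    have hmem : spoke 0 r b ⊆ fan 0 r (b - 1) := by
      rw [spoke_subset_fan hr hr]; omega
    exact ⟨hcell.2, (S.edge_of_mem_fan hF hr hcell.1 h hmem).1⟩
  have main : ∀ n : ℕ, ∀ b, b ≤ R.lo r + n → spoke 0 r b ∉ F := by
    intro n
    induction n with
    | zero => intro b hb h; have := (step b h).1; simp at hb; omega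
    | succ n ih => intro b hb h; exact ih (b - 1) (by push_cast at hb; omega) (step b h).2
  exact main (b - R.lo r).toNat b (by omega)

theorem spoke_last_notMem {F : Set (Set (ℤ × ℤ))} (hF : S.Leafless F)
    {r b : ℤ} (hr : Outer r) : spoke (R.g + 1) r b ∉ F := by
  have step : ∀ b, spoke (R.g + 1) r b ∈ F →
      b + 1 ≤ R.hi r ∧ spoke (R.g + 1) r (b + 1) ∈ F := by
    intro b h
    have hcell : S.Cell (fan (R.g + 1) r b) ∧ b + 1 ≤ R.hi r := by
      obtain ⟨-, t, ht, t', ht', hne, hs, hs'⟩ := hF.bounded h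
      have hhi := S.pos_last r hr
      rcases S.cell_of_spoke_subset hr ht hs with ⟨rfl, -, -, hl, hu⟩ | ⟨rfl, -, -, hl, hu⟩ |
        ⟨k, hk, rfl, hk0, hk1, hsk, rfl⟩ | ⟨k, hk, rfl, hk0, hk1, hsk, rfl⟩ <;>
      rcases S.cell_of_spoke_subset hr ht' hs' with ⟨rfl, -, -, hl', hu'⟩ |
        ⟨rfl, -, -, hl', hu'⟩ |
        ⟨k', hk', rfl, hk0', hk1', hsk', hb⟩ | ⟨k', hk', rfl, hk0', hk1', hsk', hb⟩ <;>
      first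
      | exact ⟨ht, by omega⟩
      | exact ⟨ht', by omega⟩
      | (exfalso
         try obtain rfl : k = R.g := by omega
         try obtain rfl : k' = R.g := by omega
         try simp only [add_sub_cancel_right] at hl hu
         try simp only [add_sub_cancel_right] at hl' hu'
         first
         | exact hne rfl
         | exact hsk hsk'
         | exact hsk' hsk
         | omega)
    have hmem : spoke (R.g + 1) r b ⊆ fan (R.g + 1) r b := by
      rw [spoke_subset_fan hr hr]; omega
    exact ⟨hcell.2, (S.edge_of_mem_fan hF hr hcell.1 h hmem).2⟩
  have main : ∀ n : ℕ, ∀ b, R.hi r ≤ b + n → spoke (R.g + 1) r b ∉ F := by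
    intro n
    induction n with
    | zero => intro b hb h; have := (step b h).1; simp at hb; omega
    | succ n ih => intro b hb h; exact ih (b + 1) (by push_cast at hb; omega) (step b h).2
  exact main (R.hi r - b).toNat b (by omega)

theorem core_spoke_of_mem {F : Set (Set (ℤ × ℤ))} (hF : S.Leafless F)
    {i r b : ℤ} (hr : Outer r) (h0 : 0 ≤ i) (h1 : i ≤ R.g + 1)
    (hl : S.pos r (i - 1) ≤ b) (hu : b ≤ S.pos r i) (h : spoke i r b ∈ F) :
    S.Core (spoke i r b) := by
  rcases h0.eq_or_lt with rfl | h0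
  · exact absurd h (S.spoke_zero_notMem hF hr)
  rcases h1.eq_or_lt with rfl | h1
  · exact absurd h (S.spoke_last_notMem hF hr)
  · exact Core.spoke i r b hr (by omega) (by omega) hl hu

/-- A bridge at an extreme gap leads only to spokes of `(0, 1)` or `(g + 1, 1)`, which are pruned,
or is itself a boundary edge. -/
theorem bridge_mem_range {F : Set (Set (ℤ × ℤ))} (hF : S.Leafless F)
    {i : ℤ} (h0 : 0 ≤ i) (h1 : i ≤ R.g) (hs : i ∈ S.split)
    (h : S.bridge i ∈ F) : 1 ≤ i ∧ i ≤ R.g - 1 := by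
  have cells : S.Cell (S.wedge i i) ∧ S.Cell (S.wedge i (i + 1)) := by
    obtain ⟨-, t, ht, t', ht', hne, hs, hs'⟩ := hF.bounded h
    cases ht with
    | fan _ _ _ hr _ _ _ _ => exact absurd hs (not_bridge_subset_fan hr)
    | flat _ _ hr _ _ _ => exact absurd hs (not_bridge_subset_flat hr)
    | wedge k j k0 k1 ks kj klo khi =>
      cases ht' with
      | fan _ _ _ hr _ _ _ _ => exact absurd hs' (not_bridge_subset_fan hr)
      | flat _ _ hr _ _ _ => exact absurd hs' (not_bridge_subset_flat hr)
      | wedge k' j' k0' k1' ks' kj' klo' khi' =>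
        obtain ⟨e0, e2⟩ := bridge_subset_wedge.1 hs
        obtain ⟨e0', e2'⟩ := bridge_subset_wedge.1 hs'
        obtain rfl := split_inj h0 h1 ‹_› k0 k1 ks e0 e2
        obtain rfl := split_inj h0 h1 ‹_› k0' k1' ks' e0' e2'
        have c := Cell.wedge i j k0 k1 ks kj klo khi
        have c' := Cell.wedge i j' k0 k1 ks kj' klo' khi'
        rcases kj with rfl | rfl <;> rcases kj' with rfl | rfl
        · exact absurd rfl hne
        · exact ⟨c, c'⟩
        · exact ⟨c', c⟩
        · exact absurd rfl hne
  have other : ∀ j, S.Cell (S.wedge i j) → ∃ r, Outer r ∧ spoke j r (S.pos r i) ∈ F := by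
    intro j hj
    obtain ⟨e', he', hne, hsub⟩ := hF.other _ h _ hj (bridge_subset_wedge.2 ⟨rfl, rfl⟩)
    rcases pair_of_subset_triple (hF.bounded he').1 hsub with h | h | h
    · exact ⟨0, outer_zero, by rwa [h] at he'⟩
    · exact ⟨2, outer_two, by rwa [h] at he'⟩
    · exact absurd h hne
  constructor
  · by_contra hi
    obtain rfl : i = 0 := by omega
    obtain ⟨r, hr, hm⟩ := other 0 cells.1
    exact S.spoke_zero_notMem hF hr hm
  · by_contra hi
    obtain rfl : i = R.g := by omega
    obtain ⟨r, hr, hm⟩ := other (R.g + 1) cells.2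
    exact S.spoke_last_notMem hF hr hm

theorem core_of_mem {F : Set (Set (ℤ × ℤ))} (hF : S.Leafless F)
    {e : Set (ℤ × ℤ)} (he : e ∈ F) : S.Core e := by
  obtain ⟨h2, t, ht, -, -, -, hs, -⟩ := hF.bounded he
  cases ht with
  | fan i r b hr h0 h1 hl hu =>
    rcases pair_of_subset_triple h2 hs with h | h | h
    · rw [h] at he ⊢
      exact S.core_spoke_of_mem hF hr h0 h1 hl hu.le he
    · rw [h] at he ⊢
      exact S.core_spoke_of_mem hF hr h0 h1 (by omega) (by omega) he
    · exact absurd (h ▸ he) (S.rowEdge_notMem hF hr)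
  | flat i r hr h0 h1 hn =>
    rcases pair_of_subset_triple h2 hs with h | h | h
    · rw [h]; exact Core.rung i h0 h1 hn
    · rw [h] at he ⊢
      exact S.core_spoke_of_mem hF hr h0 (by omega)
        (S.pos_mono hr (by omega) (by omega) (by omega)) le_rfl he
    · rw [h] at he ⊢
      exact S.core_spoke_of_mem hF hr (by omega) (by omega) (by simp)
        (S.pos_mono hr (by omega) (by omega) (by omega)) he
  | wedge i j h0 h1 hn hj hlo hhi =>
    have hj' : ∀ r, Outer r → spoke j r (S.pos r i) ∈ F → S.Core (spoke j r (S.pos r i)) := by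
      intro r hr hm
      rcases hj with rfl | rfl
      · exact S.core_spoke_of_mem hF hr h0 (by omega)
          (S.pos_mono hr (by omega) (by omega) (by omega)) le_rfl hm
      · exact S.core_spoke_of_mem hF hr (by omega) (by omega) (by simp)
          (S.pos_mono hr (by omega) (by omega) (by omega)) hm
    rcases pair_of_subset_triple h2 hs with h | h | h
    · rw [h] at he ⊢; exact hj' 0 outer_zero he
    · rw [h] at he ⊢; exact hj' 2 outer_two he
    · rw [h] at he ⊢
      obtain ⟨a, b⟩ := S.bridge_mem_range hF h0 h1 hn he
      exact Core.bridge i a b hn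

variable (S) in
-- The union of all leafless sets is attained: the explicit core is leafless and contains every
-- other leafless set.
theorem mem_coreEdges {e : Set (ℤ × ℤ)} : e ∈ coreEdges S.triangulation ↔ S.Core e := by
  constructor
  · rintro ⟨F, ⟨hF, hF'⟩, he⟩
    exact core_of_mem ⟨hF, hF'⟩ he
  · intro he
    refine ⟨{e | S.Core e}, ⟨fun e he => Core.mem_boundedEdges he, ?_⟩, he⟩
    intro e he t ht h
    obtain ⟨e', h1, h2, h3⟩ := Core.exists_other he ht h
    exact ⟨e', h1, h2, h3⟩

end Staircase

end TropicalModuli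

end


noncomputable section

namespace TropicalModuli

/-! ### Edges of the skeleton -/

/-- If `C` is a set of remaining edges that is closed under concatenation and whose elements are
all concatenated with each other, then it forms an edge of the skeleton. -/
theorem skeletonLength_eq_finsum {T C : Set (Set (ℤ × ℤ))} (hC : C ⊆ coreEdges T)
    (hclosed : ∀ e e' : coreEdges T, Concatenated T e e' → e.1 ∈ C → e'.1 ∈ C)
    (hconn : ∀ e e' : coreEdges T, e.1 ∈ C → e'.1 ∈ C →
      Quot.mk (Concatenated T) e = Quot.mk (Concatenated T) e')
    (P : Set (ℝ × ℝ)) (ω : ℤ × ℤ → ℝ) (e : coreEdges T) (he : e.1 ∈ C) :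
    skeletonLength P T ω (Quot.mk _ e) = ∑ᶠ e' ∈ C, latticeLength (dualEdge P ω e') := by
  have hsymm : ∀ e e' : coreEdges T, Concatenated T e e' → Concatenated T e' e :=
    fun e e' ⟨t, ht, h1, h2, h3⟩ => ⟨t, ht, h2, h1, h3⟩
  have hmem : ∀ e' : coreEdges T, Quot.mk (Concatenated T) e' = Quot.mk _ e ↔ e'.1 ∈ C := by
    intro e'
    constructor
    · intro h
      -- Being closed under concatenation in both directions, membership in `C` descends to the
      -- quotient.
      let f : SkeletonEdge T → Prop := Quot.lift (fun x : coreEdges T => x.1 ∈ C)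
        fun a b hab => propext ⟨hclosed a b hab, hclosed b a (hsymm a b hab)⟩
      have : f (Quot.mk _ e') = f (Quot.mk _ e) := congrArg f h
      exact (iff_of_eq this).2 he
    · exact fun h => hconn e' e h he
  rw [← finsum_set_coe_eq_finsum_mem]
  refine finsum_eq_of_bijective
    (fun x : {e' : coreEdges T // Quot.mk (Concatenated T) e' = Quot.mk _ e} =>
      (⟨x.1.1, (hmem x.1).1 x.2⟩ : C)) ⟨?_, ?_⟩ fun x => rfl
  · intro x y h
    exact Subtype.ext (Subtype.ext (congrArg (fun z : C => z.1) h))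
  · rintro ⟨y, hy⟩
    exact ⟨⟨⟨y, hC hy⟩, (hmem _).2 hy⟩, rfl⟩

namespace Staircase

variable {R : Rows} {S : Staircase R}

theorem Core.subset_fan {e : Set (ℤ × ℤ)} (he : S.Core e) {i r b : ℤ} (hr : Outer r)
    (h : e ⊆ fan i r b) : e = TropicalModuli.spoke i r b ∨ e = TropicalModuli.spoke i r (b + 1) := by
  cases he with
  | spoke i' r' b' hr' _ _ _ _ =>
    obtain ⟨rfl, rfl, rfl | rfl⟩ := (spoke_subset_fan hr' hr).1 h
    · exact Or.inl rfl
    · exact Or.inr rfl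
  | rung i' _ _ _ => exact absurd h (not_rung_subset_fan hr)
  | bridge i' _ _ _ => exact absurd h (not_bridge_subset_fan hr)

theorem Core.subset_flat {e : Set (ℤ × ℤ)} (he : S.Core e) {i r : ℤ} (hr : Outer r)
    (h : e ⊆ S.flat i r) : e = TropicalModuli.rung i ∨ (1 ≤ i ∧ e = TropicalModuli.spoke i r (S.pos r i)) ∨
      (i + 1 ≤ R.g ∧ e = TropicalModuli.spoke (i + 1) r (S.pos r i)) := by
  cases he with
  | spoke i' r' b' hr' h0 h1 _ _ =>
    obtain ⟨rfl | rfl, rfl, rfl⟩ := (spoke_subset_flat hr' hr).1 h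
    · exact Or.inr (Or.inl ⟨h0, rfl⟩)
    · exact Or.inr (Or.inr ⟨h1, rfl⟩)
  | rung i' _ _ _ =>
    obtain rfl := (rung_subset_flat hr).1 h
    exact Or.inl rfl
  | bridge i' _ _ _ => exact absurd h (not_bridge_subset_flat hr)

theorem Core.subset_wedge {e : Set (ℤ × ℤ)} (he : S.Core e) {i j : ℤ} (h0 : 0 ≤ i)
    (h1 : i ≤ R.g) (hs : i ∈ S.split) (h : e ⊆ S.wedge i j) :
    (e = S.bridge i ∧ 1 ≤ i ∧ i ≤ R.g - 1) ∨ ∃ r, Outer r ∧ e = TropicalModuli.spoke j r (S.pos r i) := by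
  cases he with
  | spoke i' r' b' hr' _ _ _ _ =>
    obtain ⟨rfl, rfl⟩ := (spoke_subset_wedge hr').1 h
    exact Or.inr ⟨r', hr', rfl⟩
  | rung i' _ _ _ => exact absurd h not_rung_subset_wedge
  | bridge i' h0' h1' hs' =>
    obtain ⟨e0, e2⟩ := bridge_subset_wedge.1 h
    obtain rfl := split_inj (by omega) (by omega) hs' h0 h1 hs e0 e2
    exact Or.inl ⟨rfl, h0', h1'⟩

theorem ncard_ne_two_of_three {α : Type*} {s : Set α} {x y z : α} (hx : x ∈ s) (hy : y ∈ s)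
    (hz : z ∈ s) (hxy : x ≠ y) (hxz : x ≠ z) (hyz : y ≠ z) : s.ncard ≠ 2 := by
  intro h
  obtain ⟨a, b, -, rfl⟩ := Set.ncard_eq_two.1 h
  simp only [Set.mem_insert_iff, Set.mem_singleton_iff] at hx hy hz
  rcases hx with rfl | rfl <;> rcases hy with rfl | rfl <;> rcases hz with rfl | rfl <;>
    simp_all

/-- A rung between two interior points meets a spoke of each of them, so its ends are genuine
trivalent vertices and no concatenation happens there. -/
theorem degree_flat {i r : ℤ} (hr : Outer r) (h0 : 1 ≤ i) (h1 : i ≤ R.g - 1)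
    (hs : i ∉ S.split) : {f | f ∈ coreEdges S.triangulation ∧ f ⊆ S.flat i r}.ncard ≠ 2 := by
  refine ncard_ne_two_of_three (x := rung i) (y := spoke i r (S.pos r i))
    (z := spoke (i + 1) r (S.pos r i)) ⟨?_, ?_⟩ ⟨?_, ?_⟩ ⟨?_, ?_⟩ ?_ ?_ ?_
  · exact S.mem_coreEdges.2 (Core.rung i (by omega) (by omega) hs)
  · exact (rung_subset_flat hr).2 rfl
  · exact S.mem_coreEdges.2 (core_spoke_of_wedge hr (Or.inl rfl) (by omega) (by omega))
  · exact (spoke_subset_flat hr hr).2 ⟨Or.inl rfl, rfl, rfl⟩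
  · exact S.mem_coreEdges.2 (core_spoke_of_wedge hr (Or.inr rfl) (by omega) (by omega))
  · exact (spoke_subset_flat hr hr).2 ⟨Or.inr rfl, rfl, rfl⟩
  · exact (spoke_ne_rung hr).symm
  · exact (spoke_ne_rung hr).symm
  · rw [Ne, spoke_inj hr hr]; omega

theorem degree_wedge {i j : ℤ} (hj : j = i ∨ j = i + 1) (h0 : 1 ≤ i) (h1 : i ≤ R.g - 1)
    (hs : i ∈ S.split) : {f | f ∈ coreEdges S.triangulation ∧ f ⊆ S.wedge i j}.ncard ≠ 2 := by
  refine ncard_ne_two_of_three (x := S.bridge i) (y := spoke j 0 (S.pos 0 i))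
    (z := spoke j 2 (S.pos 2 i)) ⟨?_, ?_⟩ ⟨?_, ?_⟩ ⟨?_, ?_⟩ ?_ ?_ ?_
  · exact S.mem_coreEdges.2 (Core.bridge i (by omega) (by omega) hs)
  · exact bridge_subset_wedge.2 ⟨rfl, rfl⟩
  · exact S.mem_coreEdges.2 (core_spoke_of_wedge outer_zero hj (by omega) (by omega))
  · exact (spoke_subset_wedge outer_zero).2 ⟨rfl, rfl⟩
  · exact S.mem_coreEdges.2 (core_spoke_of_wedge outer_two hj (by omega) (by omega))
  · exact (spoke_subset_wedge outer_two).2 ⟨rfl, rfl⟩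
  · exact spoke_ne_bridge.symm
  · exact spoke_ne_bridge.symm
  · rw [Ne, spoke_inj outer_zero outer_two]; omega

/-- The class of a core edge in the skeleton. -/
def cls {e : Set (ℤ × ℤ)} (he : S.Core e) : SkeletonEdge S.triangulation :=
  Quot.mk _ ⟨e, S.mem_coreEdges.2 he⟩

theorem cls_eq_of_cell {e e' t : Set (ℤ × ℤ)} (he : S.Core e) (he' : S.Core e') (ht : S.Cell t)
    (h : e ⊆ t) (h' : e' ⊆ t) (hne : e ≠ e')
    (hall : ∀ f, S.Core f → f ⊆ t → f = e ∨ f = e') : cls he = cls he' := by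
  refine Quot.sound ⟨t, ht, h, h', ?_⟩
  have : {f | f ∈ coreEdges S.triangulation ∧ f ⊆ t} = {e, e'} := by
    ext f
    constructor
    · rintro ⟨hf, hft⟩
      exact hall f (S.mem_coreEdges.1 hf) hft
    · rintro (rfl | rfl)
      · exact ⟨S.mem_coreEdges.2 he, h⟩
      · exact ⟨S.mem_coreEdges.2 he', h'⟩
  rw [this, Set.ncard_pair hne]

/-- Consecutive spokes meet in a fan triangle, which is a vertex of degree two once its ray is
removed. -/
theorem cls_spoke_eq {i r b b' : ℤ} (hr : Outer r) (h0 : 1 ≤ i) (h1 : i ≤ R.g)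
    (he : S.Core (spoke i r b)) (he' : S.Core (spoke i r b')) (hl : S.pos r (i - 1) ≤ b)
    (hbb : b ≤ b') (hu : b' ≤ S.pos r i) : cls he = cls he' := by
  induction b', hbb using Int.leInduction with
  | base => rfl
  | succ n hn ih =>
    have hn' : S.Core (spoke i r n) := Core.spoke i r n hr h0 h1 (by omega) (by omega)
    rw [ih hn' (by omega)]
    refine cls_eq_of_cell hn' he' (Cell.fan i r n hr (by omega) (by omega) (by omega) (by omega))
      ?_ ?_ ?_ fun f hf hft => hf.subset_fan hr hft
    · rw [spoke_subset_fan hr hr]; omega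
    · rw [spoke_subset_fan hr hr]; omega
    · rw [Ne, spoke_inj hr hr]; omega

/-- The spokes from `(i, 1)` to row `r` that belong to the core. -/
def spokes (S : Staircase R) (i r : ℤ) : Set (Set (ℤ × ℤ)) :=
  spoke i r '' (Finset.Icc (S.pos r (i - 1)) (S.pos r i))

theorem mem_spokes {i r : ℤ} {e : Set (ℤ × ℤ)} : e ∈ S.spokes i r ↔
    ∃ b, S.pos r (i - 1) ≤ b ∧ b ≤ S.pos r i ∧ e = spoke i r b := by
  simp only [spokes, Finset.coe_Icc, Set.mem_image, Set.mem_Icc]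
  constructor
  · rintro ⟨b, ⟨h1, h2⟩, rfl⟩; exact ⟨b, h1, h2, rfl⟩
  · rintro ⟨b, h1, h2, rfl⟩; exact ⟨b, ⟨h1, h2⟩, rfl⟩

theorem core_of_mem_spokes {i r : ℤ} (hr : Outer r) (h0 : 1 ≤ i) (h1 : i ≤ R.g)
    {e : Set (ℤ × ℤ)} (h : e ∈ S.spokes i r) : S.Core e := by
  obtain ⟨b, hl, hu, rfl⟩ := mem_spokes.1 h
  exact Core.spoke i r b hr h0 h1 hl hu

theorem pos_mem_spokes {i j r : ℤ} (hr : Outer r) (hj : j = i ∨ j = i + 1) (h0 : 1 ≤ j)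
    (h1 : j ≤ R.g) : spoke j r (S.pos r i) ∈ S.spokes j r := by
  refine mem_spokes.2 ⟨_, ?_, ?_, rfl⟩
  · rcases hj with rfl | rfl
    · exact S.pos_mono hr (by omega) (by omega) (by omega)
    · simp
  · rcases hj with rfl | rfl
    · exact le_rfl
    · exact S.pos_mono hr (by omega) (by omega) (by omega)

theorem cls_eq_of_mem_spokes {i r : ℤ} (hr : Outer r) (h0 : 1 ≤ i) (h1 : i ≤ R.g)
    {e e' : Set (ℤ × ℤ)} (he : S.Core e) (he' : S.Core e') (h : e ∈ S.spokes i r)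
    (h' : e' ∈ S.spokes i r) : cls he = cls he' := by
  obtain ⟨b, hl, hu, rfl⟩ := mem_spokes.1 h
  obtain ⟨b', hl', hu', rfl⟩ := mem_spokes.1 h'
  rcases le_total b b' with hb | hb
  · exact cls_spoke_eq hr h0 h1 he he' hl hb hu'
  · exact (cls_spoke_eq hr h0 h1 he' he hl' hb hu).symm

theorem mem_spokes_of_fan {i r b : ℤ} {e : Set (ℤ × ℤ)} (he : S.Core e) (hr : Outer r)
    (hl : S.pos r (i - 1) ≤ b) (hu : b < S.pos r i) (h : e ⊆ fan i r b) : e ∈ S.spokes i r := by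
  rcases he.subset_fan hr h with rfl | rfl
  · exact mem_spokes.2 ⟨_, hl, by omega, rfl⟩
  · exact mem_spokes.2 ⟨_, by omega, by omega, rfl⟩

/-- Concatenation at a vertex on a spoke stays among the spokes, except at the two ends. -/
theorem concatenated_spoke {i r : ℤ} (hr : Outer r) {e t e' : Set (ℤ × ℤ)}
    (h : e ∈ S.spokes i r) (ht : S.Cell t) (het : e ⊆ t) (he' : S.Core e') (het' : e' ⊆ t)
    (hcard : {f | f ∈ coreEdges S.triangulation ∧ f ⊆ t}.ncard = 2) :
    e' ∈ S.spokes i r ∨ ∃ k, (k = 0 ∨ k = R.g) ∧ (i = k ∨ i = k + 1) ∧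
      ((t = S.flat k r ∧ k ∉ S.split) ∨ (t = S.wedge k i ∧ k ∈ S.split)) := by
  obtain ⟨b, hl, hu, rfl⟩ := mem_spokes.1 h
  have hk' : ∀ k, 0 ≤ k → k ≤ R.g → ¬ (k = 0 ∨ k = R.g) → 1 ≤ k ∧ k ≤ R.g - 1 := by omega
  rcases S.cell_of_spoke_subset hr ht het with ⟨rfl, -, -, hl, hu⟩ | ⟨rfl, -, -, hl, hu⟩ |
    ⟨k, hk, rfl, hk0, hk1, hs, rfl⟩ | ⟨k, hk, rfl, hk0, hk1, hs, rfl⟩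
  · exact Or.inl (mem_spokes_of_fan he' hr hl hu het')
  · exact Or.inl (mem_spokes_of_fan he' hr hl hu het')
  · by_cases hend : k = 0 ∨ k = R.g
    · exact Or.inr ⟨k, hend, hk, Or.inl ⟨rfl, hs⟩⟩
    · obtain ⟨a, b⟩ := hk' k hk0 hk1 hend
      exact absurd hcard (degree_flat hr a b hs)
  · by_cases hend : k = 0 ∨ k = R.g
    · exact Or.inr ⟨k, hend, hk, Or.inr ⟨rfl, hs⟩⟩
    · obtain ⟨a, b⟩ := hk' k hk0 hk1 hend
      exact absurd hcard (degree_wedge hk a b hs)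

/-- The edge between the cycles around `(i, 1)` and `(i + 1, 1)`. -/
def link (S : Staircase R) (i : ℤ) : Set (ℤ × ℤ) :=
  open Classical in if i ∈ S.split then S.bridge i else rung i

theorem core_link {i : ℤ} (h0 : 1 ≤ i) (h1 : i ≤ R.g - 1) : S.Core (S.link i) := by
  unfold link
  split_ifs with hs
  · exact Core.bridge i h0 h1 hs
  · exact Core.rung i (by omega) (by omega) hs

/-- Both ends of a link are trivalent, so it is an edge of the skeleton on its own. -/
theorem skeletonLength_link {i : ℤ} (h0 : 1 ≤ i) (h1 : i ≤ R.g - 1) (P : Set (ℝ × ℝ))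
    (ω : ℤ × ℤ → ℝ) :
    skeletonLength P S.triangulation ω (cls (core_link h0 h1)) =
      latticeLength (dualEdge P ω (S.link i)) := by
  rw [cls, skeletonLength_eq_finsum (C := {S.link i}), finsum_mem_singleton]
  · rintro _ rfl
    exact S.mem_coreEdges.2 (core_link h0 h1)
  · rintro ⟨e, he⟩ ⟨e', he'⟩ ⟨t, ht, het, -, hcard⟩ rfl
    exfalso
    unfold link at het
    split_ifs at het with hs
    · cases ht with
      | fan _ _ _ hr _ _ _ _ => exact absurd het (not_bridge_subset_fan hr)
      | flat _ _ hr _ _ _ => exact absurd het (not_bridge_subset_flat hr)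
      | wedge k j k0 k1 ks hj _ _ =>
        obtain ⟨e0, e2⟩ := bridge_subset_wedge.1 het
        obtain rfl := split_inj (by omega) (by omega) hs k0 k1 ks e0 e2
        exact degree_wedge hj h0 h1 hs hcard
    · cases ht with
      | fan _ _ _ hr _ _ _ _ => exact absurd het (not_rung_subset_fan hr)
      | flat k r hr _ _ _ =>
        obtain rfl := (rung_subset_flat hr).1 het
        exact degree_flat hr h0 h1 hs hcard
      | wedge _ _ _ _ _ _ _ _ => exact absurd het not_rung_subset_wedge
  · rintro ⟨e, he⟩ ⟨e', he'⟩ h h'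
    obtain rfl : e = S.link i := h
    obtain rfl : e' = S.link i := h'
    rfl
  · rfl

/-- For an inner cycle both neighbouring gaps have trivalent ends, so concatenation never leaves the
spokes to one row. The strict inequalities on `i` matter: at `i = 1` and `i = g` the two arcs merge.
-/
theorem skeletonLength_spokes {i r : ℤ} (hr : Outer r) (h0 : 1 < i) (h1 : i < R.g)
    {e : Set (ℤ × ℤ)} (he : S.Core e) (hmem : e ∈ S.spokes i r) (P : Set (ℝ × ℝ))
    (ω : ℤ × ℤ → ℝ) :
    skeletonLength P S.triangulation ω (cls he) =
      ∑ᶠ e' ∈ S.spokes i r, latticeLength (dualEdge P ω e') := by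
  refine skeletonLength_eq_finsum ?_ ?_ ?_ P ω _ hmem
  · intro e he
    exact S.mem_coreEdges.2 (core_of_mem_spokes hr h0.le h1.le he)
  · rintro ⟨e, he⟩ ⟨e', he'⟩ ⟨t, ht, het, het', hcard⟩ hmem
    rcases concatenated_spoke hr hmem ht het (S.mem_coreEdges.1 he') het' hcard with h |
      ⟨k, hk, hik, -⟩
    · exact h
    · omega
  · rintro ⟨e, he⟩ ⟨f, hf⟩ hes hfs
    exact cls_eq_of_mem_spokes hr h0.le h1.le (S.mem_coreEdges.1 he) (S.mem_coreEdges.1 hf) hes hfs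

/-- The edges around the extremal interior point `(i, 1)`, where `i = 1` or `i = g`, that form a
loop of the skeleton. Here `k` is the gap that separates `(i, 1)` from the end of the polygon. -/
def loop (S : Staircase R) (i k : ℤ) : Set (Set (ℤ × ℤ)) :=
  (S.spokes i 0 ∪ S.spokes i 2) ∪ {e | e = rung k ∧ k ∉ S.split}

theorem spokes_subset_loop {i k r : ℤ} (hr : Outer r) : S.spokes i r ⊆ S.loop i k := by
  rcases hr with rfl | rfl
  · exact fun e he => Or.inl (Or.inl he)
  · exact fun e he => Or.inl (Or.inr he)

theorem loop_cases {i k : ℤ} {e : Set (ℤ × ℤ)} (h : e ∈ S.loop i k) :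
    (∃ r, Outer r ∧ e ∈ S.spokes i r) ∨ (e = rung k ∧ k ∉ S.split) := by
  rcases h with (h | h) | h
  · exact Or.inl ⟨0, outer_zero, h⟩
  · exact Or.inl ⟨2, outer_two, h⟩
  · exact Or.inr h

/-- At the extreme gap `k` all vertices near `(i, 1)` have degree two. The two arcs are glued there,
directly through a wedge if `k` is split and otherwise through the end rung, and they form a single
loop. -/
theorem skeletonLength_loop {i k : ℤ} (hik : (i = 1 ∧ k = 0) ∨ (i = R.g ∧ k = R.g))
    {e : Set (ℤ × ℤ)} (he : S.Core e) (hmem : e ∈ S.loop i k) (P : Set (ℝ × ℝ))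
    (ω : ℤ × ℤ → ℝ) :
    skeletonLength P S.triangulation ω (cls he) =
      ∑ᶠ e' ∈ S.loop i k, latticeLength (dualEdge P ω e') := by
  have hg := R.two_le
  have h0 : 1 ≤ i := by omega
  have h1 : i ≤ R.g := by omega
  have hk0 : 0 ≤ k := by omega
  have hk1 : k ≤ R.g := by omega
  have hik' : i = k ∨ i = k + 1 := by omega
  have hcore : ∀ e ∈ S.loop i k, S.Core e := by
    intro e he
    rcases loop_cases he with ⟨r, hr, h⟩ | ⟨rfl, hs⟩
    · exact core_of_mem_spokes hr h0 h1 h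
    · exact Core.rung k hk0 hk1 hs
  -- the remaining edges at the two triangles of the gap `k` near `(i, 1)`
  have hflat : ∀ r, Outer r → ∀ f, S.Core f → f ⊆ S.flat k r → f = rung k ∨
      f = spoke i r (S.pos r k) := by
    intro r hr f hf hft
    rcases hf.subset_flat hr hft with h | ⟨h1, h⟩ | ⟨h1, h⟩
    · exact Or.inl h
    · obtain rfl : i = k := by omega
      exact Or.inr h
    · obtain rfl : i = k + 1 := by omega
      exact Or.inr h
  have hwedge : k ∈ S.split → ∀ f, S.Core f → f ⊆ S.wedge k i →
      ∃ r, Outer r ∧ f = spoke i r (S.pos r k) := by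
    intro hs f hf hft
    rcases hf.subset_wedge hk0 hk1 hs hft with ⟨-, h⟩ | h
    · omega
    · exact h
  refine skeletonLength_eq_finsum ?_ ?_ ?_ P ω _ hmem
  · exact fun e he => S.mem_coreEdges.2 (hcore e he)
  · rintro ⟨e, he⟩ ⟨e', he'⟩ ⟨t, ht, het, het', hcard⟩ hmem
    replace he' := S.mem_coreEdges.1 he'
    have hfl : ∀ r, Outer r → t = S.flat k r → k ∉ S.split → e' ∈ S.loop i k := by
      rintro r hr rfl hs
      rcases hflat r hr e' he' het' with rfl | rfl
      · exact Or.inr ⟨rfl, hs⟩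
      · exact spokes_subset_loop hr (pos_mem_spokes hr hik' h0 h1)
    rcases loop_cases hmem with ⟨r, hr, h⟩ | ⟨h, hs⟩
    · rcases concatenated_spoke hr h ht het he' het' hcard with h | ⟨k', hk', hik', h⟩
      · exact spokes_subset_loop hr h
      · obtain rfl : k' = k := by omega
        rcases h with ⟨h, hs⟩ | ⟨rfl, hs⟩
        · exact hfl r hr h hs
        · obtain ⟨r', hr', rfl⟩ := hwedge hs e' he' het'
          exact spokes_subset_loop hr' (pos_mem_spokes hr' hik' h0 h1)
    · obtain rfl : e = rung k := h
      cases ht with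
      | fan _ _ _ hr _ _ _ _ => exact absurd het (not_rung_subset_fan hr)
      | flat k' r hr _ _ _ =>
        obtain rfl := (rung_subset_flat hr).1 het
        exact hfl r hr rfl hs
      | wedge _ _ _ _ _ _ _ _ => exact absurd het not_rung_subset_wedge
  -- Everything is compared with the bottom spoke at the gap `k`: first along its own row, then
  -- across the gap.
  · have hend : ∀ r (hr : Outer r) e (he : S.Core e), e ∈ S.spokes i r →
        cls he = cls (core_spoke_of_wedge (S := S) outer_zero hik' h0 h1) := by
      intro r hr e he hmem
      rw [cls_eq_of_mem_spokes hr h0 h1 he (core_spoke_of_wedge hr hik' h0 h1) hmem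
        (pos_mem_spokes hr hik' h0 h1)]
      rcases hr with rfl | rfl
      · rfl
      by_cases hs : k ∈ S.split
      · have hlo : R.lo 1 ≤ i := by rcases lo_one_eq R with h | h <;> omega
        have hhi : i ≤ R.hi 1 := by rcases hi_one_eq R with h | h <;> omega
        refine cls_eq_of_cell _ _ (Cell.wedge k i hk0 hk1 hs hik' hlo hhi) ?_ ?_ ?_ ?_
        · exact (spoke_subset_wedge outer_two).2 ⟨rfl, rfl⟩
        · exact (spoke_subset_wedge outer_zero).2 ⟨rfl, rfl⟩
        · rw [Ne, spoke_inj outer_two outer_zero]; omega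
        · intro f hf hft
          obtain ⟨r, rfl | rfl, rfl⟩ := hwedge hs f hf hft
          · exact Or.inr rfl
          · exact Or.inl rfl
      · have hrung : ∀ r (hr : Outer r), cls (core_spoke_of_wedge (S := S) hr hik' h0 h1) =
            cls (Core.rung k hk0 hk1 hs) := by
          intro r hr
          refine cls_eq_of_cell _ _ (Cell.flat k r hr hk0 hk1 hs) ?_ ?_ ?_ ?_
          · exact (spoke_subset_flat hr hr).2 ⟨hik', rfl, rfl⟩
          · exact (rung_subset_flat hr).2 rfl
          · exact spoke_ne_rung hr
          · exact fun f hf hft => (hflat r hr f hf hft).symm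
        exact (hrung 2 outer_two).trans (hrung 0 outer_zero).symm
    have hall : ∀ e (he : S.Core e), e ∈ S.loop i k →
        cls he = cls (core_spoke_of_wedge (S := S) outer_zero hik' h0 h1) := by
      intro e he hmem
      rcases loop_cases hmem with ⟨r, hr, h⟩ | ⟨rfl, hs⟩
      · exact hend r hr e he h
      · refine cls_eq_of_cell _ _ (Cell.flat k 0 outer_zero hk0 hk1 hs) ?_ ?_ ?_ ?_
        · exact (rung_subset_flat outer_zero).2 rfl
        · exact (spoke_subset_flat outer_zero outer_zero).2 ⟨hik', rfl, rfl⟩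
        · exact (spoke_ne_rung outer_zero).symm
        · exact fun f hf hft => hflat 0 outer_zero f hf hft
    rintro ⟨e, he⟩ ⟨f, hf⟩ hes hfs
    exact (hall e (S.mem_coreEdges.1 he) hes).trans (hall f (S.mem_coreEdges.1 hf) hfs).symm

/-! ### Lengths -/

/-- The value of a height function at a lattice point. -/
abbrev ev (z : ℤ × ℤ) : (ℤ × ℤ → ℝ) →ₗ[ℝ] ℝ := LinearMap.proj z

/-- The sum of the heights of the two outer vertices of gap `i`. -/
def outerSum (S : Staircase R) (i : ℤ) : (ℤ × ℤ → ℝ) →ₗ[ℝ] ℝ :=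
  ev (S.pos 0 i, 0) + ev (S.pos 2 i, 2)

/-- The length of the edge dual to the rung `i` (up to sign that of the bridge). -/
def rungLength (S : Staircase R) (i : ℤ) : (ℤ × ℤ → ℝ) →ₗ[ℝ] ℝ :=
  S.outerSum i - ((2 * i + 2 - S.pos 0 i - S.pos 2 i : ℤ) : ℝ) • ev (i, 1) -
    ((S.pos 0 i + S.pos 2 i - 2 * i : ℤ) : ℝ) • ev (i + 1, 1)

open Classical in
/-- The first coordinate of the vertex of the tropical curve where gap `i` meets the cycle around
`(i, 1)`. -/
def gapNear (S : Staircase R) (i : ℤ) : (ℤ × ℤ → ℝ) →ₗ[ℝ] ℝ :=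
  if i ∈ S.split then (2 : ℝ) • ev (i, 1) - S.outerSum i else ev (i, 1) - ev (i + 1, 1)

open Classical in
/-- The first coordinate of the vertex of the tropical curve where gap `i` meets the cycle around
`(i + 1, 1)`. -/
def gapFar (S : Staircase R) (i : ℤ) : (ℤ × ℤ → ℝ) →ₗ[ℝ] ℝ :=
  if i ∈ S.split then S.outerSum i - (2 : ℝ) • ev (i + 1, 1) else ev (i, 1) - ev (i + 1, 1)

open Classical in
/-- The length of the edge between the cycles around `(i, 1)` and `(i + 1, 1)`. -/
def linkLength (S : Staircase R) (i : ℤ) : (ℤ × ℤ → ℝ) →ₗ[ℝ] ℝ :=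
  if i ∈ S.split then - S.rungLength i else S.rungLength i

open Classical in
/-- The length of an arc (or the whole loop, if `i = 1` or `i = g`) of the cycle around
`(i, 1)`. -/
def cycleLength (S : Staircase R) (i : ℤ) : (ℤ × ℤ → ℝ) →ₗ[ℝ] ℝ :=
  if i = 1 then (2 : ℝ) • (S.gapFar 0 - S.gapNear 1) + (if 0 ∈ S.split then 0 else S.rungLength 0)
  else if i = R.g then (2 : ℝ) • (S.gapFar (R.g - 1) - S.gapNear R.g) +
    (if R.g ∈ S.split then 0 else S.rungLength R.g)
  else S.gapFar (i - 1) - S.gapNear i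

/-- Lengths of skeleton edges: first those between consecutive cycles, then those on cycles. -/
abbrev Label (R : Rows) : Type := Finset.Icc (1 : ℤ) (R.g - 1) ⊕ Finset.Icc (1 : ℤ) R.g

/-- The length functionals of the skeleton. -/
def lengths (S : Staircase R) : (ℤ × ℤ → ℝ) →ₗ[ℝ] (Label R → ℝ) :=
  LinearMap.pi (Sum.elim (fun i => S.linkLength i) (fun i => S.cycleLength i))

variable {P : Set (ℝ × ℝ)} {ω : ℤ × ℤ → ℝ}

theorem exists_vertex (hω : inducedSubdivision P ω = S.triangulation) {t : Set (ℤ × ℤ)}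
    (ht : S.Cell t) : ∃ v, t = minimizers P ω v := by
  have : t ∈ inducedSubdivision P ω := by rw [hω]; exact ht
  exact this.2

open Classical in
/-- The first coordinates of the vertices along the arc of the cycle around `(i, 1)` dual to the
spokes to row `r`. -/
def arcCoord (S : Staircase R) (i r : ℤ) (ω : ℤ × ℤ → ℝ) (b : ℤ) : ℝ :=
  if b < S.pos r (i - 1) then S.gapFar (i - 1) ω
  else if b < S.pos r i then ω (b, r) - ω (b + 1, r) else S.gapNear i ω

/-- A spoke has height difference one, so `(1, 0)` completes it to a basis and the length is the
difference of the first coordinates of the two end vertices. -/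
theorem latticeLength_spoke (hω : inducedSubdivision P ω = S.triangulation) {i r b : ℤ}
    (hr : Outer r) (h0 : 1 ≤ i) (h1 : i ≤ R.g) (hl : S.pos r (i - 1) ≤ b) (hu : b ≤ S.pos r i) :
    latticeLength (dualEdge P ω (spoke i r b)) =
      S.arcCoord i r ω (b - 1) - S.arcCoord i r ω b := by
  obtain ⟨x, hx, hx'⟩ := S.exists_cell_right hr h0 h1 hl hu
  obtain ⟨y, hy, hy'⟩ := S.exists_cell_left hr h0 h1 hl hu
  obtain ⟨vR, hvR⟩ := exists_vertex hω hx
  obtain ⟨vL, hvL⟩ := exists_vertex hω hy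
  have pR : ((i, 1) : ℤ × ℤ) ∈ minimizers P ω vR := by rw [← hvR]; simp
  have qR : (b, r) ∈ minimizers P ω vR := by rw [← hvR]; simp
  have xR : x ∈ minimizers P ω vR := by rw [← hvR]; simp
  have pL : ((i, 1) : ℤ × ℤ) ∈ minimizers P ω vL := by rw [← hvL]; simp
  have qL : (b, r) ∈ minimizers P ω vL := by rw [← hvL]; simp
  have yL : y ∈ minimizers P ω vL := by rw [← hvL]; simp
  -- The three cases are the possible right neighbours: another fan, a rung, or a bridge. In the
  -- last one the unknown second coordinate cancels when the equations of the two outer rows are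
  -- added.
  have eR : vR.1 = S.arcCoord i r ω b ∧ ∃ c : ℤ, x = (i + 1 + c * (b - i), 1 + 0 + c * (r - 1)) := by
    have e1 := tropTerm_eq_of_mem pR qR
    have e2 := tropTerm_eq_of_mem pR xR
    rcases hx' with ⟨rfl, hb⟩ | ⟨rfl, rfl, hs⟩ | ⟨rfl, rfl, hs⟩
    · refine ⟨?_, 1, by ext <;> simp; ring⟩
      rw [arcCoord, if_neg (by omega), if_pos hb]
      simp only [tropTerm] at e1 e2
      push_cast at e1 e2
      linarith
    · refine ⟨?_, 0, by ext <;> simp⟩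
      rw [arcCoord, if_neg (by omega), if_neg (by omega), gapNear, if_neg hs]
      simp only [tropTerm] at e1 e2
      push_cast at e1 e2
      simp only [LinearMap.sub_apply, LinearMap.proj_apply]
      linarith
    · refine ⟨?_, -1, by ext <;> simp <;> ring⟩
      rw [arcCoord, if_neg (by omega), if_neg (by omega), gapNear, if_pos hs]
      have hsum := S.split_sum i (by omega) h1 hs
      simp only [LinearMap.sub_apply, LinearMap.proj_apply, LinearMap.smul_apply, outerSum,
        LinearMap.add_apply, smul_eq_mul]
      rcases hr with rfl | rfl
      · rw [show 2 * i + 1 - S.pos 0 i = S.pos 2 i by omega] at e2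
        have hsum' : (S.pos 0 i + S.pos 2 i : ℝ) = 2 * i + 1 := by exact_mod_cast hsum
        simp only [tropTerm] at e1 e2
        push_cast at e1 e2
        norm_num at e1 e2 ⊢
        linear_combination -e1 - e2 - vR.1 * hsum'
      · rw [show 2 * i + 1 - S.pos 2 i = S.pos 0 i by omega] at e2
        have hsum' : (S.pos 0 i + S.pos 2 i : ℝ) = 2 * i + 1 := by exact_mod_cast hsum
        simp only [tropTerm] at e1 e2
        push_cast at e1 e2
        norm_num at e1 e2 ⊢
        linear_combination -e1 - e2 - vR.1 * hsum'
  have eL : vL.1 = S.arcCoord i r ω (b - 1) ∧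
      ∃ c : ℤ, y = (i - 1 + c * (b - i), 1 - 0 + c * (r - 1)) := by
    have e1 := tropTerm_eq_of_mem pL qL
    have e2 := tropTerm_eq_of_mem pL yL
    rcases hy' with ⟨rfl, hb⟩ | ⟨rfl, rfl, hs⟩ | ⟨rfl, rfl, hs⟩
    · refine ⟨?_, 1, by ext <;> simp⟩
      rw [arcCoord, if_neg (by omega), if_pos (by omega), sub_add_cancel]
      simp only [tropTerm] at e1 e2
      push_cast at e1 e2
      linarith
    · refine ⟨?_, 0, by ext <;> simp⟩
      rw [arcCoord, if_pos (by omega), gapFar, if_neg hs, sub_add_cancel]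
      simp only [tropTerm] at e1 e2
      push_cast at e1 e2
      simp only [LinearMap.sub_apply, LinearMap.proj_apply]
      linarith
    · refine ⟨?_, -1, by ext <;> simp <;> ring⟩
      rw [arcCoord, if_pos (by omega), gapFar, if_pos hs, sub_add_cancel]
      have hsum := S.split_sum (i - 1) (by omega) (by omega) hs
      simp only [LinearMap.sub_apply, LinearMap.proj_apply, LinearMap.smul_apply, outerSum,
        LinearMap.add_apply, smul_eq_mul]
      have hsum' : (S.pos 0 (i - 1) + S.pos 2 (i - 1) : ℝ) = 2 * i - 1 := by
        have : (S.pos 0 (i - 1) + S.pos 2 (i - 1) : ℤ) = 2 * i - 1 := by omega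
        exact_mod_cast this
      rcases hr with rfl | rfl
      · rw [show 2 * i - 1 - S.pos 0 (i - 1) = S.pos 2 (i - 1) by omega] at e2
        simp only [tropTerm] at e1 e2
        push_cast at e1 e2
        norm_num at e1 e2 ⊢
        linear_combination e1 + e2 + vL.1 * hsum'
      · rw [show 2 * i - 1 - S.pos 2 (i - 1) = S.pos 0 (i - 1) by omega] at e2
        simp only [tropTerm] at e1 e2
        push_cast at e1 e2
        norm_num at e1 e2 ⊢
        linear_combination e1 + e2 + vL.1 * hsum'
  obtain ⟨hR, cR, hcR⟩ := eR
  obtain ⟨hL, cL, hcL⟩ := eL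
  have := latticeLength_dualEdge (P := P) (ω := ω) (p := (i, 1)) (q := (b, r)) (w := (1, 0))
    cL cR (by rcases hr with rfl | rfl <;> simp) pL qL yL pR qR xR hcL hcR
  rw [spoke, this, ← hL, ← hR]
  simp

theorem latticeLength_rung (hω : inducedSubdivision P ω = S.triangulation) {i : ℤ}
    (h0 : 0 ≤ i) (h1 : i ≤ R.g) (hs : i ∉ S.split) :
    latticeLength (dualEdge P ω (rung i)) = S.rungLength i ω := by
  obtain ⟨vR, hvR⟩ := exists_vertex hω (Cell.flat i 2 outer_two h0 h1 hs)
  obtain ⟨vL, hvL⟩ := exists_vertex hω (Cell.flat i 0 outer_zero h0 h1 hs)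
  have pR : ((i, 1) : ℤ × ℤ) ∈ minimizers P ω vR := by rw [← hvR]; simp [flat]
  have qR : ((i + 1, 1) : ℤ × ℤ) ∈ minimizers P ω vR := by rw [← hvR]; simp [flat]
  have xR : (S.pos 2 i, 2) ∈ minimizers P ω vR := by rw [← hvR]; simp [flat]
  have pL : ((i, 1) : ℤ × ℤ) ∈ minimizers P ω vL := by rw [← hvL]; simp [flat]
  have qL : ((i + 1, 1) : ℤ × ℤ) ∈ minimizers P ω vL := by rw [← hvL]; simp [flat]
  have xL : (S.pos 0 i, 0) ∈ minimizers P ω vL := by rw [← hvL]; simp [flat]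
  have := latticeLength_dualEdge (P := P) (ω := ω) (p := (i, 1)) (q := (i + 1, 1)) (w := (0, 1))
    (S.pos 0 i - i) (S.pos 2 i - i) (by simp) pL qL xL pR qR xR (by ext <;> simp)
    (by ext <;> simp)
  rw [rung, this]
  have e1 := tropTerm_eq_of_mem pR qR
  have e2 := tropTerm_eq_of_mem pR xR
  have e3 := tropTerm_eq_of_mem pL qL
  have e4 := tropTerm_eq_of_mem pL xL
  simp only [tropTerm] at e1 e2 e3 e4
  push_cast at e1 e2 e3 e4
  simp only [rungLength, outerSum, LinearMap.sub_apply, LinearMap.proj_apply,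
    LinearMap.smul_apply, LinearMap.add_apply, smul_eq_mul]
  push_cast
  linear_combination e2 + e4 - (S.pos 2 i - i : ℝ) * e1 - (S.pos 0 i - i : ℝ) * e3

/-- The bridge and the rung are the two diagonals of one quadrilateral, whence the opposite sign.
The completing vector `(i - pos 0 i, 1)` has determinant one because of `split_sum`. -/
theorem latticeLength_bridge (hω : inducedSubdivision P ω = S.triangulation) {i : ℤ}
    (h0 : 1 ≤ i) (h1 : i ≤ R.g - 1) (hs : i ∈ S.split) :
    latticeLength (dualEdge P ω (S.bridge i)) = - S.rungLength i ω := by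
  have hlo : R.lo 1 ≤ i := by rcases lo_one_eq R with h | h <;> omega
  have hhi : i + 1 ≤ R.hi 1 := by rcases hi_one_eq R with h | h <;> omega
  obtain ⟨vR, hvR⟩ := exists_vertex hω
    (Cell.wedge i i (by omega) (by omega) hs (Or.inl rfl) hlo (by omega))
  obtain ⟨vL, hvL⟩ := exists_vertex hω
    (Cell.wedge i (i + 1) (by omega) (by omega) hs (Or.inr rfl) (by omega) hhi)
  have pR : (S.pos 0 i, 0) ∈ minimizers P ω vR := by rw [← hvR]; simp [wedge]
  have qR : (S.pos 2 i, 2) ∈ minimizers P ω vR := by rw [← hvR]; simp [wedge]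
  have xR : (i, 1) ∈ minimizers P ω vR := by rw [← hvR]; simp [wedge]
  have pL : (S.pos 0 i, 0) ∈ minimizers P ω vL := by rw [← hvL]; simp [wedge]
  have qL : (S.pos 2 i, 2) ∈ minimizers P ω vL := by rw [← hvL]; simp [wedge]
  have xL : (i + 1, 1) ∈ minimizers P ω vL := by rw [← hvL]; simp [wedge]
  have hsum := S.split_sum i (by omega) (by omega) hs
  have := latticeLength_dualEdge (P := P) (ω := ω) (p := (S.pos 0 i, 0)) (q := (S.pos 2 i, 2))
    (w := (i - S.pos 0 i, 1)) 1 0 (by left; simp; linarith) pL qL xL pR qR xR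
    (by ext <;> simp; linarith) (by ext <;> simp)
  rw [bridge, this]
  have e1 := tropTerm_eq_of_mem pR qR
  have e2 := tropTerm_eq_of_mem pR xR
  have e3 := tropTerm_eq_of_mem pL qL
  have e4 := tropTerm_eq_of_mem pL xL
  have hsum' : (S.pos 2 i : ℝ) = 2 * i + 1 - S.pos 0 i := by
    have : S.pos 2 i = 2 * i + 1 - S.pos 0 i := by omega
    exact_mod_cast this
  simp only [tropTerm] at e1 e2 e3 e4
  simp only [rungLength, outerSum, LinearMap.sub_apply, LinearMap.proj_apply,
    LinearMap.smul_apply, LinearMap.add_apply, smul_eq_mul]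
  push_cast at e1 e2 e3 e4 ⊢
  rw [hsum'] at e1 e3 ⊢
  linear_combination e2 + e4 - e3

theorem sum_Icc_sub (f : ℤ → ℝ) {m n : ℤ} (hmn : m ≤ n) :
    ∑ b ∈ Finset.Icc m n, (f (b - 1) - f b) = f (m - 1) - f n := by
  induction n, hmn using Int.leInduction with
  | base => simp
  | succ n hn ih =>
    rw [← Finset.insert_Icc_right_eq_Icc_add_one (by omega), Finset.sum_insert (by simp), ih]
    simp

/-- The lengths telescope to a value independent of `r`: the two arcs of a cycle are equally long.
-/
theorem finsum_spokes (hω : inducedSubdivision P ω = S.triangulation) {i r : ℤ}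
    (hr : Outer r) (h0 : 1 ≤ i) (h1 : i ≤ R.g) :
    ∑ᶠ e ∈ S.spokes i r, latticeLength (dualEdge P ω e) = S.gapFar (i - 1) ω - S.gapNear i ω := by
  rw [spokes, finsum_mem_image, finsum_mem_coe_finset]
  · have hle : S.pos r (i - 1) ≤ S.pos r i := S.pos_mono hr (by omega) (by omega) (by omega)
    rw [Finset.sum_congr rfl fun b hb => ?_, sum_Icc_sub (S.arcCoord i r ω) hle]
    · rw [arcCoord, if_pos (by omega), arcCoord, if_neg (by omega), if_neg (by omega)]
    · rw [Finset.mem_Icc] at hb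
      exact latticeLength_spoke hω hr h0 h1 hb.1 hb.2
  · intro b _ b' _ h
    exact ((spoke_inj hr hr).1 h).2.2

open Classical in
theorem finsum_loop (hω : inducedSubdivision P ω = S.triangulation) {i k : ℤ}
    (h0 : 1 ≤ i) (h1 : i ≤ R.g) (hk0 : 0 ≤ k) (hk1 : k ≤ R.g) :
    ∑ᶠ e ∈ S.loop i k, latticeLength (dualEdge P ω e) =
      2 * (S.gapFar (i - 1) ω - S.gapNear i ω) + if k ∈ S.split then 0 else S.rungLength k ω := by
  have hfin : ∀ r, (S.spokes i r).Finite := fun r => (Finset.finite_toSet _).image _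
  have hd : Disjoint (S.spokes i 0) (S.spokes i 2) := by
    rw [Set.disjoint_left]
    intro e he he'
    obtain ⟨b, -, -, rfl⟩ := mem_spokes.1 he
    obtain ⟨b', -, -, h⟩ := mem_spokes.1 he'
    rw [spoke_inj outer_zero outer_two] at h
    omega
  have hd' : Disjoint (S.spokes i 0 ∪ S.spokes i 2) {e | e = rung k ∧ k ∉ S.split} := by
    rw [Set.disjoint_left]
    rintro e (he | he) ⟨rfl, -⟩
    · obtain ⟨b, -, -, h⟩ := mem_spokes.1 he
      exact spoke_ne_rung outer_zero h.symm
    · obtain ⟨b, -, -, h⟩ := mem_spokes.1 he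
      exact spoke_ne_rung outer_two h.symm
  have hfin' : {e | e = rung k ∧ k ∉ S.split}.Finite :=
    (Set.finite_singleton (rung k)).subset fun e he => he.1
  rw [loop, finsum_mem_union hd' ((hfin 0).union (hfin 2)) hfin',
    finsum_mem_union hd (hfin 0) (hfin 2), finsum_spokes hω outer_zero h0 h1,
    finsum_spokes hω outer_two h0 h1]
  split_ifs with hs
  · have : {e : Set (ℤ × ℤ) | e = rung k ∧ k ∉ S.split} = ∅ := by ext e; simp [hs]
    rw [this, finsum_mem_empty]; ring
  · have : {e : Set (ℤ × ℤ) | e = rung k ∧ k ∉ S.split} = {rung k} := by ext e; simp [hs]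
    rw [this, finsum_mem_singleton, latticeLength_rung hω hk0 hk1 hs]; ring

theorem skeletonLength_cycle {i r : ℤ} (hr : Outer r) (h0 : 1 ≤ i) (h1 : i ≤ R.g)
    {e : Set (ℤ × ℤ)} (he : S.Core e) (hmem : e ∈ S.spokes i r)
    (hω : inducedSubdivision P ω = S.triangulation) :
    skeletonLength P S.triangulation ω (cls he) = S.cycleLength i ω := by
  have hg := R.two_le
  unfold cycleLength
  split_ifs with hi hs hi' hs
  · subst hi
    rw [skeletonLength_loop (Or.inl ⟨rfl, rfl⟩) he (spokes_subset_loop hr hmem),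
      finsum_loop hω h0 h1 le_rfl (by omega), if_pos hs]
    simp
  · subst hi
    rw [skeletonLength_loop (Or.inl ⟨rfl, rfl⟩) he (spokes_subset_loop hr hmem),
      finsum_loop hω h0 h1 le_rfl (by omega), if_neg hs]
    simp
  · subst hi'
    rw [skeletonLength_loop (Or.inr ⟨rfl, rfl⟩) he (spokes_subset_loop hr hmem),
      finsum_loop hω h0 h1 (by omega) (by omega), if_pos hs]
    simp
  · subst hi'
    rw [skeletonLength_loop (Or.inr ⟨rfl, rfl⟩) he (spokes_subset_loop hr hmem),
      finsum_loop hω h0 h1 (by omega) (by omega), if_neg hs]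
    simp
  · rw [skeletonLength_spokes hr (by omega) (by omega) he hmem, finsum_spokes hω hr h0 h1]
    rfl

theorem skeletonLength_link_eq {i : ℤ} (h0 : 1 ≤ i) (h1 : i ≤ R.g - 1)
    (hω : inducedSubdivision P ω = S.triangulation) :
    skeletonLength P S.triangulation ω (cls (core_link h0 h1)) = S.linkLength i ω := by
  rw [skeletonLength_link h0 h1]
  unfold link linkLength
  split_ifs with hs
  · exact latticeLength_bridge hω h0 h1 hs
  · exact latticeLength_rung hω (by omega) (by omega) hs

variable (S) in
/-- The dimension of the moduli space is the rank of the length functionals. -/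
theorem triangulationModuliDim_eq (hfin : (latticePoints P).Finite)
    (hT : IsRegularUnimodularTriangulation P S.triangulation) :
    triangulationModuliDim P S.triangulation =
      Module.finrank ℝ (LinearMap.range S.lengths) := by
  have hg := R.two_le
  refine triangulationModuliDim_eq_finrank_range hfin hT S.lengths ?_ ?_
  · rintro ⟨e, he⟩
    have hcyc : ∀ i r, Outer r → 1 ≤ i → i ≤ R.g → e ∈ S.spokes i r →
        ∃ l : Label R, ∀ ω, inducedSubdivision P ω = S.triangulation →
          skeletonLength P S.triangulation ω (cls (S.mem_coreEdges.1 he)) = S.lengths ω l :=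
      fun i r hr h0 h1 hmem => ⟨Sum.inr ⟨i, by simp [h0, h1]⟩, fun ω hω =>
        skeletonLength_cycle hr h0 h1 _ hmem hω⟩
    have hlink : ∀ i, 1 ≤ i → i ≤ R.g - 1 → e = S.link i →
        ∃ l : Label R, ∀ ω, inducedSubdivision P ω = S.triangulation →
          skeletonLength P S.triangulation ω (cls (S.mem_coreEdges.1 he)) = S.lengths ω l := by
      rintro i h0 h1 rfl
      exact ⟨Sum.inl ⟨i, by simp [h0, h1]⟩, fun ω hω => skeletonLength_link_eq h0 h1 hω⟩
    change ∃ l : Label R, ∀ ω, inducedSubdivision P ω = S.triangulation →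
          skeletonLength P S.triangulation ω (cls (S.mem_coreEdges.1 he)) = S.lengths ω l
    have hcore := S.mem_coreEdges.1 he
    cases hcore with
    | spoke i r b hr h0 h1 hl hu =>
      exact hcyc i r hr h0 h1 (mem_spokes.2 ⟨b, hl, hu, rfl⟩)
    | rung i h0 h1 hs =>
      by_cases hi : 1 ≤ i ∧ i ≤ R.g - 1
      · exact hlink i hi.1 hi.2 (by rw [link, if_neg hs])
      -- The rungs at the gaps `0` and `g` are not links; they are part of the first and the last
      -- loop.
      · obtain ⟨j, hj⟩ : ∃ j, (j = 1 ∧ i = 0) ∨ (j = R.g ∧ i = R.g) := by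
          rcases h0.eq_or_lt with h | h
          · exact ⟨1, Or.inl ⟨rfl, h.symm⟩⟩
          · exact ⟨R.g, Or.inr ⟨rfl, by omega⟩⟩
        have hmem := pos_mem_spokes (S := S) (i := i) (j := j) outer_zero (by omega) (by omega)
          (by omega)
        refine ⟨Sum.inr ⟨j, by rw [Finset.mem_Icc]; omega⟩, fun ω hω => ?_⟩
        have := skeletonLength_cycle outer_zero (by omega) (by omega)
          (core_spoke_of_wedge outer_zero (by omega) (by omega) (by omega)) hmem hω
        refine Eq.trans ?_ this
        rw [skeletonLength_loop hj _ (Or.inr ⟨rfl, hs⟩),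
          skeletonLength_loop hj _ (spokes_subset_loop outer_zero hmem)]
    | bridge i h0 h1 hs => exact hlink i h0 h1 (by rw [link, if_pos hs])
  · rintro (⟨i, hi⟩ | ⟨i, hi⟩)
    · rw [Finset.mem_Icc] at hi
      exact ⟨_, fun ω hω => skeletonLength_link_eq hi.1 hi.2 hω⟩
    · rw [Finset.mem_Icc] at hi
      exact ⟨_, fun ω hω => skeletonLength_cycle outer_zero hi.1 hi.2
        (core_spoke_of_wedge outer_zero (Or.inl rfl) hi.1 hi.2)
        (pos_mem_spokes outer_zero (Or.inl rfl) hi.1 hi.2) hω⟩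

end Staircase

end TropicalModuli

end


noncomputable section

namespace TropicalModuli

open Filter Topology

/-! ### Sweeping a height function along the rows -/

/-- The value at first coordinate `X` of the term of `(b, r)`, up to a multiple of the second
coordinate that only depends on the row. -/
def rowTerm (ω : ℤ × ℤ → ℝ) (r b : ℤ) (X : ℝ) : ℝ := ω (b, r) + b * X

namespace Rows

variable (R : Rows) (ω : ℤ × ℤ → ℝ)

/-- The minimal term in row `r`. -/
def rowMin (r : ℤ) (X : ℝ) : ℝ := sInf ((fun b : ℤ => rowTerm ω r b X) '' Set.Icc (R.lo r) (R.hi r))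

/-- The minimum in row `r` is attained at `(b, r)`. -/
def IsArg (r : ℤ) (X : ℝ) (b : ℤ) : Prop :=
  R.lo r ≤ b ∧ b ≤ R.hi r ∧ ∀ c, R.lo r ≤ c → c ≤ R.hi r → rowTerm ω r b X ≤ rowTerm ω r c X

/-- The middle row contributes to the tropical curve over `X` if and only if this is
nonnegative. -/
def gapHeight (X : ℝ) : ℝ := R.rowMin ω 0 X + R.rowMin ω 2 X - 2 * R.rowMin ω 1 X

variable {R ω}

theorem lo_le_hi' {r : ℤ} (h0 : 0 ≤ r) (h2 : r ≤ 2) : R.lo r ≤ R.hi r := by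
  have hg := R.two_le
  obtain rfl | rfl | rfl : r = 0 ∨ r = 1 ∨ r = 2 := by omega
  · exact R.lo_le_hi 0 (Or.inl rfl)
  · rcases R.left with h | h <;> rcases R.right with h' | h' <;> omega
  · exact R.lo_le_hi 2 (Or.inr rfl)

theorem continuous_rowTerm (r b : ℤ) : Continuous (rowTerm ω r b) := by
  unfold rowTerm; fun_prop

theorem IsArg.rowMin_eq {r b : ℤ} {X : ℝ} (h : R.IsArg ω r X b) :
    R.rowMin ω r X = rowTerm ω r b X := by
  refine IsLeast.csInf_eq ⟨⟨b, ⟨h.1, h.2.1⟩, rfl⟩, ?_⟩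
  rintro _ ⟨b', hb', rfl⟩
  exact h.2.2 b' hb'.1 hb'.2

theorem exists_isArg {r : ℤ} (h0 : 0 ≤ r) (h2 : r ≤ 2) (X : ℝ) : ∃ b, R.IsArg ω r X b := by
  obtain ⟨b, hb, hmin⟩ := Finset.exists_min_image (Finset.Icc (R.lo r) (R.hi r))
    (fun b => rowTerm ω r b X) (Finset.nonempty_Icc.2 (lo_le_hi' h0 h2))
  rw [Finset.mem_Icc] at hb
  exact ⟨b, hb.1, hb.2, fun b' h1 h2 => hmin b' (Finset.mem_Icc.2 ⟨h1, h2⟩)⟩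

theorem rowMin_le {r b : ℤ} {X : ℝ} (h0 : 0 ≤ r) (h2 : r ≤ 2) (hl : R.lo r ≤ b)
    (hu : b ≤ R.hi r) : R.rowMin ω r X ≤ rowTerm ω r b X := by
  obtain ⟨b', hb'⟩ := exists_isArg (R := R) (ω := ω) h0 h2 X
  rw [hb'.rowMin_eq]
  exact hb'.2.2 b hl hu

theorem continuous_rowMin {r : ℤ} (h0 : 0 ≤ r) (h2 : r ≤ 2) : Continuous (R.rowMin ω r) := by
  have hne : (Finset.Icc (R.lo r) (R.hi r)).Nonempty := Finset.nonempty_Icc.2 (lo_le_hi' h0 h2)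
  have : R.rowMin ω r =
      fun X => (Finset.Icc (R.lo r) (R.hi r)).inf' hne (fun b => rowTerm ω r b X) := by
    funext X
    rw [Finset.inf'_eq_csInf_image, rowMin, Finset.coe_Icc]
  rw [this]
  exact Continuous.finset_inf'_apply hne fun b _ => continuous_rowTerm r b

theorem continuous_gapHeight : Continuous (R.gapHeight ω) := by
  have h0 := continuous_rowMin (R := R) (ω := ω) (r := 0) (by norm_num) (by norm_num)
  have h1 := continuous_rowMin (R := R) (ω := ω) (r := 1) (by norm_num) (by norm_num)
  have h2 := continuous_rowMin (R := R) (ω := ω) (r := 2) (by norm_num) (by norm_num)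
  unfold gapHeight
  fun_prop

theorem isClosed_isArg (r b : ℤ) : IsClosed {X | R.IsArg ω r X b} := by
  have : {X | R.IsArg ω r X b} = {X | R.lo r ≤ b ∧ b ≤ R.hi r} ∩
      ⋂ b' ∈ Set.Icc (R.lo r) (R.hi r), {X | rowTerm ω r b X ≤ rowTerm ω r b' X} := by
    ext X
    simp only [IsArg, Set.mem_ofPred_eq, Set.mem_inter_iff, Set.mem_iInter, Set.mem_Icc]
    tauto
  rw [this]
  refine isClosed_const.inter (isClosed_biInter fun b' _ => ?_)
  exact isClosed_le (continuous_rowTerm r _) (continuous_rowTerm r _)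

/-- Minimizers in a row move to the left when `X` increases. -/
theorem IsArg.anti {r b b' : ℤ} {X X' : ℝ} (h : R.IsArg ω r X b) (h' : R.IsArg ω r X' b')
    (hX : X < X') : b' ≤ b := by
  have e1 := h.2.2 b' h'.1 h'.2.1
  have e2 := h'.2.2 b h.1 h.2.1
  simp only [rowTerm] at e1 e2
  by_contra hlt
  have : (b : ℝ) < b' := by exact_mod_cast not_le.1 hlt
  nlinarith

/-- A unique minimizer in a row remains one nearby. -/
theorem IsArg.eventually {r b : ℤ} {X : ℝ} (h : R.IsArg ω r X b)
    (hu : ∀ b', R.IsArg ω r X b' → b' = b) : ∀ᶠ x in 𝓝 X, R.IsArg ω r x b := by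
  have : ∀ᶠ x in 𝓝 X, ∀ b' ∈ Finset.Icc (R.lo r) (R.hi r), rowTerm ω r b x ≤ rowTerm ω r b' x := by
    rw [Filter.eventually_all_finset]
    intro b' hb'
    rw [Finset.mem_Icc] at hb'
    by_cases hbb : b' = b
    · subst hbb; exact Eventually.of_forall fun x => le_rfl
    · have hlt : rowTerm ω r b X < rowTerm ω r b' X := by
        refine lt_of_le_of_ne (h.2.2 b' hb'.1 hb'.2) fun he => hbb (hu b' ⟨hb'.1, hb'.2, ?_⟩)
        intro b'' h1 h2
        rw [← he]; exact h.2.2 b'' h1 h2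
      exact ((continuous_rowTerm r b).continuousAt.eventually_lt
        (continuous_rowTerm r b').continuousAt hlt).mono fun x hx => hx.le
  filter_upwards [this] with x hx
  exact ⟨h.1, h.2.1, fun b' h1 h2 => hx b' (Finset.mem_Icc.2 ⟨h1, h2⟩)⟩

theorem eventually_isArg_lo {r : ℤ} (h0 : 0 ≤ r) (h2 : r ≤ 2) :
    ∀ᶠ X in atTop, R.IsArg ω r X (R.lo r) := by
  have : ∀ᶠ X in atTop, ∀ b' ∈ Finset.Icc (R.lo r) (R.hi r),
      rowTerm ω r (R.lo r) X ≤ rowTerm ω r b' X := by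
    rw [Filter.eventually_all_finset]
    intro b' hb'
    rw [Finset.mem_Icc] at hb'
    filter_upwards [eventually_ge_atTop (|ω (R.lo r, r) - ω (b', r)|)] with X hX
    have h3 := le_abs_self (ω (R.lo r, r) - ω (b', r))
    simp only [rowTerm]
    rcases hb'.1.eq_or_lt with h | h
    · rw [h]
    · have : (R.lo r : ℝ) + 1 ≤ b' := by exact_mod_cast h
      nlinarith [abs_nonneg (ω (R.lo r, r) - ω (b', r))]
  filter_upwards [this] with x hx
  exact ⟨le_rfl, lo_le_hi' h0 h2, fun b' h1 h2 => hx b' (Finset.mem_Icc.2 ⟨h1, h2⟩)⟩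

theorem eventually_isArg_hi {r : ℤ} (h0 : 0 ≤ r) (h2 : r ≤ 2) :
    ∀ᶠ X in atBot, R.IsArg ω r X (R.hi r) := by
  have : ∀ᶠ X in atBot, ∀ b' ∈ Finset.Icc (R.lo r) (R.hi r),
      rowTerm ω r (R.hi r) X ≤ rowTerm ω r b' X := by
    rw [Filter.eventually_all_finset]
    intro b' hb'
    rw [Finset.mem_Icc] at hb'
    filter_upwards [eventually_le_atBot (-|ω (R.hi r, r) - ω (b', r)|)] with X hX
    have h3 := le_abs_self (ω (R.hi r, r) - ω (b', r))
    simp only [rowTerm]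
    rcases hb'.2.eq_or_lt with h | h
    · rw [h]
    · have : (b' : ℝ) + 1 ≤ R.hi r := by exact_mod_cast h
      nlinarith [abs_nonneg (ω (R.hi r, r) - ω (b', r))]
  filter_upwards [this] with x hx
  exact ⟨lo_le_hi' h0 h2, le_rfl, fun b' h1 h2 => hx b' (Finset.mem_Icc.2 ⟨h1, h2⟩)⟩

/-- At some `X` the minimum in a row is attained on both sides of a given gap. -/
theorem exists_crossing {r b : ℤ} (h0 : 0 ≤ r) (h2 : r ≤ 2) (hl : R.lo r ≤ b) (hu : b < R.hi r) :
    ∃ X b₁ b₂, b₁ ≤ b ∧ b < b₂ ∧ R.IsArg ω r X b₁ ∧ R.IsArg ω r X b₂ := by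
  have hclosed : ∀ s : Set ℤ, s ⊆ Set.Icc (R.lo r) (R.hi r) →
      IsClosed (⋃ b' ∈ s, {X | R.IsArg ω r X b'}) := fun s hs =>
    Set.Finite.isClosed_biUnion ((Set.finite_Icc _ _).subset hs) fun b' _ => isClosed_isArg r b'
  -- The line is covered by two nonempty closed sets, where some minimizer is at most `b` and where
  -- some minimizer exceeds `b`. By connectedness they meet.
  have key := isPreconnected_closed_iff.1 (isPreconnected_univ (α := ℝ))
    (⋃ b' ∈ Set.Icc (R.lo r) b, {X | R.IsArg ω r X b'})
    (⋃ b' ∈ Set.Icc (b + 1) (R.hi r), {X | R.IsArg ω r X b'})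
    (hclosed _ (Set.Icc_subset_Icc_right hu.le)) (hclosed _ (Set.Icc_subset_Icc_left (by omega)))
    ?_ ?_ ?_
  · obtain ⟨X, -, h1, h2⟩ := key
    simp only [Set.mem_iUnion, Set.mem_ofPred_eq, Set.mem_Icc] at h1 h2
    obtain ⟨b₁, hb₁, h1⟩ := h1
    obtain ⟨b₂, hb₂, h2⟩ := h2
    exact ⟨X, b₁, b₂, hb₁.2, by omega, h1, h2⟩
  · intro X _
    obtain ⟨b', hb'⟩ := exists_isArg (R := R) (ω := ω) h0 h2 X
    simp only [Set.mem_union, Set.mem_iUnion, Set.mem_ofPred_eq, Set.mem_Icc]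
    by_cases h : b' ≤ b
    · exact Or.inl ⟨b', ⟨hb'.1, h⟩, hb'⟩
    · exact Or.inr ⟨b', ⟨by omega, hb'.2.1⟩, hb'⟩
  · obtain ⟨X, hX⟩ := (eventually_isArg_lo (R := R) (ω := ω) h0 h2).exists
    refine ⟨X, trivial, ?_⟩
    simp only [Set.mem_iUnion, Set.mem_ofPred_eq, Set.mem_Icc]
    exact ⟨_, ⟨le_rfl, hl⟩, hX⟩
  · obtain ⟨X, hX⟩ := (eventually_isArg_hi (R := R) (ω := ω) h0 h2).exists
    refine ⟨X, trivial, ?_⟩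
    simp only [Set.mem_iUnion, Set.mem_ofPred_eq, Set.mem_Icc]
    exact ⟨_, ⟨by omega, le_rfl⟩, hX⟩

/-! ### The cells of the subdivision -/

variable {P : Set (ℝ × ℝ)}

theorem tropTerm_eq_rowTerm (X Y : ℝ) (z : ℤ × ℤ) :
    tropTerm ω (X, Y) z = rowTerm ω z.2 z.1 X + z.2 * Y := by
  simp [tropTerm, rowTerm]

/-- Minimization over the polygon splits into minimizing inside each row and comparing three affine
functions of the second coordinate, of slopes `0`, `1`, `2`. -/
theorem mem_minimizers (hP : latticePoints P = R.pts) {X Y : ℝ} {z : ℤ × ℤ} :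
    z ∈ minimizers P ω (X, Y) ↔ 0 ≤ z.2 ∧ z.2 ≤ 2 ∧ R.IsArg ω z.2 X z.1 ∧
      ∀ s, 0 ≤ s → s ≤ 2 → R.rowMin ω z.2 X + z.2 * Y ≤ R.rowMin ω s X + s * Y := by
  simp only [minimizers, Set.mem_ofPred_eq, hP, tropTerm_eq_rowTerm]
  constructor
  · rintro ⟨⟨h0, h2, hl, hu⟩, hmin⟩
    have harg : R.IsArg ω z.2 X z.1 := by
      refine ⟨hl, hu, fun b' h1 h3 => ?_⟩
      have := hmin (b', z.2) ⟨h0, h2, h1, h3⟩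
      simpa using this
    refine ⟨h0, h2, harg, fun s hs0 hs2 => ?_⟩
    obtain ⟨b, hb⟩ := exists_isArg (R := R) (ω := ω) hs0 hs2 X
    rw [harg.rowMin_eq, hb.rowMin_eq]
    exact hmin (b, s) ⟨hs0, hs2, hb.1, hb.2.1⟩
  · rintro ⟨h0, h2, harg, hmin⟩
    refine ⟨⟨h0, h2, harg.1, harg.2.1⟩, ?_⟩
    rintro y ⟨hy0, hy2, hyl, hyu⟩
    have h3 := hmin y.2 hy0 hy2
    rw [harg.rowMin_eq] at h3
    exact h3.trans (by gcongr; exact rowMin_le hy0 hy2 hyl hyu)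

/-- The second coordinate is the one at which the row `r` and the middle row take the same value.
The third row joins them only where all three values agree, which is the vanishing of `gapHeight`.
-/
theorem mem_minimizers_of_nonneg (hP : latticePoints P = R.pts) {X : ℝ}
    (hD : 0 ≤ R.gapHeight ω X) {r : ℤ} (hr : Outer r) {z : ℤ × ℤ} :
    z ∈ minimizers P ω (X, (r - 1) * (R.rowMin ω 1 X - R.rowMin ω r X)) ↔
      R.IsArg ω z.2 X z.1 ∧ (z.2 = 1 ∨ z.2 = r ∨ (z.2 = 2 - r ∧ R.gapHeight ω X = 0)) := by
  rw [mem_minimizers hP]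
  unfold gapHeight at *
  constructor
  · rintro ⟨h0, h2, harg, hmin⟩
    refine ⟨harg, ?_⟩
    obtain h | h | h : z.2 = 1 ∨ z.2 = r ∨ z.2 = 2 - r := by rcases hr with rfl | rfl <;> omega
    · exact Or.inl h
    · exact Or.inr (Or.inl h)
    · refine Or.inr (Or.inr ⟨h, ?_⟩)
      have := hmin 1 (by norm_num) (by norm_num)
      rw [h] at this
      rcases hr with rfl | rfl
      · norm_num at this ⊢; linarith
      · norm_num at this ⊢; linarith
  · rintro ⟨harg, h⟩
    have hz : 0 ≤ z.2 ∧ z.2 ≤ 2 := by rcases hr with rfl | rfl <;> omega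
    refine ⟨hz.1, hz.2, harg, fun s hs0 hs2 => ?_⟩
    obtain rfl | rfl | rfl : s = 0 ∨ s = 1 ∨ s = 2 := by omega
    all_goals
      rcases hr with rfl | rfl <;> rcases h with h | h | ⟨h, h'⟩ <;> rw [h] <;> norm_num <;>
        linarith

/-- Here the outer rows meet at a value strictly below that of the middle row. -/
theorem mem_minimizers_of_neg (hP : latticePoints P = R.pts) {X : ℝ}
    (hD : R.gapHeight ω X < 0) {z : ℤ × ℤ} (hz : Outer z.2) (harg : R.IsArg ω z.2 X z.1) :
    z ∈ minimizers P ω (X, (R.rowMin ω 0 X - R.rowMin ω 2 X) / 2) := by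
  rw [mem_minimizers hP]
  unfold gapHeight at hD
  have hz' : 0 ≤ z.2 ∧ z.2 ≤ 2 := by rcases hz with h | h <;> omega
  refine ⟨hz'.1, hz'.2, harg, fun s hs0 hs2 => ?_⟩
  obtain rfl | rfl | rfl : s = 0 ∨ s = 1 ∨ s = 2 := by omega
  all_goals rcases hz with h | h <;> rw [h] <;> norm_num <;> linarith

/-- All cells are unimodular triangles. -/
structure UnimodularOn (R : Rows) (P : Set (ℝ × ℝ)) (ω : ℤ × ℤ → ℝ) : Prop where
  pts : latticePoints P = R.pts
  cells : ∀ t ∈ inducedSubdivision P ω, IsUnimodularTriangle t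

theorem UnimodularOn.minimizers_eq (h : UnimodularOn R P ω) {v : ℝ × ℝ} {p q s : ℤ × ℤ}
    (hp : p ∈ minimizers P ω v) (hq : q ∈ minimizers P ω v) (hs : s ∈ minimizers P ω v)
    (hA : area2 p q s ≠ 0) : minimizers P ω v = {p, q, s} ∧ |area2 p q s| = 1 ∧
      {p, q, s} ∈ inducedSubdivision P ω := by
  have hcell : minimizers P ω v ∈ inducedSubdivision P ω :=
    ⟨not_collinear_toPlane hp hq hs hA, v, rfl⟩
  obtain ⟨h1, h2⟩ := (h.cells _ hcell).eq_of_area2_ne_zero hp hq hs hA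
  exact ⟨h1, h2, h1 ▸ hcell⟩

theorem outer_bounds {r : ℤ} (hr : Outer r) : 0 ≤ r ∧ r ≤ 2 := by
  rcases hr with rfl | rfl <;> norm_num

/-- If the minimum in an outer row is attained twice, these two points form a cell together with
the unique minimizer in the middle row. -/
theorem UnimodularOn.two_outer (h : UnimodularOn R P ω) {r b b' : ℤ} {X : ℝ} (hr : Outer r)
    (hb : R.IsArg ω r X b) (hb' : R.IsArg ω r X b') (hne : b < b') :
    0 < R.gapHeight ω X ∧ b' = b + 1 ∧ (∀ m m', R.IsArg ω 1 X m → R.IsArg ω 1 X m' → m = m') ∧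
      ∀ m, R.IsArg ω 1 X m → fan m r b ∈ inducedSubdivision P ω := by
  obtain ⟨a, ha⟩ := exists_isArg (R := R) (ω := ω) (outer_bounds (Staircase.outer_mirror hr)).1
    (outer_bounds (Staircase.outer_mirror hr)).2 X
  -- A triangle with vertices only in the rows `0` and `2` has even doubled area, so it cannot be
  -- unimodular.
  by_cases hD : R.gapHeight ω X < 0
  · exfalso
    have := h.minimizers_eq (mem_minimizers_of_neg h.pts hD (z := (b, r)) hr hb)
      (mem_minimizers_of_neg h.pts hD (z := (b', r)) hr hb')
      (mem_minimizers_of_neg h.pts hD (z := (a, 2 - r)) (Staircase.outer_mirror hr) ha)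
    rcases hr with rfl | rfl <;> simp only [area2] at this <;> norm_num at this
    · have := (this (by omega)).2.1
      omega
    · have := (this (by omega)).2.1
      omega
  rw [not_lt] at hD
  have key : ∀ m, R.IsArg ω 1 X m →
      minimizers P ω (X, (r - 1) * (R.rowMin ω 1 X - R.rowMin ω r X)) = {(m, 1), (b, r), (b', r)} ∧
      |area2 (m, 1) (b, r) (b', r)| = 1 ∧
      {(m, 1), (b, r), (b', r)} ∈ inducedSubdivision P ω := by
    intro m hm
    refine h.minimizers_eq ?_ ?_ ?_ ?_
    · exact (mem_minimizers_of_nonneg h.pts hD hr).2 ⟨hm, Or.inl rfl⟩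
    · exact (mem_minimizers_of_nonneg h.pts hD hr).2 ⟨hb, Or.inr (Or.inl rfl)⟩
    · exact (mem_minimizers_of_nonneg h.pts hD hr).2 ⟨hb', Or.inr (Or.inl rfl)⟩
    · simp only [area2]
      rcases hr with rfl | rfl <;> norm_num <;> omega
  obtain ⟨m, hm⟩ := exists_isArg (R := R) (ω := ω) (r := 1) (by norm_num) (by norm_num) X
  have hbb : b' = b + 1 := by
    have := (key m hm).2.1
    simp only [area2] at this
    rcases hr with rfl | rfl <;> norm_num at this <;>
      rcases abs_eq (by norm_num : (0 : ℤ) ≤ 1) |>.1 this with h | h <;> omega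
  refine ⟨lt_of_le_of_ne hD fun h0 => ?_, hbb, ?_, ?_⟩
  · have : (a, 2 - r) ∈ minimizers P ω (X, (r - 1) * (R.rowMin ω 1 X - R.rowMin ω r X)) :=
      (mem_minimizers_of_nonneg h.pts hD hr).2 ⟨ha, Or.inr (Or.inr ⟨rfl, h0.symm⟩)⟩
    rw [(key m hm).1] at this
    simp only [Set.mem_insert_iff, Set.mem_singleton_iff, Prod.mk.injEq] at this
    rcases hr with rfl | rfl <;> omega
  · intro m m' hm hm'
    have : (m', 1) ∈ minimizers P ω (X, (r - 1) * (R.rowMin ω 1 X - R.rowMin ω r X)) :=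
      (mem_minimizers_of_nonneg h.pts hD hr).2 ⟨hm', Or.inl rfl⟩
    rw [(key m hm).1] at this
    simp only [Set.mem_insert_iff, Set.mem_singleton_iff, Prod.mk.injEq] at this
    rcases hr with rfl | rfl <;> omega
  · intro m hm
    have := (key m hm).2.2
    rwa [hbb] at this

theorem UnimodularOn.outer_unique (h : UnimodularOn R P ω) {r b b' : ℤ} {X : ℝ} (hr : Outer r)
    (hD : R.gapHeight ω X ≤ 0) (hb : R.IsArg ω r X b) (hb' : R.IsArg ω r X b') : b = b' := by
  rcases lt_trichotomy b b' with hlt | rfl | hlt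
  · exact absurd (h.two_outer hr hb hb' hlt).1 (not_lt.2 hD)
  · rfl
  · exact absurd (h.two_outer hr hb' hb hlt).1 (not_lt.2 hD)

/-- If the minimum in the middle row is attained twice and the middle row contributes, the two
points form cells together with the unique minimizers in the outer rows. -/
theorem UnimodularOn.two_mid (h : UnimodularOn R P ω) {m m' : ℤ} {X : ℝ}
    (hm : R.IsArg ω 1 X m) (hm' : R.IsArg ω 1 X m') (hne : m < m')
    (hD : 0 ≤ R.gapHeight ω X) :
    0 < R.gapHeight ω X ∧ m' = m + 1 ∧
      (∀ r, Outer r → ∀ b b', R.IsArg ω r X b → R.IsArg ω r X b' → b = b') ∧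
      ∀ r, Outer r → ∀ b, R.IsArg ω r X b →
        {(m, 1), (m + 1, 1), (b, r)} ∈ inducedSubdivision P ω := by
  have key : ∀ r, Outer r → ∀ b, R.IsArg ω r X b →
      minimizers P ω (X, (r - 1) * (R.rowMin ω 1 X - R.rowMin ω r X)) = {(m, 1), (m', 1), (b, r)} ∧
      |area2 (m, 1) (m', 1) (b, r)| = 1 ∧
      {(m, 1), (m', 1), (b, r)} ∈ inducedSubdivision P ω := by
    intro r hr b hb
    refine h.minimizers_eq ?_ ?_ ?_ ?_
    · exact (mem_minimizers_of_nonneg h.pts hD hr).2 ⟨hm, Or.inl rfl⟩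
    · exact (mem_minimizers_of_nonneg h.pts hD hr).2 ⟨hm', Or.inl rfl⟩
    · exact (mem_minimizers_of_nonneg h.pts hD hr).2 ⟨hb, Or.inr (Or.inl rfl)⟩
    · simp only [area2]
      rcases hr with rfl | rfl <;> norm_num <;> omega
  obtain ⟨a, ha⟩ := exists_isArg (R := R) (ω := ω) (r := 0) (by norm_num) (by norm_num) X
  obtain ⟨b, hb⟩ := exists_isArg (R := R) (ω := ω) (r := 2) (by norm_num) (by norm_num) X
  have hmm : m' = m + 1 := by
    have := (key 0 Staircase.outer_zero a ha).2.1
    simp only [area2] at this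
    norm_num at this
    rcases abs_eq (by norm_num : (0 : ℤ) ≤ 1) |>.1 this with h | h <;> omega
  refine ⟨lt_of_le_of_ne hD fun h0 => ?_, hmm, ?_, ?_⟩
  · have : (b, 2) ∈ minimizers P ω (X, ((0 : ℤ) - 1) * (R.rowMin ω 1 X - R.rowMin ω 0 X)) :=
      (mem_minimizers_of_nonneg h.pts hD Staircase.outer_zero).2
        ⟨hb, Or.inr (Or.inr ⟨rfl, h0.symm⟩)⟩
    rw [(key 0 Staircase.outer_zero a ha).1] at this
    simp at this
  · intro r hr b b' hb hb'
    have : (b', r) ∈ minimizers P ω (X, (r - 1) * (R.rowMin ω 1 X - R.rowMin ω r X)) :=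
      (mem_minimizers_of_nonneg h.pts hD hr).2 ⟨hb', Or.inr (Or.inl rfl)⟩
    rw [(key r hr b hb).1] at this
    simp only [Set.mem_insert_iff, Set.mem_singleton_iff, Prod.mk.injEq] at this
    rcases hr with rfl | rfl <;> omega
  · intro r hr b hb
    have := (key r hr b hb).2.2
    rwa [hmm] at this

theorem UnimodularOn.mid_unique (h : UnimodularOn R P ω) {m m' : ℤ} {X : ℝ}
    (hD : R.gapHeight ω X = 0) (hm : R.IsArg ω 1 X m) (hm' : R.IsArg ω 1 X m') : m = m' := by
  rcases lt_trichotomy m m' with hlt | rfl | hlt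
  · exact absurd hD (h.two_mid hm hm' hlt hD.ge).1.ne'
  · rfl
  · exact absurd hD (h.two_mid hm' hm hlt hD.ge).1.ne'

theorem gapHeight_eq {a m b : ℤ} {X : ℝ} (ha : R.IsArg ω 0 X a) (hm : R.IsArg ω 1 X m)
    (hb : R.IsArg ω 2 X b) :
    R.gapHeight ω X = rowTerm ω 0 a X + rowTerm ω 2 b X - 2 * rowTerm ω 1 m X := by
  rw [gapHeight, ha.rowMin_eq, hm.rowMin_eq, hb.rowMin_eq]

/-- Where the three rows meet, their minimizers form a unimodular triangle. -/
theorem UnimodularOn.three_rows (h : UnimodularOn R P ω) {a m b : ℤ} {X : ℝ}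
    (hD : R.gapHeight ω X = 0) (ha : R.IsArg ω 0 X a) (hm : R.IsArg ω 1 X m)
    (hb : R.IsArg ω 2 X b) :
    (a + b = 2 * m + 1 ∨ a + b = 2 * m - 1) ∧
      {(m, 1), (a, 0), (b, 2)} ∈ inducedSubdivision P ω := by
  -- If the sum were `2 * m`, `gapHeight` would stay zero wherever `a`, `m`, `b` are minimizers.
  -- Uniqueness makes this set open as well as closed, hence the whole line, whereas the middle
  -- minimizer must move from `hi 1` to `lo 1`.
  have hne : a + b ≠ 2 * m := by
    intro hsum
    have hsum' : (a : ℝ) + b = 2 * m := by exact_mod_cast hsum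
    let J : Set ℝ := {x | R.IsArg ω 0 x a} ∩ {x | R.IsArg ω 1 x m} ∩ {x | R.IsArg ω 2 x b}
    have hclosed : IsClosed J :=
      ((isClosed_isArg 0 a).inter (isClosed_isArg 1 m)).inter (isClosed_isArg 2 b)
    have hopen : IsOpen J := by
      rw [isOpen_iff_mem_nhds]
      rintro x ⟨⟨xa, xm⟩, xb⟩
      have hDx : R.gapHeight ω x = 0 := by
        rw [gapHeight_eq xa xm xb]
        rw [gapHeight_eq ha hm hb] at hD
        simp only [rowTerm] at hD ⊢
        linear_combination hD + (x - X) * hsum'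
      filter_upwards [xa.eventually fun b' hb' => h.outer_unique Staircase.outer_zero hDx.le hb' xa,
        xm.eventually fun b' hb' => h.mid_unique hDx hb' xm,
        xb.eventually fun b' hb' => h.outer_unique Staircase.outer_two hDx.le hb' xb] with y h1 h2 h3
      exact ⟨⟨h1, h2⟩, h3⟩
    have huniv := IsClopen.eq_univ ⟨hclosed, hopen⟩ ⟨X, ⟨ha, hm⟩, hb⟩
    have hall : ∀ x, R.IsArg ω 1 x m := fun x => by
      have : x ∈ J := by rw [huniv]; trivial
      exact this.1.2
    have hg := R.two_le
    have hlt : R.lo 1 < R.hi 1 := by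
      rcases R.left with h | h <;> rcases R.right with h' | h' <;> omega
    obtain ⟨X₁, hX₁⟩ := (eventually_isArg_lo (R := R) (ω := ω) (r := 1) (by norm_num)
      (by norm_num)).exists
    obtain ⟨X₂, hX₂⟩ := (eventually_isArg_hi (R := R) (ω := ω) (r := 1) (by norm_num)
      (by norm_num)).exists
    have h1 := (hall (X₁ - 1)).anti hX₁ (by linarith)
    have h2 := hX₁.anti (hall (X₁ + 1)) (by linarith)
    have h3 := (hall (X₂ - 1)).anti hX₂ (by linarith)
    have h4 := hX₂.anti (hall (X₂ + 1)) (by linarith)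
    omega
  have hcell := h.minimizers_eq (p := (m, 1)) (q := (a, 0)) (s := (b, 2))
    ((mem_minimizers_of_nonneg h.pts hD.ge Staircase.outer_zero).2 ⟨hm, Or.inl rfl⟩)
    ((mem_minimizers_of_nonneg h.pts hD.ge Staircase.outer_zero).2 ⟨ha, Or.inr (Or.inl rfl)⟩)
    ((mem_minimizers_of_nonneg h.pts hD.ge Staircase.outer_zero).2
      ⟨hb, Or.inr (Or.inr ⟨rfl, hD⟩)⟩) (by simp only [area2]; norm_num; omega)
  refine ⟨?_, hcell.2.2⟩
  have := hcell.2.1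
  simp only [area2] at this
  norm_num at this
  rcases abs_eq (by norm_num : (0 : ℤ) ≤ 1) |>.1 this with h | h <;> omega

end Rows

end TropicalModuli

end


noncomputable section

namespace TropicalModuli

open Filter Topology

namespace Rows

variable {R : Rows} {ω : ℤ × ℤ → ℝ} {P : Set (ℝ × ℝ)}

/-! ### Where the middle row does not contribute -/

/-- As long as the middle row does not contribute, the minimizers in the outer rows do not
change. -/
theorem UnimodularOn.isArg_of_neg (h : UnimodularOn R P ω) {r b : ℤ} (hr : Outer r) {X s τ : ℝ}
    (hτ : 0 ≤ τ) (hneg : ∀ t, 0 ≤ t → t < τ → R.gapHeight ω (X + s * t) < 0)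
    (hb : R.IsArg ω r X b) : R.IsArg ω r (X + s * τ) b := by
  have hcont : Continuous fun t : ℝ => X + s * t := by fun_prop
  -- Take the last time at which `b` is still a minimizer. If it came before `τ`, uniqueness there
  -- would let `b` survive a little longer.
  have hcomp : IsCompact (Set.Icc 0 τ ∩ (fun t : ℝ => X + s * t) ⁻¹' {x | R.IsArg ω r x b}) :=
    isCompact_Icc.inter_right ((isClosed_isArg r b).preimage hcont)
  obtain ⟨t, ⟨⟨ht0, htτ⟩, ht⟩, hmax⟩ := hcomp.exists_isGreatest ⟨0, ⟨le_rfl, hτ⟩, by simpa using hb⟩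
  rcases htτ.eq_or_lt with rfl | hlt
  · exact ht
  exfalso
  have hD := hneg t ht0 hlt
  have hev := (IsArg.eventually (show R.IsArg ω r (X + s * t) b from ht)
    fun b' hb' => h.outer_unique hr hD.le hb' ht)
  have hev' : ∀ᶠ u in 𝓝[>] t, R.IsArg ω r (X + s * u) b :=
    (hcont.continuousAt.eventually hev).filter_mono nhdsWithin_le_nhds
  obtain ⟨u, hu, hu'⟩ := (hev'.and (Ioo_mem_nhdsGT hlt)).exists
  exact absurd (hmax ⟨⟨ht0.trans hu'.1.le, hu'.2.le⟩, hu⟩) (not_le.2 hu'.1)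

/-- Moving in direction `s = ±1` from a point where the middle row does not contribute, either one
reaches a point where the three rows meet, or the middle row never contributes. -/
theorem UnimodularOn.walk (h : UnimodularOn R P ω) {a b s : ℤ} (hs : s = 1 ∨ s = -1) {X : ℝ}
    (hD : R.gapHeight ω X < 0) (ha : R.IsArg ω 0 X a) (hb : R.IsArg ω 2 X b) :
    (∃ m, ∃ τ : ℝ, 0 < τ ∧ R.IsArg ω 1 (X + s * τ) m ∧ a + b - 2 * m = s ∧
      {(m, 1), (a, 0), (b, 2)} ∈ inducedSubdivision P ω) ∨
    ∀ τ : ℝ, 0 ≤ τ → R.gapHeight ω (X + s * τ) < 0 ∧ R.IsArg ω 0 (X + s * τ) a ∧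
      R.IsArg ω 2 (X + s * τ) b := by
  have hcont : Continuous fun t : ℝ => R.gapHeight ω (X + s * t) :=
    continuous_gapHeight.comp (by fun_prop)
  by_cases hex : ∃ τ : ℝ, 0 ≤ τ ∧ 0 ≤ R.gapHeight ω (X + s * τ)
  · left
    obtain ⟨τ, hτ, hτD⟩ := hex
    -- The first time at which the middle row contributes; `gapHeight` vanishes there by the
    -- intermediate value theorem.
    have hcomp : IsCompact (Set.Icc 0 τ ∩ (fun t : ℝ => R.gapHeight ω (X + s * t)) ⁻¹' Set.Ici 0) :=
      isCompact_Icc.inter_right (isClosed_Ici.preimage hcont)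
    obtain ⟨t, ⟨⟨ht0, htτ⟩, ht⟩, hmin⟩ := hcomp.exists_isLeast ⟨τ, ⟨hτ, le_rfl⟩, hτD⟩
    have hneg : ∀ u, 0 ≤ u → u < t → R.gapHeight ω (X + s * u) < 0 := by
      intro u hu0 hut
      by_contra hge
      exact absurd (hmin ⟨⟨hu0, hut.le.trans htτ⟩, not_lt.1 hge⟩) (not_le.2 hut)
    have htpos : 0 < t := by
      rcases ht0.eq_or_lt with rfl | h0
      · simp only [Set.mem_preimage, mul_zero, add_zero, Set.mem_Ici] at ht
        exact absurd hD (not_lt.2 ht)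
      · exact h0
    have hzero : R.gapHeight ω (X + s * t) = 0 := by
      have himg := intermediate_value_Icc ht0 hcont.continuousOn
      have h0mem : (0 : ℝ) ∈ Set.Icc (R.gapHeight ω (X + s * 0)) (R.gapHeight ω (X + s * t)) :=
        ⟨by simpa using hD.le, ht⟩
      obtain ⟨u, ⟨hu0, hut⟩, hu⟩ := himg h0mem
      have : u = t := by
        rcases hut.eq_or_lt with h | h
        · exact h
        · exact absurd hu (hneg u hu0 h).ne
      rw [← this]; exact hu
    have ha' := h.isArg_of_neg Staircase.outer_zero ht0 hneg ha
    have hb' := h.isArg_of_neg Staircase.outer_two ht0 hneg hb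
    obtain ⟨m, hm⟩ := exists_isArg (R := R) (ω := ω) (r := 1) (by norm_num) (by norm_num)
      (X + s * t)
    obtain ⟨hsum, hcell⟩ := h.three_rows hzero ha' hm hb'
    refine ⟨m, t, htpos, hm, ?_, hcell⟩
    -- the height is below the linear function through the meeting point
    have h1 : R.rowMin ω 1 X ≤ rowTerm ω 1 m X :=
      rowMin_le (by norm_num) (by norm_num) hm.1 hm.2.1
    rw [gapHeight_eq ha' hm hb'] at hzero
    rw [gapHeight, ha.rowMin_eq, hb.rowMin_eq] at hD
    have hpos : 0 < ((a + b - 2 * m : ℤ) : ℝ) * s * t := by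
      simp only [rowTerm] at hzero hD h1
      push_cast
      nlinarith
    have hpos' : 0 < (a + b - 2 * m) * s := by
      have := pos_of_mul_pos_left hpos htpos.le
      exact_mod_cast this
    rcases hs with rfl | rfl <;> rcases hsum with h | h <;> omega
  · right
    push Not at hex
    intro τ hτ
    exact ⟨hex τ hτ, h.isArg_of_neg Staircase.outer_zero hτ (fun t ht _ => hex t ht) ha,
      h.isArg_of_neg Staircase.outer_two hτ (fun t ht _ => hex t ht) hb⟩

/-- Far to the right the minimizers are the left ends of the rows, and `gapHeight` is affine there.
Remaining negative forces a nonpositive slope, and the shape of the left end leaves only this sum.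
-/
theorem UnimodularOn.sum_of_walk_right (h : UnimodularOn R P ω) {a b : ℤ} {X : ℝ}
    (hinf : ∀ τ : ℝ, 0 ≤ τ → R.gapHeight ω (X + (1 : ℤ) * τ) < 0 ∧
      R.IsArg ω 0 (X + (1 : ℤ) * τ) a ∧ R.IsArg ω 2 (X + (1 : ℤ) * τ) b) :
    a + b = R.lo 1 := by
  have hev : ∀ᶠ x in atTop, R.gapHeight ω x < 0 ∧ R.IsArg ω 0 x a ∧ R.IsArg ω 2 x b := by
    filter_upwards [eventually_ge_atTop X] with x hx
    have := hinf (x - X) (by linarith)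
    simpa using this
  have hlo0 := eventually_isArg_lo (R := R) (ω := ω) (r := 0) (by norm_num) (by norm_num)
  have hlo1 := eventually_isArg_lo (R := R) (ω := ω) (r := 1) (by norm_num) (by norm_num)
  have hlo2 := eventually_isArg_lo (R := R) (ω := ω) (r := 2) (by norm_num) (by norm_num)
  obtain ⟨x, ⟨hD, xa, xb⟩, x0, x2⟩ := (hev.and (hlo0.and hlo2)).exists
  have ha := h.outer_unique Staircase.outer_zero hD.le xa x0
  have hb := h.outer_unique Staircase.outer_two hD.le xb x2
  have hslope : a + b - 2 * R.lo 1 ≤ 0 := by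
    by_contra hpos
    have hpos' : (1 : ℝ) ≤ a + b - 2 * R.lo 1 := by exact_mod_cast not_le.1 hpos
    obtain ⟨y, ⟨⟨hDy, ya, yb⟩, y1⟩, hy⟩ := ((hev.and hlo1).and (eventually_ge_atTop
      (|ω (a, 0) + ω (b, 2) - 2 * ω (R.lo 1, 1)|))).exists
    rw [gapHeight_eq ya y1 yb] at hDy
    simp only [rowTerm] at hDy
    have := neg_abs_le (ω (a, 0) + ω (b, 2) - 2 * ω (R.lo 1, 1))
    nlinarith [abs_nonneg (ω (a, 0) + ω (b, 2) - 2 * ω (R.lo 1, 1))]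
  rcases R.left with h | h <;> omega

/-- Mirror image: a nonnegative slope at minus infinity, so the sum is `2 * g + 2` or `2 * g + 1`
according to whether `(g + 1, 1)` is present. -/
theorem UnimodularOn.sum_of_walk_left (h : UnimodularOn R P ω) {a b : ℤ} {X : ℝ}
    (hinf : ∀ τ : ℝ, 0 ≤ τ → R.gapHeight ω (X + (-1 : ℤ) * τ) < 0 ∧
      R.IsArg ω 0 (X + (-1 : ℤ) * τ) a ∧ R.IsArg ω 2 (X + (-1 : ℤ) * τ) b) :
    a + b = R.hi 1 + R.g + 1 := by
  have hev : ∀ᶠ x in atBot, R.gapHeight ω x < 0 ∧ R.IsArg ω 0 x a ∧ R.IsArg ω 2 x b := by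
    filter_upwards [eventually_le_atBot X] with x hx
    have := hinf (X - x) (by linarith)
    simpa using this
  have hhi0 := eventually_isArg_hi (R := R) (ω := ω) (r := 0) (by norm_num) (by norm_num)
  have hhi1 := eventually_isArg_hi (R := R) (ω := ω) (r := 1) (by norm_num) (by norm_num)
  have hhi2 := eventually_isArg_hi (R := R) (ω := ω) (r := 2) (by norm_num) (by norm_num)
  obtain ⟨x, ⟨hD, xa, xb⟩, x0, x2⟩ := (hev.and (hhi0.and hhi2)).exists
  have ha := h.outer_unique Staircase.outer_zero hD.le xa x0
  have hb := h.outer_unique Staircase.outer_two hD.le xb x2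
  have hslope : 0 ≤ a + b - 2 * R.hi 1 := by
    by_contra hpos
    have hpos' : (a + b - 2 * R.hi 1 : ℝ) ≤ -1 := by
      have : a + b - 2 * R.hi 1 ≤ -1 := by omega
      exact_mod_cast this
    obtain ⟨y, ⟨⟨hDy, ya, yb⟩, y1⟩, hy⟩ := ((hev.and hhi1).and (eventually_le_atBot
      (-|ω (a, 0) + ω (b, 2) - 2 * ω (R.hi 1, 1)|))).exists
    rw [gapHeight_eq ya y1 yb] at hDy
    simp only [rowTerm] at hDy
    have := neg_abs_le (ω (a, 0) + ω (b, 2) - 2 * ω (R.hi 1, 1))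
    nlinarith [abs_nonneg (ω (a, 0) + ω (b, 2) - 2 * ω (R.hi 1, 1))]
  rcases R.right with h | h <;> omega

theorem IsArg.eq_sub {r b : ℤ} {X : ℝ} (h : R.IsArg ω r X b) (h' : R.IsArg ω r X (b + 1)) :
    X = ω (b, r) - ω (b + 1, r) := by
  have := h.rowMin_eq.symm.trans h'.rowMin_eq
  simp only [rowTerm] at this
  push_cast at this
  linarith

/-- The structure of the subdivision between `(i, 1)` and `(i + 1, 1)`. -/
theorem UnimodularOn.gap (h : UnimodularOn R P ω) {i : ℤ} (hl : R.lo 1 ≤ i) (hu : i < R.hi 1) :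
    ∃ X a b, R.IsArg ω 1 X i ∧ R.IsArg ω 1 X (i + 1) ∧ R.IsArg ω 0 X a ∧ R.IsArg ω 2 X b ∧
      (∀ a', R.IsArg ω 0 X a' → a' = a) ∧ (∀ b', R.IsArg ω 2 X b' → b' = b) ∧
      ((0 < R.gapHeight ω X ∧ {(i, 1), (i + 1, 1), (a, 0)} ∈ inducedSubdivision P ω ∧
        {(i, 1), (i + 1, 1), (b, 2)} ∈ inducedSubdivision P ω) ∨
      (R.gapHeight ω X < 0 ∧ a + b = 2 * i + 1 ∧
        {(i, 1), (a, 0), (b, 2)} ∈ inducedSubdivision P ω ∧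
        {(i + 1, 1), (a, 0), (b, 2)} ∈ inducedSubdivision P ω)) := by
  obtain ⟨X, m, m', hmi, him, hm, hm'⟩ :=
    exists_crossing (R := R) (ω := ω) (r := 1) (by norm_num) (by norm_num) hl hu
  obtain ⟨a, ha⟩ := exists_isArg (R := R) (ω := ω) (r := 0) (by norm_num) (by norm_num) X
  obtain ⟨b, hb⟩ := exists_isArg (R := R) (ω := ω) (r := 2) (by norm_num) (by norm_num) X
  by_cases hD : 0 ≤ R.gapHeight ω X
  · obtain ⟨hpos, hmm, huniq, hcell⟩ := h.two_mid hm hm' (by omega) hD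
    obtain rfl : m = i := by omega
    subst hmm
    exact ⟨X, a, b, hm, hm', ha, hb,
      fun a' ha' => huniq 0 Staircase.outer_zero _ _ ha' ha,
      fun b' hb' => huniq 2 Staircase.outer_two _ _ hb' hb,
      Or.inl ⟨hpos, hcell 0 Staircase.outer_zero a ha, hcell 2 Staircase.outer_two b hb⟩⟩
  · rw [not_le] at hD
    have hg := R.two_le
    have hlo := Staircase.lo_one_eq R
    have hhi := Staircase.hi_one_eq R
    -- Walking right ends at `m₁` with `a + b = 2 * m₁ + 1` and walking left at `m₂` with `a + b = 2
    -- * m₂ - 1`, so `m₂ = m₁ + 1`. As `m₁ ≤ i < m₂`, both are determined. An endless walk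
    -- contradicts the sums found for it.
    rcases h.walk (Or.inl rfl) hD ha hb with ⟨m₁, τ₁, hτ₁, hm₁, hs₁, hc₁⟩ | hinf₁
    · have hle₁ := hm.anti hm₁ (by push_cast; linarith)
      rcases h.walk (Or.inr rfl) hD ha hb with ⟨m₂, τ₂, hτ₂, hm₂, hs₂, hc₂⟩ | hinf₂
      · have hle₂ := hm₂.anti hm' (by push_cast; linarith)
        obtain rfl : m₁ = i := by omega
        obtain rfl : m₂ = m₁ + 1 := by omega
        obtain rfl : m = m₁ := by omega
        obtain rfl : m' = m + 1 := by omega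
        exact ⟨X, a, b, hm, hm', ha, hb,
          fun a' ha' => h.outer_unique Staircase.outer_zero hD.le ha' ha,
          fun b' hb' => h.outer_unique Staircase.outer_two hD.le hb' hb,
          Or.inr ⟨hD, by omega, hc₁, hc₂⟩⟩
      · have := h.sum_of_walk_left hinf₂
        omega
    · have hsum := h.sum_of_walk_right hinf₁
      rcases h.walk (Or.inr rfl) hD ha hb with ⟨m₂, τ₂, hτ₂, hm₂, hs₂, hc₂⟩ | hinf₂
      · have hle₂ := hm₂.anti hm' (by push_cast; linarith)
        omega
      · have := h.sum_of_walk_left hinf₂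
        omega

/-- Without `(0, 1)` the slope of `gapHeight` at plus infinity is `1 - 2 = -1`, so it is negative
far right; walking back to the left must end in this triangle. -/
theorem UnimodularOn.left_end (h : UnimodularOn R P ω) (hlo : R.lo 1 = 1) :
    {(1, 1), (R.lo 0, 0), (R.lo 2, 2)} ∈ inducedSubdivision P ω := by
  have hg := R.two_le
  have hhi := Staircase.hi_one_eq R
  have hsum : R.lo 0 + R.lo 2 = 1 := by rcases R.left with h | h <;> omega
  have hlo0 := eventually_isArg_lo (R := R) (ω := ω) (r := 0) (by norm_num) (by norm_num)
  have hlo1 := eventually_isArg_lo (R := R) (ω := ω) (r := 1) (by norm_num) (by norm_num)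
  have hlo2 := eventually_isArg_lo (R := R) (ω := ω) (r := 2) (by norm_num) (by norm_num)
  obtain ⟨X, ⟨h0, h1, h2⟩, hX⟩ := ((hlo0.and (hlo1.and hlo2)).and (eventually_gt_atTop
    (ω (R.lo 0, 0) + ω (R.lo 2, 2) - 2 * ω (R.lo 1, 1)))).exists
  have hD : R.gapHeight ω X < 0 := by
    rw [gapHeight_eq h0 h1 h2]
    have hsum' : (R.lo 0 + R.lo 2 : ℝ) = 1 := by exact_mod_cast hsum
    have hlo' : (R.lo 1 : ℝ) = 1 := by exact_mod_cast hlo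
    have hmul : (R.lo 0 + R.lo 2 : ℝ) * X = 1 * X := by rw [hsum']
    simp only [rowTerm]
    rw [hlo']
    linarith
  rcases h.walk (Or.inr rfl) hD h0 h2 with ⟨m, τ, hτ, hm, hs, hc⟩ | hinf
  · obtain rfl : m = 1 := by omega
    exact hc
  · have := h.sum_of_walk_left hinf
    omega

theorem UnimodularOn.right_end (h : UnimodularOn R P ω) (hhi : R.hi 1 = R.g) :
    {(R.g, 1), (R.hi 0, 0), (R.hi 2, 2)} ∈ inducedSubdivision P ω := by
  have hg := R.two_le
  have hlo := Staircase.lo_one_eq R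
  have hsum : R.hi 0 + R.hi 2 = 2 * R.g + 1 := by rcases R.right with h | h <;> omega
  have hhi0 := eventually_isArg_hi (R := R) (ω := ω) (r := 0) (by norm_num) (by norm_num)
  have hhi1 := eventually_isArg_hi (R := R) (ω := ω) (r := 1) (by norm_num) (by norm_num)
  have hhi2 := eventually_isArg_hi (R := R) (ω := ω) (r := 2) (by norm_num) (by norm_num)
  obtain ⟨X, ⟨h0, h1, h2⟩, hX⟩ := ((hhi0.and (hhi1.and hhi2)).and (eventually_lt_atBot
    (-(ω (R.hi 0, 0) + ω (R.hi 2, 2) - 2 * ω (R.hi 1, 1))))).exists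
  have hD : R.gapHeight ω X < 0 := by
    rw [gapHeight_eq h0 h1 h2]
    have hsum' : (R.hi 0 + R.hi 2 : ℝ) = 2 * R.hi 1 + 1 := by rw [hhi]; exact_mod_cast hsum
    have hmul : (R.hi 0 + R.hi 2 : ℝ) * X = (2 * R.hi 1 + 1) * X := by rw [hsum']
    simp only [rowTerm]
    linarith
  rcases h.walk (Or.inl rfl) hD h0 h2 with ⟨m, τ, hτ, hm, hs, hc⟩ | hinf
  · obtain rfl : m = R.g := by omega
    exact hc
  · have := h.sum_of_walk_right hinf
    omega

/-- A cell with a vertex in each row lies at the gap next to it. -/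
theorem UnimodularOn.wedge_unique (h : UnimodularOn R P ω) {a m b k : ℤ} {X Z : ℝ} {s : ℤ}
    (hs : s = 1 ∨ s = -1) (hD : R.gapHeight ω X = 0) (ha : R.IsArg ω 0 X a)
    (hm : R.IsArg ω 1 X m) (hb : R.IsArg ω 2 X b) (hsum : a + b - 2 * m = s)
    (hZ : R.IsArg ω 1 Z m) (hk : R.IsArg ω 1 Z k) (hmk : k = m + s) :
    R.gapHeight ω Z < 0 ∧ (∀ a', R.IsArg ω 0 Z a' → a' = a) ∧
      ∀ b', R.IsArg ω 2 Z b' → b' = b := by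
  -- The terms of `m` and `m + s` agree at `Z`, while at `X` the minimizer `m` is unique. So `X`
  -- lies on the side `s` of `Z`.
  have hτ : 0 < s * (X - Z) := by
    have hlt : rowTerm ω 1 m X < rowTerm ω 1 k X := by
      refine lt_of_le_of_ne (hm.2.2 k hk.1 hk.2.1) fun he => ?_
      have : R.IsArg ω 1 X k := ⟨hk.1, hk.2.1, fun b' h1 h2 => he ▸ hm.2.2 b' h1 h2⟩
      have := h.mid_unique hD hm this
      omega
    have heq := hZ.rowMin_eq.symm.trans hk.rowMin_eq
    have hmk' : (k : ℝ) = m + s := by exact_mod_cast hmk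
    simp only [rowTerm] at hlt heq
    rw [hmk'] at hlt heq
    nlinarith
  have hss : (s : ℝ) * s = 1 := by rcases hs with rfl | rfl <;> norm_num
  have hX : Z + s * (s * (X - Z)) = X := by linear_combination (X - Z) * hss
  -- Between `Z` and `X` the point `m` stays a minimizer, so `gapHeight` is bounded by the affine
  -- function of `a`, `m`, `b`. That function has slope `s` and vanishes at `X`.
  have hneg : ∀ t, 0 ≤ t → t < s * (X - Z) → R.gapHeight ω (Z + s * t) < 0 := by
    intro t ht0 ht
    have e0 : R.rowMin ω 0 (Z + s * t) ≤ rowTerm ω 0 a (Z + s * t) :=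
      rowMin_le (by norm_num) (by norm_num) ha.1 ha.2.1
    have e2 : R.rowMin ω 2 (Z + s * t) ≤ rowTerm ω 2 b (Z + s * t) :=
      rowMin_le (by norm_num) (by norm_num) hb.1 hb.2.1
    have e1 : R.IsArg ω 1 (Z + s * t) m := by
      refine ⟨hm.1, hm.2.1, fun m' h1 h2 => ?_⟩
      have f1 := hm.2.2 m' h1 h2
      have f2 := hZ.2.2 m' h1 h2
      simp only [rowTerm] at f1 f2 ⊢
      set c := s * (X - Z) with hc
      have g1 := mul_le_mul_of_nonneg_left f1 ht0
      have g2 := mul_le_mul_of_nonneg_left f2 (sub_nonneg.2 ht.le)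
      rw [← hX] at g1
      refine le_of_mul_le_mul_left ?_ hτ
      linarith
    rw [gapHeight, e1.rowMin_eq]
    rw [gapHeight_eq ha hm hb] at hD
    have hsum' : (a + b - 2 * m : ℝ) = s := by exact_mod_cast hsum
    simp only [rowTerm] at *
    have : ω (a, 0) + a * (Z + s * t) + (ω (b, 2) + b * (Z + s * t)) -
        2 * (ω (m, 1) + m * (Z + s * t)) = t - s * (X - Z) := by
      linear_combination hD + (Z + s * t - X) * hsum' + t * hss
    linarith
  have hDZ : R.gapHeight ω Z < 0 := by simpa using hneg 0 le_rfl hτ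
  refine ⟨hDZ, fun a' ha' => ?_, fun b' hb' => ?_⟩
  · have := h.isArg_of_neg Staircase.outer_zero hτ.le hneg ha'
    rw [hX] at this
    exact h.outer_unique Staircase.outer_zero hD.le this ha
  · have := h.isArg_of_neg Staircase.outer_two hτ.le hneg hb'
    rw [hX] at this
    exact h.outer_unique Staircase.outer_two hD.le this hb

end Rows

end TropicalModuli

end


/-! ### Every regular unimodular triangulation is a staircase -/

noncomputable section

namespace TropicalModuli

namespace Rows

variable {R : Rows} {ω : ℤ × ℤ → ℝ} {P : Set (ℝ × ℝ)}

theorem gapHeight_nonneg_of_mem (hP : latticePoints P = R.pts) {m : ℤ} {X Y : ℝ}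
    (h : (m, 1) ∈ minimizers P ω (X, Y)) : 0 ≤ R.gapHeight ω X := by
  obtain ⟨-, -, -, hmin⟩ := (mem_minimizers hP).1 h
  have h0 := hmin 0 (by norm_num) (by norm_num)
  have h2 := hmin 2 (by norm_num) (by norm_num)
  simp only at h0 h2
  push_cast at h0 h2
  unfold gapHeight
  linarith

theorem gapHeight_eq_zero_of_mem (hP : latticePoints P = R.pts) {a m b : ℤ} {X Y : ℝ}
    (ha : (a, 0) ∈ minimizers P ω (X, Y)) (hm : (m, 1) ∈ minimizers P ω (X, Y))
    (hb : (b, 2) ∈ minimizers P ω (X, Y)) : R.gapHeight ω X = 0 := by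
  refine le_antisymm ?_ (gapHeight_nonneg_of_mem hP hm)
  have h0 := ((mem_minimizers hP).1 ha).2.2.2 1 (by norm_num) (by norm_num)
  have h2 := ((mem_minimizers hP).1 hb).2.2.2 1 (by norm_num) (by norm_num)
  simp only at h0 h2
  push_cast at h0 h2
  unfold gapHeight
  linarith

/-- A regular unimodular triangulation of a polygon with three rows is given by a staircase. -/
theorem UnimodularOn.exists_staircase (h : UnimodularOn R P ω) :
    ∃ S : Staircase R, inducedSubdivision P ω = S.triangulation ∧
      ∀ i, R.lo 1 ≤ i → i < R.hi 1 →
        (∀ r, Outer r → R.IsArg ω r (ω (i, 1) - ω (i + 1, 1)) (S.pos r i)) ∧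
        (i ∈ S.split → R.gapHeight ω (ω (i, 1) - ω (i + 1, 1)) < 0) := by
  classical
  have hg := R.two_le
  have hlo1 := Staircase.lo_one_eq R
  have hhi1 := Staircase.hi_one_eq R
  have hgap : ∀ i, ∃ a b, R.lo 1 ≤ i → i < R.hi 1 →
      ∃ X, X = ω (i, 1) - ω (i + 1, 1) ∧
      R.IsArg ω 1 X i ∧ R.IsArg ω 1 X (i + 1) ∧ R.IsArg ω 0 X a ∧ R.IsArg ω 2 X b ∧
      (∀ a', R.IsArg ω 0 X a' → a' = a) ∧ (∀ b', R.IsArg ω 2 X b' → b' = b) ∧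
      ((0 < R.gapHeight ω X ∧ {(i, 1), (i + 1, 1), (a, 0)} ∈ inducedSubdivision P ω ∧
        {(i, 1), (i + 1, 1), (b, 2)} ∈ inducedSubdivision P ω) ∨
      (R.gapHeight ω X < 0 ∧ a + b = 2 * i + 1 ∧
        {(i, 1), (a, 0), (b, 2)} ∈ inducedSubdivision P ω ∧
        {(i + 1, 1), (a, 0), (b, 2)} ∈ inducedSubdivision P ω)) := by
    intro i
    by_cases hi : R.lo 1 ≤ i ∧ i < R.hi 1
    · obtain ⟨X, a, b, h1, h2, h3⟩ := h.gap hi.1 hi.2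
      exact ⟨a, b, fun _ _ => ⟨X, h1.eq_sub h2, h1, h2, h3⟩⟩
    · exact ⟨0, 0, fun h1 h2 => absurd ⟨h1, h2⟩ hi⟩
  choose a b hgap using hgap
  set X : ℤ → ℝ := fun i => ω (i, 1) - ω (i + 1, 1) with hX
  have hgap' : ∀ i, R.lo 1 ≤ i → i < R.hi 1 →
      R.IsArg ω 1 (X i) i ∧ R.IsArg ω 1 (X i) (i + 1) ∧ R.IsArg ω 0 (X i) (a i) ∧
      R.IsArg ω 2 (X i) (b i) ∧
      (∀ a', R.IsArg ω 0 (X i) a' → a' = a i) ∧ (∀ b', R.IsArg ω 2 (X i) b' → b' = b i) ∧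
      ((0 < R.gapHeight ω (X i) ∧ {(i, 1), (i + 1, 1), (a i, 0)} ∈ inducedSubdivision P ω ∧
        {(i, 1), (i + 1, 1), (b i, 2)} ∈ inducedSubdivision P ω) ∨
      (R.gapHeight ω (X i) < 0 ∧ a i + b i = 2 * i + 1 ∧
        {(i, 1), (a i, 0), (b i, 2)} ∈ inducedSubdivision P ω ∧
        {(i + 1, 1), (a i, 0), (b i, 2)} ∈ inducedSubdivision P ω)) := by
    intro i h1 h2
    obtain ⟨x, rfl, hx⟩ := hgap i h1 h2
    exact hx
  clear hgap
  -- At a gap with both middle points present, the outer vertex is the row minimizer at the break `X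
  -- i`; beyond the ends of the middle row it is the end of the outer row.
  let pos : ℤ → ℤ → ℤ := fun r i =>
    if i < R.lo 1 then R.lo r else if R.hi 1 ≤ i then R.hi r else if r = 0 then a i else b i
  have pos_lo : ∀ r i, i < R.lo 1 → pos r i = R.lo r := fun r i hi => if_pos hi
  have pos_hi : ∀ r i, R.lo 1 ≤ i → R.hi 1 ≤ i → pos r i = R.hi r := fun r i hi hi' => by
    simp only [pos]; rw [if_neg (by omega), if_pos hi']
  have pos_zero : ∀ i, R.lo 1 ≤ i → i < R.hi 1 → pos 0 i = a i := fun i hi hi' => by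
    simp only [pos]; rw [if_neg (by omega), if_neg (by omega), if_pos trivial]
  have pos_two : ∀ i, R.lo 1 ≤ i → i < R.hi 1 → pos 2 i = b i := fun i hi hi' => by
    simp only [pos]; rw [if_neg (by omega), if_neg (by omega), if_neg (by norm_num)]
  have pos_arg : ∀ r, Outer r → ∀ i, R.lo 1 ≤ i → i < R.hi 1 →
      R.IsArg ω r (X i) (pos r i) ∧ ∀ c, R.IsArg ω r (X i) c → c = pos r i := by
    rintro r (rfl | rfl) i h1 h2
    · rw [pos_zero i h1 h2]
      exact ⟨(hgap' i h1 h2).2.2.1, (hgap' i h1 h2).2.2.2.2.1⟩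
    · rw [pos_two i h1 h2]
      exact ⟨(hgap' i h1 h2).2.2.2.1, (hgap' i h1 h2).2.2.2.2.2.1⟩
  -- where the cell over `(c, r), (c + 1, r)` is
  have fan_pos : ∀ r, Outer r → ∀ c m x, R.IsArg ω r x c → R.IsArg ω r x (c + 1) →
      R.IsArg ω 1 x m → pos r (m - 1) ≤ c ∧ c < pos r m := by
    intro r hr c m x hc hc' hm
    obtain ⟨-, -, huniq, -⟩ := h.two_outer hr hc hc' (by omega)
    constructor
    · by_cases hlo : R.lo 1 ≤ m - 1
      · have hhi : m - 1 < R.hi 1 := by have := hm.2.1; omega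
        obtain ⟨g1, g2, -⟩ := hgap' (m - 1) hlo hhi
        obtain ⟨g3, g4⟩ := pos_arg r hr (m - 1) hlo hhi
        -- The breaks `X i` decrease with `i`. Equality would give two middle minimizers at `x`, and
        -- a larger `x` would push the minimizer below `m`, so only `x < X (m - 1)` is possible.
        rcases lt_trichotomy x (X (m - 1)) with hx | hx | hx
        · exact hc.anti g3 hx
        · rw [← hx] at g1
          have := huniq _ _ g1 hm
          omega
        · have := g1.anti hm hx
          omega
      · rw [pos_lo r _ (by omega)]
        exact hc.1
    · by_cases hhi : R.hi 1 ≤ m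
      · have := hm.1
        rw [pos_hi r _ (by omega) hhi]
        have := hc'.2.1
        omega
      · have hlo : R.lo 1 ≤ m := hm.1
        obtain ⟨g1, g2, -⟩ := hgap' m hlo (by omega)
        obtain ⟨g3, g4⟩ := pos_arg r hr m hlo (by omega)
        rcases lt_trichotomy x (X m) with hx | hx | hx
        · have := hm.anti g2 hx
          omega
        · rw [← hx] at g2
          have := huniq _ _ g2 hm
          omega
        · have := g3.anti hc' hx
          omega
  let S : Staircase R :=
    { pos := pos
      -- The first two conditions mark gaps with a missing middle point; in the range of gaps they
      -- concern only `0` and `g`.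
      split := {i | i < R.lo 1 ∨ R.hi 1 ≤ i ∨ R.gapHeight ω (X i) < 0}
      pos_neg_one := fun r _ => pos_lo r _ (by omega)
      pos_last := fun r _ => pos_hi r _ (by omega) (by omega)
      pos_le_succ := by
        intro r hr i h1 h2
        obtain ⟨hr0, hr2⟩ := outer_bounds hr
        have hlh := lo_le_hi' (R := R) hr0 hr2
        by_cases c1 : i + 1 < R.lo 1
        · rw [pos_lo r i (by omega), pos_lo r _ c1]
        by_cases c2 : R.hi 1 ≤ i
        · rw [pos_hi r i (by omega) c2, pos_hi r _ (by omega) (by omega)]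
        by_cases c3 : i < R.lo 1
        · rw [pos_lo r i c3]
          by_cases c4 : R.hi 1 ≤ i + 1
          · rw [pos_hi r _ (by omega) c4]; exact hlh
          · exact (pos_arg r hr (i + 1) (by omega) (by omega)).1.1
        · by_cases c4 : R.hi 1 ≤ i + 1
          · rw [pos_hi r (i + 1) (by omega) c4]
            exact (pos_arg r hr i (by omega) (by omega)).1.2.1
          · have p1 := (pos_arg r hr i (by omega) (by omega)).1
            have p2 := (pos_arg r hr (i + 1) (by omega) (by omega))
            have g1 := (hgap' i (by omega) (by omega))
            have g2 := (hgap' (i + 1) (by omega) (by omega))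
            rcases lt_trichotomy (X (i + 1)) (X i) with hx | hx | hx
            · exact p2.1.anti p1 hx
            · rw [← hx] at p1
              exact (p2.2 _ p1).le
            · have := g1.1.anti g2.2.1 hx
              omega
      split_sum := by
        rintro i h0 h1 (hs | hs | hs)
        · rw [pos_lo 0 i hs, pos_lo 2 i hs]
          rcases R.left with h | h <;> omega
        · by_cases hlo : R.lo 1 ≤ i
          · rw [pos_hi 0 i hlo hs, pos_hi 2 i hlo hs]
            rcases R.right with h | h <;> omega
          · omega
        · by_cases hlo : i < R.lo 1
          · rw [pos_lo 0 i hlo, pos_lo 2 i hlo]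
            rcases R.left with h | h <;> omega
          by_cases hhi : R.hi 1 ≤ i
          · rw [pos_hi 0 i (by omega) hhi, pos_hi 2 i (by omega) hhi]
            rcases R.right with h | h <;> omega
          rw [pos_zero i (by omega) (by omega), pos_two i (by omega) (by omega)]
          rcases (hgap' i (by omega) (by omega)).2.2.2.2.2.2 with g | g
          · exact absurd hs (not_lt.2 g.1.le)
          · exact g.2.1
      left_absent := fun hl => ⟨Or.inl (by omega), fun r _ => pos_lo r _ (by omega)⟩
      right_absent := fun hl => ⟨Or.inr (Or.inl (by omega)),
        fun r _ => pos_hi r _ (by omega) (by omega)⟩ }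
  have Spos : ∀ r i, S.pos r i = pos r i := fun _ _ => rfl
  have Ssplit : ∀ i, i ∈ S.split ↔ i < R.lo 1 ∨ R.hi 1 ≤ i ∨ R.gapHeight ω (X i) < 0 :=
    fun _ => Iff.rfl
  refine ⟨S, ?_, ?_⟩
  swap
  · intro i h1 h2
    refine ⟨fun r hr => (pos_arg r hr i h1 h2).1, fun hs => ?_⟩
    rcases (Ssplit i).1 hs with hs | hs | hs
    · omega
    · omega
    · exact hs
  ext t
  constructor
  · intro ht
    obtain ⟨hnc, ⟨x, y⟩, rfl⟩ := id ht
    have hmem := fun z => mem_minimizers (R := R) (ω := ω) h.pts (X := x) (Y := y) (z := z)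
    obtain ⟨p, hp, q, hq, s, hs, hA⟩ : ∃ p ∈ minimizers P ω (x, y), ∃ q ∈ minimizers P ω (x, y),
        ∃ s ∈ minimizers P ω (x, y), area2 p q s ≠ 0 := by
      by_contra hcon
      push Not at hcon
      exact hnc (collinear_toPlane_iff.2 hcon)
    have hrow : ∀ k : ℤ, ∃ z ∈ minimizers P ω (x, y), z.2 ≠ k := by
      intro k
      by_contra hcon
      push Not at hcon
      apply hA
      simp only [area2, hcon p hp, hcon q hq, hcon s hs]
      ring
    -- two vertices in an outer row
    by_cases hA1 : ∃ r, Outer r ∧ ∃ c c', c < c' ∧ (c, r) ∈ minimizers P ω (x, y) ∧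
        (c', r) ∈ minimizers P ω (x, y)
    · obtain ⟨r, hr, c, c', hcc, hc, hc'⟩ := hA1
      have ac := ((hmem _).1 hc).2.2.1
      have ac' := ((hmem _).1 hc').2.2.1
      obtain ⟨hD, rfl, -, -⟩ := h.two_outer hr ac ac' hcc
      obtain ⟨z, hz, hzr⟩ := hrow r
      have hz' := (hmem z).1 hz
      -- The doubled area is the distance of the third vertex from the row `r`, so unimodularity
      -- puts that vertex in the middle row.
      obtain ⟨heq, habs, -⟩ := h.minimizers_eq hz hc hc' (by
        simp only [area2]
        have : z.2 - r ≠ 0 := sub_ne_zero.2 hzr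
        intro h0
        apply this
        linarith)
      have hz1 : z.2 = 1 := by
        simp only [area2] at habs
        rcases abs_eq (by norm_num : (0 : ℤ) ≤ 1) |>.1 habs with h | h <;>
          rcases hr with rfl | rfl <;> nlinarith
      obtain ⟨m, rfl⟩ : ∃ m, z = (m, 1) := ⟨z.1, by rw [← hz1]⟩
      rw [heq]
      have am := hz'.2.2.1
      have hml := am.1
      have hmu := am.2.1
      simp only at hml hmu
      obtain ⟨f1, f2⟩ := fan_pos r hr c m x ac ac' am
      exact Staircase.Cell.fan m r c hr (by omega) (by omega) f1 f2
    -- two vertices in the middle row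
    by_cases hB1 : ∃ m m', m < m' ∧ (m, 1) ∈ minimizers P ω (x, y) ∧
        (m', 1) ∈ minimizers P ω (x, y)
    · obtain ⟨m, m', hmm, hm, hm'⟩ := hB1
      have am := ((hmem _).1 hm).2.2.1
      have am' := ((hmem _).1 hm').2.2.1
      have hD := gapHeight_nonneg_of_mem h.pts hm
      obtain ⟨hD', rfl, -, -⟩ := h.two_mid am am' hmm hD
      obtain ⟨z, hz, hzr⟩ := hrow 1
      have hz' := (hmem z).1 hz
      have hr : Outer z.2 := by have := hz'.1; have := hz'.2.1; unfold Outer; omega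
      obtain ⟨heq, -, -⟩ := h.minimizers_eq hm hm' hz (by
        simp only [area2]
        intro h0
        apply hzr
        linarith)
      rw [heq]
      have hml := am.1
      have hmu := am'.2.1
      simp only at hml hmu
      have hxm : x = X m := am.eq_sub am'
      have hz1 : z.1 = pos z.2 m := by
        refine (pos_arg z.2 hr m hml (by omega)).2 z.1 ?_
        rw [← hxm]; exact hz'.2.2.1
      have hns : m ∉ S.split := by
        rw [Ssplit]
        rintro (h | h | h)
        · omega
        · omega
        · rw [← hxm] at h
          exact absurd h (not_lt.2 hD)
      have := Staircase.Cell.flat (S := S) m z.2 hr (by omega) (by omega) hns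
      rw [Staircase.flat, Spos, ← hz1] at this
      exact this
    -- one vertex in each row
    · have huniq : ∀ z ∈ minimizers P ω (x, y), ∀ z' ∈ minimizers P ω (x, y), z.2 = z'.2 →
          z = z' := by
        rintro ⟨c, k⟩ hz ⟨c', k'⟩ hz' hk
        obtain rfl : k = k' := hk
        have hk0 := ((hmem _).1 hz).1
        have hk2 := ((hmem _).1 hz).2.1
        simp only at hk0 hk2
        by_contra hne
        have hcc : c ≠ c' := fun h => hne (by rw [h])
        by_cases hk1 : k = 1
        · subst hk1
          rcases lt_or_gt_of_ne hcc with hlt | hlt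
          · exact hB1 ⟨_, _, hlt, hz, hz'⟩
          · exact hB1 ⟨_, _, hlt, hz', hz⟩
        · have hr : Outer k := by unfold Outer; omega
          rcases lt_or_gt_of_ne hcc with hlt | hlt
          · exact hA1 ⟨k, hr, _, _, hlt, hz, hz'⟩
          · exact hA1 ⟨k, hr, _, _, hlt, hz', hz⟩
      have hpq : p.2 ≠ q.2 := fun he => hA (by rw [huniq p hp q hq he]; simp only [area2]; ring)
      have hps : p.2 ≠ s.2 := fun he => hA (by rw [huniq p hp s hs he]; simp only [area2]; ring)
      have hqs : q.2 ≠ s.2 := fun he => hA (by rw [huniq q hq s hs he]; simp only [area2]; ring)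
      have hp' := (hmem p).1 hp
      have hq' := (hmem q).1 hq
      have hs' := (hmem s).1 hs
      have hex : ∀ k, 0 ≤ k → k ≤ 2 → ∃ c, (c, k) ∈ minimizers P ω (x, y) := by
        intro k h0 h2
        obtain h | h | h : p.2 = k ∨ q.2 = k ∨ s.2 = k := by omega
        · exact ⟨p.1, by rw [← h]; exact hp⟩
        · exact ⟨q.1, by rw [← h]; exact hq⟩
        · exact ⟨s.1, by rw [← h]; exact hs⟩
      obtain ⟨c₀, h0⟩ := hex 0 (by norm_num) (by norm_num)
      obtain ⟨m, h1⟩ := hex 1 (by norm_num) (by norm_num)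
      obtain ⟨c₂, h2⟩ := hex 2 (by norm_num) (by norm_num)
      have hD := gapHeight_eq_zero_of_mem h.pts h0 h1 h2
      have a0 := ((hmem _).1 h0).2.2.1
      have a1 := ((hmem _).1 h1).2.2.1
      have a2 := ((hmem _).1 h2).2.2.1
      simp only at a0 a1 a2
      have hsum := (h.three_rows hD a0 a1 a2).1
      obtain ⟨heq, -, -⟩ := h.minimizers_eq h1 h0 h2 (by simp only [area2]; norm_num; omega)
      rw [heq]
      have b0l := a0.1
      have b0u := a0.2.1
      have b1l := a1.1
      have b1u := a1.2.1
      have b2l := a2.1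
      have b2u := a2.2.1
      have goal : ∀ k, 0 ≤ k → k ≤ R.g → k ∈ S.split → (m = k ∨ m = k + 1) → pos 0 k = c₀ →
          pos 2 k = c₂ → S.Cell {(m, 1), (c₀, 0), (c₂, 2)} := by
        intro k k0 k1 ks hk p0 p2
        have := Staircase.Cell.wedge (S := S) k m k0 k1 ks hk b1l b1u
        rwa [Staircase.wedge, Spos, Spos, p0, p2] at this
      rcases hsum with hsum | hsum
      · by_cases hm : m < R.hi 1
        · obtain ⟨g1, g2, g3⟩ := hgap' m b1l hm
          obtain ⟨w1, w2, w3⟩ := h.wedge_unique (s := 1) (Or.inl rfl) hD a0 a1 a2 (by omega) g1 g2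
            rfl
          refine goal m (by omega) (by omega) ((Ssplit m).2 (Or.inr (Or.inr w1))) (Or.inl rfl) ?_ ?_
          · exact w2 _ (pos_arg 0 Staircase.outer_zero m b1l hm).1
          · exact w3 _ (pos_arg 2 Staircase.outer_two m b1l hm).1
        · have : m = R.g ∧ R.hi 1 = R.g ∧ c₀ = R.hi 0 ∧ c₂ = R.hi 2 := by
            rcases R.right with h | h <;> omega
          obtain ⟨rfl, e1, rfl, rfl⟩ := this
          exact goal R.g (by omega) le_rfl ((Ssplit _).2 (Or.inr (Or.inl e1.le))) (Or.inl rfl)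
            (pos_hi 0 _ (by omega) e1.le) (pos_hi 2 _ (by omega) e1.le)
      · by_cases hm : R.lo 1 < m
        · obtain ⟨g1, g2, g3⟩ := hgap' (m - 1) (by omega) (by omega)
          rw [sub_add_cancel] at g2
          obtain ⟨w1, w2, w3⟩ := h.wedge_unique (s := -1) (Or.inr rfl) hD a0 a1 a2 (by omega) g2 g1
            (by omega)
          refine goal (m - 1) (by omega) (by omega) ((Ssplit _).2 (Or.inr (Or.inr w1)))
            (Or.inr (by omega)) ?_ ?_
          · exact w2 _ (pos_arg 0 Staircase.outer_zero (m - 1) (by omega) (by omega)).1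
          · exact w3 _ (pos_arg 2 Staircase.outer_two (m - 1) (by omega) (by omega)).1
        · have : m = 1 ∧ R.lo 1 = 1 ∧ c₀ = R.lo 0 ∧ c₂ = R.lo 2 := by
            rcases R.left with h | h <;> omega
          obtain ⟨rfl, e1, rfl, rfl⟩ := this
          exact goal 0 le_rfl (by omega) ((Ssplit _).2 (Or.inl (by omega))) (Or.inr rfl)
            (pos_lo 0 _ (by omega)) (pos_lo 2 _ (by omega))
  · intro ht
    cases ht with
    | fan i r c hr h0 h1 hl hu =>
      obtain ⟨hr0, hr2⟩ := outer_bounds hr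
      have hlo : R.lo r ≤ c := by
        have := S.pos_mono hr (i := -1) (j := i - 1) (by omega) (by omega) (by omega)
        rw [S.pos_neg_one r hr] at this
        omega
      have hhi : c < R.hi r := by
        have := S.pos_mono hr (i := i) (j := R.g + 1) (by omega) (by omega) (by omega)
        rw [S.pos_last r hr] at this
        omega
      -- Some cell lies over this row edge, since the row minimum must cross it. Its apex is the
      -- middle minimizer `m`, and `fan_index_unique` identifies `m` with `i`.
      obtain ⟨x, c₁, c₂, hc1, hc2, ac₁, ac₂⟩ :=
        exists_crossing (R := R) (ω := ω) hr0 hr2 hlo hhi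
      obtain ⟨-, rfl, -, hcell⟩ := h.two_outer hr ac₁ ac₂ (by omega)
      obtain rfl : c₁ = c := by omega
      obtain ⟨m, am⟩ := exists_isArg (R := R) (ω := ω) (r := 1) (by norm_num) (by norm_num) x
      obtain ⟨f1, f2⟩ := fan_pos r hr c₁ m x ac₁ ac₂ am
      have hml := am.1
      have hmu := am.2.1
      obtain rfl : i = m :=
        Staircase.fan_index_unique (S := S) hr h0 h1 hl hu (by omega) (by omega) f1 f2
      exact hcell i am
    | flat i r hr h0 h1 hs =>
      rw [Ssplit] at hs
      push Not at hs
      have g := (hgap' i hs.1 hs.2.1).2.2.2.2.2.2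
      rcases g with g | g
      · rw [Staircase.flat, Spos]
        rcases hr with rfl | rfl
        · rw [pos_zero i hs.1 hs.2.1]; exact g.2.1
        · rw [pos_two i hs.1 hs.2.1]; exact g.2.2
      · exact absurd g.1 (not_lt.2 hs.2.2)
    | wedge i j h0 h1 hs hj hlo hhi =>
      rw [Staircase.wedge, Spos, Spos]
      by_cases c1 : i < R.lo 1
      · rw [pos_lo 0 i c1, pos_lo 2 i c1]
        obtain rfl : j = 1 := by omega
        exact h.left_end (by omega)
      by_cases c2 : R.hi 1 ≤ i
      · rw [pos_hi 0 i (by omega) c2, pos_hi 2 i (by omega) c2]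
        obtain rfl : j = R.g := by omega
        exact h.right_end (by omega)
      rw [pos_zero i (by omega) (by omega), pos_two i (by omega) (by omega)]
      rcases (hgap' i (by omega) (by omega)).2.2.2.2.2.2 with g | g
      · rcases (Ssplit i).1 hs with h | h | h
        · omega
        · omega
        · exact absurd h (not_lt.2 g.1.le)
      · rcases hj with rfl | rfl
        · exact g.2.2.1
        · exact g.2.2.2

end Rows

end TropicalModuli

end


noncomputable section

namespace TropicalModuli

namespace Staircase

variable {R : Rows} {S : Staircase R}

/-! ### Upper bounds for the rank of the length functionals -/

theorem lengths_eq_zero_iff {ω : ℤ × ℤ → ℝ} : S.lengths ω = 0 ↔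
    (∀ i, 1 ≤ i → i ≤ R.g - 1 → S.rungLength i ω = 0) ∧
      ∀ i, 1 ≤ i → i ≤ R.g → S.cycleLength i ω = 0 := by
  have key : ∀ i, S.linkLength i ω = 0 ↔ S.rungLength i ω = 0 := by
    intro i
    unfold linkLength
    split_ifs <;> simp
  constructor
  · intro h
    refine ⟨fun i h0 h1 => ?_, fun i h0 h1 => ?_⟩
    · exact (key i).1 (congrFun h (Sum.inl ⟨i, Finset.mem_Icc.2 ⟨h0, h1⟩⟩))
    · exact congrFun h (Sum.inr ⟨i, Finset.mem_Icc.2 ⟨h0, h1⟩⟩)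
  · rintro ⟨h, h'⟩
    funext l
    rcases l with ⟨i, hi⟩ | ⟨i, hi⟩ <;> rw [Finset.mem_Icc] at hi
    · exact (key i).2 (h i hi.1 hi.2)
    · exact h' i hi.1 hi.2

theorem rungLength_apply (i : ℤ) (ω : ℤ × ℤ → ℝ) : S.rungLength i ω =
    ω (S.pos 0 i, 0) + ω (S.pos 2 i, 2) - (2 * i + 2 - S.pos 0 i - S.pos 2 i) * ω (i, 1) -
      (S.pos 0 i + S.pos 2 i - 2 * i) * ω (i + 1, 1) := by
  simp [rungLength, outerSum]

open Classical in
theorem gapNear_apply (i : ℤ) (ω : ℤ × ℤ → ℝ) : S.gapNear i ω =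
    if i ∈ S.split then 2 * ω (i, 1) - (ω (S.pos 0 i, 0) + ω (S.pos 2 i, 2))
      else ω (i, 1) - ω (i + 1, 1) := by
  unfold gapNear
  split_ifs <;> simp [outerSum]

open Classical in
theorem gapFar_apply (i : ℤ) (ω : ℤ × ℤ → ℝ) : S.gapFar i ω =
    if i ∈ S.split then ω (S.pos 0 i, 0) + ω (S.pos 2 i, 2) - 2 * ω (i + 1, 1)
      else ω (i, 1) - ω (i + 1, 1) := by
  unfold gapFar
  split_ifs <;> simp [outerSum]

/-- Records which heights occur in the lengths: those at interior points, at outer vertices of gaps,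
and at the two ends of the middle row. -/
theorem lengths_eq_zero_of_vanish {ω : ℤ × ℤ → ℝ}
    (hmid : ∀ i, 1 ≤ i → i ≤ R.g → ω (i, 1) = 0)
    (hout : ∀ i, 0 ≤ i → i ≤ R.g → ω (S.pos 0 i, 0) = 0 ∧ ω (S.pos 2 i, 2) = 0)
    (hfirst : 0 ∉ S.split → S.pos 0 0 + S.pos 2 0 ≠ 0 → ω (0, 1) = 0)
    (hlast : R.g ∉ S.split → ω (R.g + 1, 1) = 0) : S.lengths ω = 0 := by
  have hg := R.two_le
  rw [lengths_eq_zero_iff]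
  refine ⟨fun i h0 h1 => ?_, fun i h0 h1 => ?_⟩
  · rw [rungLength_apply, (hout i (by omega) (by omega)).1, (hout i (by omega) (by omega)).2,
      hmid i h0 (by omega), hmid (i + 1) (by omega) (by omega)]
    ring
  have near : ∀ i, 1 ≤ i → i ≤ R.g → S.gapNear i ω = 0 := by
    intro i h0 h1
    rw [gapNear_apply, (hout i (by omega) (by omega)).1, (hout i (by omega) (by omega)).2,
      hmid i h0 (by omega)]
    split_ifs with hs
    · ring
    · rcases h1.eq_or_lt with rfl | h1
      · rw [hlast hs]; ring
      · rw [hmid (i + 1) (by omega) (by omega)]; ring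
  have far : ∀ i, 1 ≤ i → i ≤ R.g - 1 → S.gapFar i ω = 0 := by
    intro i h0 h1
    rw [gapFar_apply, (hout i (by omega) (by omega)).1, (hout i (by omega) (by omega)).2,
      hmid (i + 1) (by omega) (by omega), hmid i h0 (by omega)]
    simp
  unfold cycleLength
  split_ifs with h h' h' h''
  · simp [near 1 le_rfl (by omega), gapFar_apply, h', hout 0 le_rfl (by omega),
      hmid 1 le_rfl (by omega)]
  · simp only [LinearMap.add_apply, LinearMap.smul_apply, LinearMap.sub_apply,
      near 1 le_rfl (by omega), gapFar_apply, h', rungLength_apply, hout 0 le_rfl (by omega),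
      hmid 1 le_rfl (by omega), smul_eq_mul, if_false, zero_add]
    -- In the first loop `(0, 1)` has coefficient `2` from the arcs and `-(2 - pos 0 0 - pos 2 0)`
    -- from the rung, in total `pos 0 0 + pos 2 0`.
    by_cases hs : S.pos 0 0 + S.pos 2 0 = 0
    · have : (S.pos 0 0 : ℝ) + S.pos 2 0 = 0 := by exact_mod_cast hs
      push_cast
      linear_combination ω (0, 1) * this
    · rw [hfirst h' hs]; ring
  · simp [near R.g (by omega) le_rfl, far (R.g - 1) (by omega) le_rfl]
  · simp [near R.g (by omega) le_rfl, far (R.g - 1) (by omega) le_rfl, rungLength_apply,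
      hout R.g (by omega) le_rfl, hmid R.g (by omega) le_rfl, hlast h'']
  · simp [near i h0 h1, far (i - 1) (by omega) (by omega)]

/-- Affine height functions do not contribute to the lengths. -/
theorem lengths_affine (α β γ : ℝ) :
    S.lengths (fun z => α + β * z.1 + γ * (z.2 - 1)) = 0 := by
  have hg := R.two_le
  have hsum : ∀ i, 0 ≤ i → i ≤ R.g → i ∈ S.split →
      (S.pos 0 i : ℝ) + S.pos 2 i = 2 * i + 1 := fun i h0 h1 hs => by
    exact_mod_cast S.split_sum i h0 h1 hs
  have near : ∀ i, 0 ≤ i → i ≤ R.g →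
      S.gapNear i (fun z => α + β * z.1 + γ * (z.2 - 1)) = -β := by
    intro i h0 h1
    rw [gapNear_apply]
    split_ifs with hs
    · push_cast
      linear_combination -β * hsum i h0 h1 hs
    · push_cast
      ring
  have far : ∀ i, 0 ≤ i → i ≤ R.g →
      S.gapFar i (fun z => α + β * z.1 + γ * (z.2 - 1)) = -β := by
    intro i h0 h1
    rw [gapFar_apply]
    split_ifs with hs
    · push_cast
      linear_combination β * hsum i h0 h1 hs
    · push_cast
      ring
  have rung : ∀ i, S.rungLength i (fun z => α + β * z.1 + γ * (z.2 - 1)) = 0 := by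
    intro i
    rw [rungLength_apply]
    push_cast
    ring
  rw [lengths_eq_zero_iff]
  refine ⟨fun i _ _ => rung i, fun i h0 h1 => ?_⟩
  unfold cycleLength
  split_ifs with h h' h' h'' <;>
    simp only [LinearMap.add_apply, LinearMap.smul_apply, LinearMap.sub_apply, rung,
      LinearMap.zero_apply]
  · rw [near 1 (by omega) (by omega), far 0 (by omega) (by omega)]; simp
  · rw [near 1 (by omega) (by omega), far 0 (by omega) (by omega)]; simp
  · rw [near R.g (by omega) (by omega), far (R.g - 1) (by omega) (by omega)]; simp
  · rw [near R.g (by omega) (by omega), far (R.g - 1) (by omega) (by omega)]; simp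
  · rw [near i (by omega) (by omega), far (i - 1) (by omega) (by omega)]; simp

/-- Extension of functions by zero. -/
def extendZero (Z : Finset (ℤ × ℤ)) : (Z → ℝ) →ₗ[ℝ] (ℤ × ℤ → ℝ) where
  toFun f z := if h : z ∈ Z then f ⟨z, h⟩ else 0
  map_add' f g := by ext z; by_cases h : z ∈ Z <;> simp [h]
  map_smul' c f := by ext z; by_cases h : z ∈ Z <;> simp [h]

theorem extendZero_of_notMem {Z : Finset (ℤ × ℤ)} (f : Z → ℝ) {z : ℤ × ℤ} (h : z ∉ Z) :
    extendZero Z f z = 0 := dif_neg h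

theorem extendZero_of_mem {Z : Finset (ℤ × ℤ)} (f : Z → ℝ) {z : ℤ × ℤ} (h : z ∈ Z) :
    extendZero Z f z = f ⟨z, h⟩ := dif_pos h

/-- There are `g - 1` links and `g` cycles. -/
theorem finrank_lengths_le_label : Module.finrank ℝ (LinearMap.range S.lengths) ≤
    (2 * R.g - 1).toNat := by
  have hg := R.two_le
  refine (Submodule.finrank_le _).trans (le_of_eq ?_)
  rw [Module.finrank_fintype_fun_eq_card, Fintype.card_sum, Fintype.card_coe, Fintype.card_coe,
    Int.card_Icc, Int.card_Icc]
  omega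

/-- If the lengths only depend on the heights on `A`, then their rank is bounded by the number of
points of `A`, up to affine functions. -/
theorem finrank_lengths_add_three_le (A : Finset (ℤ × ℤ))
    (hA : ∀ ω : ℤ × ℤ → ℝ, (∀ z ∈ A, ω z = 0) → S.lengths ω = 0) (h1 : ((1, 1) : ℤ × ℤ) ∈ A)
    (h2 : ((2, 1) : ℤ × ℤ) ∈ A) {b : ℤ} (h3 : (b, 2) ∈ A) :
    Module.finrank ℝ (LinearMap.range S.lengths) + 3 ≤ A.card := by
  classical
  set B : Finset (ℤ × ℤ) := {(1, 1), (2, 1), (b, 2)} with hB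
  have hBA : B ⊆ A := by
    intro z hz
    simp only [hB, Finset.mem_insert, Finset.mem_singleton] at hz
    rcases hz with rfl | rfl | rfl <;> assumption
  have hBc : B.card = 3 := Finset.card_eq_three.2 ⟨_, _, _, by simp, by simp, by simp, rfl⟩
  have hle : LinearMap.range S.lengths ≤
      LinearMap.range (S.lengths ∘ₗ extendZero (A \ B)) := by
    rintro _ ⟨ω, rfl⟩
    -- The affine function `L` interpolates `ω` at the three points of `B`, so that subtracting it
    -- leaves heights supported off `B`.
    set β := ω (2, 1) - ω (1, 1)
    set α := ω (1, 1) - β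
    set γ := ω (b, 2) - α - β * b
    set L : ℤ × ℤ → ℝ := fun z => α + β * z.1 + γ * (z.2 - 1)
    refine ⟨fun z => (ω - L) z, ?_⟩
    rw [LinearMap.comp_apply, ← sub_eq_zero, ← map_sub]
    suffices h : S.lengths (extendZero (A \ B) (fun z => (ω - L) z) - ω + L) = 0 by
      rwa [map_add, S.lengths_affine α β γ, add_zero] at h
    refine hA _ fun z hz => ?_
    by_cases hzB : z ∈ B
    · rw [Pi.add_apply, Pi.sub_apply, extendZero_of_notMem _ (by simp [hzB])]
      simp only [hB, Finset.mem_insert, Finset.mem_singleton] at hzB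
      rcases hzB with rfl | rfl | rfl <;> simp [L, α, β, γ] <;> ring
    · rw [Pi.add_apply, Pi.sub_apply, extendZero_of_mem _ (Finset.mem_sdiff.2 ⟨hz, hzB⟩)]
      simp
  have := (Submodule.finrank_mono hle).trans (LinearMap.finrank_range_le _)
  rw [Module.finrank_fintype_fun_eq_card, Fintype.card_coe, Finset.card_sdiff_of_subset hBA,
    hBc] at this
  have := Finset.card_le_card hBA
  omega

end Staircase

namespace Rows

variable (R : Rows)

/-- The points of row `r`. -/
def row (r : ℤ) : Finset (ℤ × ℤ) := (Finset.Icc (R.lo r) (R.hi r)).image fun b => (b, r)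

theorem mem_row {r : ℤ} {z : ℤ × ℤ} : z ∈ R.row r ↔ z.2 = r ∧ R.lo r ≤ z.1 ∧ z.1 ≤ R.hi r := by
  simp only [row, Finset.mem_image, Finset.mem_Icc]
  constructor
  · rintro ⟨b, hb, rfl⟩; exact ⟨rfl, hb⟩
  · rintro ⟨rfl, h⟩; exact ⟨z.1, h, rfl⟩

theorem card_row (r : ℤ) : (R.row r).card = (R.hi r + 1 - R.lo r).toNat := by
  rw [row, Finset.card_image_of_injective _ (fun a b h => (Prod.ext_iff.1 h).1), Int.card_Icc]

open Classical in
/-- The points of `R`. -/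
def points : Finset (ℤ × ℤ) := R.row 0 ∪ (R.row 1 ∪ R.row 2)

theorem mem_points {z : ℤ × ℤ} : z ∈ R.points ↔ z ∈ R.pts := by
  simp only [points, Finset.mem_union, mem_row, pts, Set.mem_ofPred_eq]
  constructor
  · rintro (⟨h, h'⟩ | ⟨h, h'⟩ | ⟨h, h'⟩) <;> rw [h] <;> exact ⟨by norm_num, by norm_num, h'⟩
  · rintro ⟨h0, h2, h⟩
    obtain h' | h' | h' : z.2 = 0 ∨ z.2 = 1 ∨ z.2 = 2 := by omega
    all_goals rw [h'] at h
    · exact Or.inl ⟨h', h⟩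
    · exact Or.inr (Or.inl ⟨h', h⟩)
    · exact Or.inr (Or.inr ⟨h', h⟩)

theorem finite_pts : R.pts.Finite :=
  R.points.finite_toSet.subset fun z hz => by simpa [mem_points] using hz

theorem card_points : (R.points.card : ℤ) =
    (R.hi 0 + 1 - R.lo 0) + (R.hi 1 + 1 - R.lo 1) + (R.hi 2 + 1 - R.lo 2) := by
  classical
  have h0 := lo_le_hi' (R := R) (r := 0) (by norm_num) (by norm_num)
  have h1 := lo_le_hi' (R := R) (r := 1) (by norm_num) (by norm_num)
  have h2 := lo_le_hi' (R := R) (r := 2) (by norm_num) (by norm_num)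
  have hd : ∀ r s, r ≠ s → Disjoint (R.row r) (R.row s) := by
    intro r s hrs
    rw [Finset.disjoint_left]
    intro z hz hz'
    exact hrs (((R.mem_row).1 hz).1.symm.trans ((R.mem_row).1 hz').1)
  rw [points, Finset.card_union_of_disjoint, Finset.card_union_of_disjoint (hd 1 2 (by norm_num)),
    card_row, card_row, card_row]
  · push_cast
    omega
  · rw [Finset.disjoint_union_right]
    exact ⟨hd 0 1 (by norm_num), hd 0 2 (by norm_num)⟩

end Rows

namespace Staircase

variable {R : Rows} {S : Staircase R}

theorem pos_bounds {r i : ℤ} (hr : Outer r) (h0 : -1 ≤ i) (h1 : i ≤ R.g + 1) :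
    R.lo r ≤ S.pos r i ∧ S.pos r i ≤ R.hi r := by
  have h := S.pos_mono hr (i := -1) (j := i) le_rfl h0 h1
  have h' := S.pos_mono hr (i := i) (j := R.g + 1) h0 h1 le_rfl
  rw [S.pos_neg_one r hr] at h
  rw [S.pos_last r hr] at h'
  exact ⟨h, h'⟩

/-- The point `d` is one whose height may be ignored because it occurs in none of the length
formulas. -/
theorem lengths_eq_zero_of_points {ω : ℤ × ℤ → ℝ} {d : ℤ × ℤ}
    (hω : ∀ z ∈ R.points, z ≠ d → ω z = 0)
    (hd : ∀ i, 0 ≤ i → i ≤ R.g → (S.pos 0 i, 0) ≠ d ∧ (S.pos 2 i, 2) ≠ d)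
    (hd1 : ∀ i, 1 ≤ i → i ≤ R.g + 1 → (i, 1) ≠ d)
    (hd0 : 0 ∉ S.split → S.pos 0 0 + S.pos 2 0 ≠ 0 → (0, 1) ≠ d) : S.lengths ω = 0 := by
  have hg := R.two_le
  have hl := lo_one_eq R
  have hh := hi_one_eq R
  have mid : ∀ i, R.lo 1 ≤ i → i ≤ R.hi 1 → (i, 1) ≠ d → ω (i, 1) = 0 := fun i h0 h1 h =>
    hω _ (R.mem_points.2 ⟨by norm_num, by norm_num, h0, h1⟩) h
  refine lengths_eq_zero_of_vanish (fun i h0 h1 => ?_) (fun i h0 h1 => ⟨?_, ?_⟩) (fun hs hsum => ?_)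
    fun hs => ?_
  · exact mid i (by omega) (by omega) (hd1 i h0 (by omega))
  · exact hω _ (R.mem_points.2 ⟨by norm_num, by norm_num,
      pos_bounds outer_zero (by omega) (by omega)⟩) (hd i h0 h1).1
  · exact hω _ (R.mem_points.2 ⟨by norm_num, by norm_num,
      pos_bounds outer_two (by omega) (by omega)⟩) (hd i h0 h1).2
  · exact mid 0 (hl.resolve_right fun h => hs (S.left_absent h).1).le (by omega) (hd0 hs hsum)
  · exact mid _ (by omega) (hh.resolve_left fun h => hs (S.right_absent h).1).ge
      (hd1 _ (by omega) le_rfl)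

theorem one_one_mem : ((1, 1) : ℤ × ℤ) ∈ R.points ∧ ((2, 1) : ℤ × ℤ) ∈ R.points := by
  have hg := R.two_le
  have hl := lo_one_eq R
  have hh := hi_one_eq R
  refine ⟨R.mem_points.2 ⟨by norm_num, by norm_num, ?_⟩,
    R.mem_points.2 ⟨by norm_num, by norm_num, ?_⟩⟩ <;> dsimp <;> omega

theorem top_mem : (R.hi 2, 2) ∈ R.points :=
  R.mem_points.2 ⟨by norm_num, by norm_num, R.lo_le_hi 2 (Or.inr rfl), le_rfl⟩

theorem finrank_lengths_le_points :
    Module.finrank ℝ (LinearMap.range S.lengths) + 3 ≤ R.points.card := by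
  have hl := lo_one_eq R
  refine S.finrank_lengths_add_three_le R.points (fun ω hω => ?_) one_one_mem.1 one_one_mem.2
    top_mem
  -- Here nothing is to be ignored, so `d` is taken outside the strip.
  have hd : ∀ z : ℤ × ℤ, 0 ≤ z.2 → z ≠ (0, -1) := by rintro z hz rfl; simp at hz
  exact lengths_eq_zero_of_points (d := (0, -1)) (fun z hz _ => hω z hz)
    (fun i _ _ => ⟨hd _ le_rfl, hd _ (by norm_num)⟩) (fun i _ _ => hd _ (by norm_num))
    fun _ _ => hd _ (by norm_num)

/-- If the left end of the polygon is a vertical edge of length two, then one of its three points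
does not contribute to the lengths. -/
theorem finrank_lengths_lt_points (h1 : R.lo 1 = 0) (h0 : R.lo 0 = 0) (h2 : R.lo 2 = 0) :
    Module.finrank ℝ (LinearMap.range S.lengths) + 4 ≤ R.points.card := by
  classical
  have hg := R.two_le
  have hh := hi_one_eq R
  have hh2 := R.lo_le_hi 2 (Or.inr rfl)
  have hh0 := R.lo_le_hi 0 (Or.inl rfl)
  have drop : ∀ d ∈ R.points, d ≠ (1, 1) → d ≠ (2, 1) → d ≠ (R.hi 2, 2) →
      (∀ i, 0 ≤ i → i ≤ R.g → (S.pos 0 i, 0) ≠ d ∧ (S.pos 2 i, 2) ≠ d) →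
      (∀ i, 1 ≤ i → i ≤ R.g + 1 → (i, 1) ≠ d) →
      (0 ∉ S.split → S.pos 0 0 + S.pos 2 0 ≠ 0 → (0, 1) ≠ d) →
      Module.finrank ℝ (LinearMap.range S.lengths) + 4 ≤ R.points.card := by
    intro d hd n1 n2 n3 e1 e2 e3
    have := S.finrank_lengths_add_three_le (R.points.erase d) (fun ω hω =>
      lengths_eq_zero_of_points (d := d) (fun z hz hzd => hω z (Finset.mem_erase.2 ⟨hzd, hz⟩))
        e1 e2 e3) (Finset.mem_erase.2 ⟨n1.symm, one_one_mem.1⟩)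
        (Finset.mem_erase.2 ⟨n2.symm, one_one_mem.2⟩) (Finset.mem_erase.2 ⟨n3.symm, top_mem⟩)
    have := Finset.card_erase_add_one hd
    omega
  have p0 := (pos_bounds (S := S) outer_zero (i := 0) (by omega) (by omega))
  have p2 := (pos_bounds (S := S) outer_two (i := 0) (by omega) (by omega))
  have mono : ∀ r, Outer r → ∀ i, 0 ≤ i → i ≤ R.g → S.pos r 0 ≤ S.pos r i :=
    fun r hr i hi hi' => S.pos_mono hr (by omega) hi (by omega)
  -- If an outer row has already advanced at gap `0`, its corner is not a vertex of any gap. If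
  -- neither has, the coefficient of `(0, 1)` is zero.
  by_cases c2 : 0 < S.pos 2 0
  · refine drop (0, 2) (R.mem_points.2 ⟨by norm_num, by norm_num, ?_⟩) (by simp) (by simp) ?_
      (fun i hi hi' => ⟨by simp, ?_⟩) (fun i _ _ => by simp) (fun _ _ => by simp)
    · dsimp; omega
    · simp only [ne_eq, Prod.mk.injEq, and_true]; omega
    · have := mono 2 outer_two i hi hi'
      simp only [ne_eq, Prod.mk.injEq, and_true]; omega
  by_cases c0 : 0 < S.pos 0 0
  · refine drop (0, 0) (R.mem_points.2 ⟨by norm_num, by norm_num, ?_⟩) (by simp) (by simp)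
      (by simp) (fun i hi hi' => ⟨?_, by simp⟩) (fun i _ _ => by simp) (fun _ _ => by simp)
    · dsimp; omega
    · have := mono 0 outer_zero i hi hi'
      simp only [ne_eq, Prod.mk.injEq, and_true]; omega
  · refine drop (0, 1) (R.mem_points.2 ⟨by norm_num, by norm_num, ?_⟩) (by simp) (by simp)
      (by simp) (fun i hi hi' => by simp) (fun i _ _ => ?_) (fun _ h => absurd (by omega) h)
    · dsimp; omega
    · simp only [ne_eq, Prod.mk.injEq, and_true]; omega

end Staircase

end TropicalModuli

end


/-! ### Rowwise convex heights induce unimodular triangulations -/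

noncomputable section

namespace TropicalModuli

/-- A set of at most three points that is not contained in a line consists of three points. -/
theorem eq_triple_of_not_collinear {t : Set (ℤ × ℤ)} {p q r : ℤ × ℤ} (h : t ⊆ {p, q, r})
    (hc : ¬ Collinear ℝ (toPlane '' t)) : t = {p, q, r} := by
  have key : ∀ a b : ℤ × ℤ, ¬ t ⊆ {a, b} := by
    intro a b hab
    refine hc ((collinear_pair ℝ (toPlane a) (toPlane b)).subset ?_)
    rw [← Set.image_pair]
    exact Set.image_mono hab
  refine h.antisymm ?_
  simp only [Set.insert_subset_iff, Set.singleton_subset_iff]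
  refine ⟨?_, ?_, ?_⟩ <;> by_contra hn
  · refine key q r fun z hz => ?_
    rcases h hz with rfl | rfl | rfl
    · exact absurd hz hn
    · simp
    · simp
  · refine key p r fun z hz => ?_
    rcases h hz with rfl | rfl | rfl
    · simp
    · exact absurd hz hn
    · simp
  · refine key p q fun z hz => ?_
    rcases h hz with rfl | rfl | rfl
    · simp
    · simp
    · exact absurd hz hn

/-- The position where the terms of `(b, r)` and `(b + 1, r)` agree. -/
def slope (ω : ℤ × ℤ → ℝ) (r b : ℤ) : ℝ := ω (b, r) - ω (b + 1, r)

namespace Rows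

/-- Height functions that are strictly convex in each row, with breaks of the middle row different
from those of the outer ones and all breaks in an interval where the middle row is lowest. -/
structure Convex (R : Rows) (ω : ℤ × ℤ → ℝ) (M : ℝ) : Prop where
  anti : ∀ r, 0 ≤ r → r ≤ 2 → ∀ b, R.lo r ≤ b → b + 1 < R.hi r → slope ω r (b + 1) < slope ω r b
  bound : ∀ r, 0 ≤ r → r ≤ 2 → ∀ b, R.lo r ≤ b → b < R.hi r → |slope ω r b| < M
  ne : ∀ r, Outer r → ∀ b m, R.lo r ≤ b → b < R.hi r → R.lo 1 ≤ m → m < R.hi 1 →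
    slope ω r b ≠ slope ω 1 m
  pos : ∀ X, |X| ≤ M → 0 < R.gapHeight ω X

variable {R : Rows} {ω : ℤ × ℤ → ℝ} {M : ℝ}

theorem IsArg.slope_le {r b : ℤ} {X : ℝ} (h : R.IsArg ω r X b) (hb : b < R.hi r) :
    slope ω r b ≤ X := by
  have := h.2.2 (b + 1) (by linarith [h.1]) hb
  simp only [rowTerm] at this
  push_cast at this
  unfold slope
  linarith

theorem IsArg.le_slope {r b : ℤ} {X : ℝ} (h : R.IsArg ω r X (b + 1)) (hb : R.lo r ≤ b) :
    X ≤ slope ω r b := by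
  have := h.2.2 b hb (by linarith [h.2.1])
  simp only [rowTerm] at this
  push_cast at this
  unfold slope
  linarith

namespace Convex

theorem slope_lt (h : R.Convex ω M) {r b c : ℤ} (h0 : 0 ≤ r) (h2 : r ≤ 2) (hl : R.lo r ≤ b)
    (hbc : b < c) (hu : c < R.hi r) : slope ω r c < slope ω r b := by
  have : b + 1 ≤ c := hbc
  induction c, this using Int.leInduction with
  | base => exact h.anti r h0 h2 b hl hu
  | succ n hn ih =>
    exact (h.anti r h0 h2 n (by omega) hu).trans (ih (by omega) (by omega))

/-- If `b < c` both minimize, then `slope ω r b ≤ X ≤ slope ω r (c - 1)`, and strictly decreasing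
slopes force `c = b + 1`. -/
theorem isArg_succ (h : R.Convex ω M) {r b c : ℤ} {X : ℝ} (h0 : 0 ≤ r) (h2 : r ≤ 2)
    (hb : R.IsArg ω r X b) (hc : R.IsArg ω r X c) (hbc : b < c) :
    c = b + 1 ∧ X = slope ω r b := by
  have hl := hb.1
  have hu := hc.2.1
  have e1 := hb.slope_le (by omega)
  obtain ⟨d, rfl⟩ : ∃ d, c = d + 1 := ⟨c - 1, by ring⟩
  have e2 := hc.le_slope (by omega)
  have : d = b := by
    by_contra hne
    have := h.slope_lt h0 h2 hl (show b < d by omega) (by omega)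
    linarith
  subst this
  exact ⟨rfl, le_antisymm e2 e1⟩

/-- The minimizers in a row. -/
theorem args (h : R.Convex ω M) {r : ℤ} (h0 : 0 ≤ r) (h2 : r ≤ 2) (X : ℝ) :
    (∃ b, R.IsArg ω r X b ∧ ∀ c, R.IsArg ω r X c → c = b) ∨
      ∃ b, R.lo r ≤ b ∧ b < R.hi r ∧ X = slope ω r b ∧ R.IsArg ω r X b ∧ R.IsArg ω r X (b + 1) ∧
        ∀ c, R.IsArg ω r X c → c = b ∨ c = b + 1 := by
  obtain ⟨b, hb⟩ := exists_isArg (R := R) (ω := ω) h0 h2 X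
  by_cases huniq : ∀ c, R.IsArg ω r X c → c = b
  · exact Or.inl ⟨b, hb, huniq⟩
  have main : ∀ b c, R.IsArg ω r X b → R.IsArg ω r X c → b < c →
      ∃ b, R.lo r ≤ b ∧ b < R.hi r ∧ X = slope ω r b ∧ R.IsArg ω r X b ∧ R.IsArg ω r X (b + 1) ∧
        ∀ c, R.IsArg ω r X c → c = b ∨ c = b + 1 := by
    intro b c hb hc hbc
    obtain ⟨rfl, hX⟩ := h.isArg_succ h0 h2 hb hc hbc
    have := hc.2.1
    refine ⟨b, hb.1, by omega, hX, hb, hc, fun d hd => ?_⟩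
    rcases lt_trichotomy d b with hlt | rfl | hlt
    · have := (h.isArg_succ h0 h2 hd hc (by omega)).1
      omega
    · exact Or.inl rfl
    · exact Or.inr (h.isArg_succ h0 h2 hb hd hlt).1
  push Not at huniq
  obtain ⟨c, hc, hne⟩ := huniq
  rcases lt_or_gt_of_ne hne with hlt | hlt
  · exact Or.inr (main c b hc hb hlt)
  · exact Or.inr (main b c hb hc hlt)

theorem eq_lo (h : R.Convex ω M) {r b : ℤ} {X : ℝ} (h0 : 0 ≤ r) (h2 : r ≤ 2)
    (hb : R.IsArg ω r X b) (hX : M ≤ X) : b = R.lo r := by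
  have hl := hb.1
  have hu := hb.2.1
  by_contra hne
  obtain ⟨d, rfl⟩ : ∃ d, b = d + 1 := ⟨b - 1, by ring⟩
  have e := hb.le_slope (by omega)
  have := (abs_lt.1 (h.bound r h0 h2 d (by omega) (by omega))).2
  linarith

theorem eq_hi (h : R.Convex ω M) {r b : ℤ} {X : ℝ} (h0 : 0 ≤ r) (h2 : r ≤ 2)
    (hb : R.IsArg ω r X b) (hX : X ≤ -M) : b = R.hi r := by
  have hl := hb.1
  have hu := hb.2.1
  by_contra hne
  have e := hb.slope_le (by omega)
  have := (abs_lt.1 (h.bound r h0 h2 b (by omega) (by omega))).1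
  linarith

theorem isArg_lo (h : R.Convex ω M) {r : ℤ} {X : ℝ} (h0 : 0 ≤ r) (h2 : r ≤ 2)
    (hX : M ≤ X) : R.IsArg ω r X (R.lo r) := by
  obtain ⟨b, hb⟩ := exists_isArg (R := R) (ω := ω) h0 h2 X
  rwa [h.eq_lo h0 h2 hb hX] at hb

theorem isArg_hi (h : R.Convex ω M) {r : ℤ} {X : ℝ} (h0 : 0 ≤ r) (h2 : r ≤ 2)
    (hX : X ≤ -M) : R.IsArg ω r X (R.hi r) := by
  obtain ⟨b, hb⟩ := exists_isArg (R := R) (ω := ω) h0 h2 X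
  rwa [h.eq_hi h0 h2 hb hX] at hb

/-- If each row has a unique minimizer, then the cell at this place is a triangle with vertices in
all three rows. -/
theorem cell_of_unique {P : Set (ℝ × ℝ)} (hP : latticePoints P = R.pts)
    {X Y : ℝ} (hcol : ¬ Collinear ℝ (toPlane '' minimizers P ω (X, Y))) {c : ℤ → ℤ}
    (hc : ∀ r, 0 ≤ r → r ≤ 2 → ∀ b, R.IsArg ω r X b → b = c r) :
    minimizers P ω (X, Y) = {(c 0, 0), (c 1, 1), (c 2, 2)} ∧ R.gapHeight ω X = 0 := by
  have e : minimizers P ω (X, Y) = {(c 0, 0), (c 1, 1), (c 2, 2)} := by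
    refine eq_triple_of_not_collinear (fun z hz => ?_) hcol
    rw [mem_minimizers hP] at hz
    obtain ⟨h0, h2, ha, -⟩ := hz
    have := hc _ h0 h2 _ ha
    obtain ⟨z1, z2⟩ := z
    dsimp only at *
    obtain rfl | rfl | rfl : z2 = 0 ∨ z2 = 1 ∨ z2 = 2 := by omega
    all_goals simp [this]
  refine ⟨e, ?_⟩
  have m0 : (c 0, 0) ∈ minimizers P ω (X, Y) := by rw [e]; simp
  have m1 : (c 1, 1) ∈ minimizers P ω (X, Y) := by rw [e]; simp
  have m2 : (c 2, 2) ∈ minimizers P ω (X, Y) := by rw [e]; simp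
  rw [mem_minimizers hP] at m0 m1 m2
  have a0 := m0.2.2.2 1 (by norm_num) (by norm_num)
  have a1 := m1.2.2.2 0 (by norm_num) (by norm_num)
  have a1' := m1.2.2.2 2 (by norm_num) (by norm_num)
  have a2 := m2.2.2.2 1 (by norm_num) (by norm_num)
  push_cast at a0 a1 a1' a2
  unfold gapHeight
  linarith

theorem isUnimodularTriangle_ends {a b c : ℤ} (h : a + c - 2 * b = 1 ∨ a + c - 2 * b = -1) :
    IsUnimodularTriangle {(a, 0), (b, 1), (c, 2)} := by
  refine ⟨_, _, _, rfl, ?_⟩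
  dsimp only
  rcases h with h | h
  · rw [show (b - a) * (2 - 0) - (1 - 0) * (c - a) = -1 by linarith]; norm_num
  · rw [show (b - a) * (2 - 0) - (1 - 0) * (c - a) = 1 by linarith]; norm_num

/-- In the window `|X| ≤ M` the middle row separates the outer ones, so a cell uses two adjacent
rows, with consecutive points in exactly one of them. Outside the window all rows are at their ends,
and a cell can occur only where an end point of the middle strip is missing. -/
theorem unimodularOn (h : R.Convex ω M) (hM : 0 < M) {P : Set (ℝ × ℝ)}
    (hP : latticePoints P = R.pts) : UnimodularOn R P ω := by
  refine ⟨hP, ?_⟩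
  rintro t ⟨hcol, ⟨X, Y⟩, rfl⟩
  by_cases hX : |X| ≤ M
  · have hpos := h.pos X hX
    -- Vertices in both outer rows at once would force `gapHeight ≤ 0`.
    obtain ⟨r, hr, hsub⟩ : ∃ r, Outer r ∧ ∀ z ∈ minimizers P ω (X, Y),
        (z.2 = 1 ∨ z.2 = r) ∧ R.IsArg ω z.2 X z.1 := by
      by_cases hrow : ∃ z ∈ minimizers P ω (X, Y), z.2 = 0
      · refine ⟨0, Or.inl rfl, fun y hy => ?_⟩
        obtain ⟨z, hz, hz0⟩ := hrow
        rw [mem_minimizers hP] at hz hy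
        obtain ⟨-, -, -, hz⟩ := hz
        obtain ⟨y0, y2, ya, hy⟩ := hy
        refine ⟨?_, ya⟩
        by_contra hne
        push Not at hne
        have y22 : y.2 = 2 := by omega
        have e1 := hz 1 (by norm_num) (by norm_num)
        have e2 := hy 1 (by norm_num) (by norm_num)
        rw [hz0] at e1
        rw [y22] at e2
        push_cast at e1 e2
        unfold gapHeight at hpos
        linarith
      · refine ⟨2, Or.inr rfl, fun y hy => ?_⟩
        have hy' := hy
        rw [mem_minimizers hP] at hy'
        have : y.2 ≠ 0 := fun h => hrow ⟨y, hy, h⟩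
        exact ⟨by omega, hy'.2.2.1⟩
    obtain ⟨r0, r2⟩ := outer_bounds hr
    rcases h.args (r := 1) (by norm_num) (by norm_num) X with ⟨m, -, um⟩ | ⟨m, lm, hm, eX, -, -, um⟩
    · rcases h.args r0 r2 X with ⟨b, -, ub⟩ | ⟨b, -, -, -, -, -, ub⟩
      · refine absurd ?_ hcol
        refine (collinear_pair ℝ (toPlane (m, 1)) (toPlane (b, r))).subset ?_
        rintro _ ⟨⟨z1, z2⟩, hz, rfl⟩
        obtain ⟨rfl | rfl, hza⟩ := hsub _ hz
        · rw [um z1 hza]; simp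
        · rw [ub z1 hza]; simp
      · rw [eq_triple_of_not_collinear (p := (m, 1)) (q := (b, r)) (r := (b + 1, r)) ?_ hcol]
        · refine ⟨_, _, _, rfl, ?_⟩
          rcases hr with rfl | rfl
          · dsimp only
            rw [show (b - m) * (0 - 1) - (0 - 1) * (b + 1 - m) = 1 by ring]; norm_num
          · dsimp only
            rw [show (b - m) * (2 - 1) - (2 - 1) * (b + 1 - m) = -1 by ring]; norm_num
        · rintro ⟨z1, z2⟩ hz
          obtain ⟨rfl | rfl, hza⟩ := hsub _ hz
          · rw [um z1 hza]; simp
          · rcases ub _ hza with hb | hb <;> dsimp only at hb <;> rw [hb] <;> simp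
    · rcases h.args r0 r2 X with ⟨b, -, ub⟩ | ⟨b, lb, hb, eX', -, -, ub⟩
      · rw [eq_triple_of_not_collinear (p := (m, 1)) (q := (m + 1, 1)) (r := (b, r)) ?_ hcol]
        · refine ⟨_, _, _, rfl, ?_⟩
          rcases hr with rfl | rfl
          · dsimp only
            rw [show (m + 1 - m) * (0 - 1) - (1 - 1) * (b - m) = -1 by ring]; norm_num
          · dsimp only
            rw [show (m + 1 - m) * (2 - 1) - (1 - 1) * (b - m) = 1 by ring]; norm_num
        · rintro ⟨z1, z2⟩ hz
          obtain ⟨rfl | rfl, hza⟩ := hsub _ hz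
          · rcases um _ hza with hb | hb <;> dsimp only at hb <;> rw [hb] <;> simp
          · rw [ub z1 hza]; simp
      · exact absurd (eX'.symm.trans eX) (h.ne r hr b m lb hb lm hm)
  rw [not_le, lt_abs] at hX
  rcases hX with hX | hX
  · obtain ⟨e, hD⟩ := cell_of_unique hP hcol (c := R.lo) fun r h0 h2 b hb => h.eq_lo h0 h2 hb hX.le
    rw [e]
    refine isUnimodularTriangle_ends ?_
    rcases R.left with hl | hl
    · exfalso
      have hpos := h.pos M (abs_of_pos hM).le
      -- Beyond the window `gapHeight` is affine with nonnegative slope and positive at `M`, so it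
      -- cannot vanish when `(0, 1)` is present.
      have ev : ∀ x, M ≤ x → R.gapHeight ω x = ω (R.lo 0, 0) + ω (R.lo 2, 2) - 2 * ω (R.lo 1, 1)
          + (R.lo 0 + R.lo 2 - 2 * R.lo 1) * x := by
        intro x hx
        rw [gapHeight, (h.isArg_lo (by norm_num) (by norm_num) hx).rowMin_eq,
          (h.isArg_lo (by norm_num) (by norm_num) hx).rowMin_eq,
          (h.isArg_lo (by norm_num) (by norm_num) hx).rowMin_eq]
        simp only [rowTerm]
        ring
      rw [ev M le_rfl] at hpos
      rw [ev X hX.le] at hD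
      have : (0 : ℝ) ≤ R.lo 0 + R.lo 2 - 2 * R.lo 1 := by
        rw [hl.1]; push_cast; rw [mul_zero, sub_zero]; exact_mod_cast hl.2
      nlinarith
    · right; rw [hl.1]; omega
  · have hX' : X ≤ -M := by linarith
    obtain ⟨e, hD⟩ := cell_of_unique hP hcol (c := R.hi) fun r h0 h2 b hb => h.eq_hi h0 h2 hb hX'
    rw [e]
    refine isUnimodularTriangle_ends ?_
    rcases R.right with hl | hl
    · exfalso
      have hpos := h.pos (-M) (by rw [abs_neg, abs_of_pos hM])
      have ev : ∀ x, x ≤ -M → R.gapHeight ω x = ω (R.hi 0, 0) + ω (R.hi 2, 2) - 2 * ω (R.hi 1, 1)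
          + (R.hi 0 + R.hi 2 - 2 * R.hi 1) * x := by
        intro x hx
        rw [gapHeight, (h.isArg_hi (by norm_num) (by norm_num) hx).rowMin_eq,
          (h.isArg_hi (by norm_num) (by norm_num) hx).rowMin_eq,
          (h.isArg_hi (by norm_num) (by norm_num) hx).rowMin_eq]
        simp only [rowTerm]
        ring
      rw [ev (-M) le_rfl] at hpos
      rw [ev X hX'] at hD
      have : (R.hi 0 : ℝ) + R.hi 2 - 2 * R.hi 1 ≤ 0 := by
        have : R.hi 0 + R.hi 2 - 2 * R.hi 1 ≤ 0 := by rw [hl.1]; linarith [hl.2]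
        exact_mod_cast this
      nlinarith
    · left; rw [hl.1]; omega

end Convex

end Rows

end TropicalModuli

end


/-! ### Realizing prescribed outer vertices -/

noncomputable section

namespace TropicalModuli

namespace Rows

/-- A choice of outer vertices between consecutive points of the middle row. -/
structure Profile (R : Rows) where
  pos : ℤ → ℤ → ℤ
  le_succ : ∀ r, Outer r → ∀ i, 0 ≤ i → i < R.g → pos r i ≤ pos r (i + 1)
  bounds : ∀ r, Outer r → ∀ i, 0 ≤ i → i ≤ R.g → R.lo r ≤ pos r i ∧ pos r i ≤ R.hi r
  left : R.lo 1 = 1 → ∀ r, Outer r → pos r 0 = R.lo r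
  right : R.hi 1 = R.g → ∀ r, Outer r → pos r R.g = R.hi r

namespace Profile

variable {R : Rows} (p : R.Profile)

theorem mono {r : ℤ} (hr : Outer r) {i j : ℤ} (h0 : 0 ≤ i) (hij : i ≤ j) (hj : j ≤ R.g) :
    p.pos r i ≤ p.pos r j := by
  induction j, hij using Int.leInduction with
  | base => exact le_rfl
  | succ n hn ih => exact (ih (by omega)).trans (p.le_succ r hr n (by omega) (by omega))

/-- The number of gaps whose vertex in row `r` is at most `b`. -/
def slot (r b : ℤ) : ℕ := ((Finset.Icc 0 R.g).filter fun m => p.pos r m ≤ b).card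

theorem slot_le (r b : ℤ) : (p.slot r b : ℤ) ≤ R.g + 1 := by
  have hg := R.two_le
  have : p.slot r b ≤ (Finset.Icc 0 R.g).card := Finset.card_filter_le _ _
  rw [Int.card_Icc] at this
  omega

theorem slot_mono (r : ℤ) {b c : ℤ} (h : b ≤ c) : p.slot r b ≤ p.slot r c := by
  refine Finset.card_le_card fun m hm => ?_
  rw [Finset.mem_filter] at hm ⊢
  exact ⟨hm.1, hm.2.trans h⟩

theorem lt_slot {r b m : ℤ} (hr : Outer r) (h0 : 0 ≤ m) (h1 : m ≤ R.g) (h : p.pos r m ≤ b) :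
    m + 1 ≤ p.slot r b := by
  have : (Finset.Icc 0 m).card ≤ p.slot r b := by
    refine Finset.card_le_card fun n hn => ?_
    rw [Finset.mem_Icc] at hn
    rw [Finset.mem_filter, Finset.mem_Icc]
    exact ⟨by omega, (p.mono hr hn.1 hn.2 h1).trans h⟩
  rw [Int.card_Icc] at this
  omega

theorem slot_le_of_lt {r b m : ℤ} (hr : Outer r) (h0 : 0 ≤ m) (h : b < p.pos r m) :
    p.slot r b ≤ m := by
  have : p.slot r b ≤ (Finset.Ico 0 m).card := by
    refine Finset.card_le_card fun n hn => ?_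
    rw [Finset.mem_filter, Finset.mem_Icc] at hn
    rw [Finset.mem_Ico]
    refine ⟨hn.1.1, ?_⟩
    by_contra hmn
    have := p.mono hr h0 (not_lt.1 hmn) hn.1.2
    omega
  rw [Int.card_Ico] at this
  omega

/-- The negative of the slope of the height function at `(b, r)`. -/
def rise (r b : ℤ) : ℝ := 2 * p.slot r b + (b - R.lo r + 1) / (R.hi r - R.lo r + 2)

theorem rise_frac {r b : ℤ} (hl : R.lo r ≤ b) (hu : b < R.hi r) :
    (0 : ℝ) < (b - R.lo r + 1) / (R.hi r - R.lo r + 2) ∧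
      ((b - R.lo r + 1) / (R.hi r - R.lo r + 2) : ℝ) < 1 := by
  have h1 : (R.lo r : ℝ) ≤ b := by exact_mod_cast hl
  have h2 : (b : ℝ) < R.hi r := by exact_mod_cast hu
  exact ⟨by apply div_pos <;> linarith, by rw [div_lt_one (by linarith)]; linarith⟩

/-- A height function inducing the profile, with the outer rows lifted by `K`. -/
def height (K : ℝ) (z : ℤ × ℤ) : ℝ :=
  if z.2 = 1 then (z.1 : ℝ) ^ 2 else K + ∑ c ∈ Finset.Ico (R.lo z.2) z.1, p.rise z.2 c

theorem slope_height_one (K : ℝ) (m : ℤ) : slope (p.height K) 1 m = -(2 * m + 1) := by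
  simp only [slope, height, if_true]
  push_cast
  ring

theorem slope_height (K : ℝ) {r b : ℤ} (hr : Outer r) (hb : R.lo r ≤ b) :
    slope (p.height K) r b = -p.rise r b := by
  have hr1 : r ≠ 1 := by rcases hr with rfl | rfl <;> norm_num
  have : Finset.Ico (R.lo r) (b + 1) = insert b (Finset.Ico (R.lo r) b) := by
    ext c
    simp only [Finset.mem_Ico, Finset.mem_insert]
    omega
  simp only [slope, height, if_neg hr1, this]
  rw [Finset.sum_insert (by simp)]
  ring

/-- The middle breaks are the negatives of the odd numbers `2 * m + 1`, whereas `rise` lies strictly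
between `2 * slot` and `2 * slot + 1`. The fractional part makes it strictly increasing along a row,
and `slot ≤ g + 1` gives the bound `2 * g + 3`. -/
theorem convex_height_of_pos {K : ℝ}
    (hpos : ∀ X : ℝ, |X| ≤ 2 * R.g + 3 → 0 < R.gapHeight (p.height K) X) :
    R.Convex (p.height K) (2 * R.g + 3) := by
  have hg := R.two_le
  have hl := Staircase.lo_one_eq R
  have hh := Staircase.hi_one_eq R
  refine ⟨?_, ?_, ?_, hpos⟩
  · intro r h0 h2 b hb hu
    by_cases hr : Outer r
    · rw [p.slope_height K hr hb, p.slope_height K hr (by omega)]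
      have h1 : (R.lo r : ℝ) ≤ b := by exact_mod_cast hb
      have h2 : (b : ℝ) + 1 < R.hi r := by exact_mod_cast hu
      have h3 : (p.slot r b : ℝ) ≤ p.slot r (b + 1) := by
        exact_mod_cast p.slot_mono r (by omega)
      have h4 : ((b - R.lo r + 1) / (R.hi r - R.lo r + 2) : ℝ) <
          ((b + 1) - R.lo r + 1) / (R.hi r - R.lo r + 2) := by
        apply div_lt_div_of_pos_right <;> linarith
      simp only [rise]
      push_cast
      linarith
    · obtain rfl : r = 1 := by unfold Outer at hr; omega
      rw [slope_height_one, slope_height_one]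
      push_cast
      linarith
  · intro r h0 h2 b hb hu
    by_cases hr : Outer r
    · rw [p.slope_height K hr hb, abs_neg]
      obtain ⟨f0, f1⟩ := rise_frac hb hu
      have h3 : (p.slot r b : ℝ) ≤ R.g + 1 := by exact_mod_cast p.slot_le r b
      have h4 : (0 : ℝ) ≤ p.slot r b := Nat.cast_nonneg _
      rw [abs_lt]
      unfold rise
      constructor <;> linarith
    · obtain rfl : r = 1 := by unfold Outer at hr; omega
      rw [slope_height_one, abs_neg]
      have h1 : (0 : ℝ) ≤ b := by exact_mod_cast (show (0 : ℤ) ≤ b by omega)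
      have h3 : (b : ℝ) ≤ R.g := by exact_mod_cast (show b ≤ R.g by omega)
      rw [abs_lt]
      constructor <;> linarith
  · intro r hr b m hb hu hm hm'
    rw [p.slope_height K hr hb, slope_height_one, Ne, neg_inj, rise]
    obtain ⟨f0, f1⟩ := rise_frac hb hu
    intro h
    -- An odd integer cannot lie strictly between `2 * slot` and `2 * slot + 1`.
    have a1 : (2 * (p.slot r b : ℤ) : ℝ) < 2 * m + 1 := by push_cast; linarith
    have a2 : (2 * m : ℝ) < 2 * (p.slot r b : ℤ) := by push_cast; linarith
    have b1 : 2 * (p.slot r b : ℤ) < 2 * m + 1 := by exact_mod_cast a1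
    have b2 : 2 * m < 2 * (p.slot r b : ℤ) := by exact_mod_cast a2
    omega

/-- On a bounded window, raising both outer rows by a large constant leaves the middle row lowest;
slopes are unaffected. -/
theorem exists_lift : ∃ K, ∀ X : ℝ, |X| ≤ 2 * R.g + 3 → 0 < R.gapHeight (p.height K) X := by
  have hg := R.two_le
  have hl := Staircase.lo_one_eq R
  have hh := Staircase.hi_one_eq R
  have hM : (0 : ℝ) < 2 * R.g + 3 := by
    have : (2 : ℝ) ≤ R.g := by exact_mod_cast hg
    linarith
  have bd : ∀ r, ∃ B : ℝ, ∀ b ∈ Finset.Icc (R.lo r) (R.hi r),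
      |∑ c ∈ Finset.Ico (R.lo r) b, p.rise r c| + |(b : ℝ)| * (2 * R.g + 3) ≤ B := by
    intro r
    obtain ⟨B, hB⟩ := ((Finset.Icc (R.lo r) (R.hi r)).image fun b : ℤ =>
      |∑ c ∈ Finset.Ico (R.lo r) b, p.rise r c| + |(b : ℝ)| * (2 * R.g + 3)).exists_le
    exact ⟨B, fun b hb => hB _ (Finset.mem_image_of_mem _ hb)⟩
  obtain ⟨B0, hB0⟩ := bd 0
  obtain ⟨B2, hB2⟩ := bd 2
  -- Each outer minimum is at least `K - B`, and the middle one is at most the term `1 + X` of `(1,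
  -- 1)`; this `K` leaves a margin of at least `2`.
  refine ⟨|B0| + |B2| + (2 * R.g + 3) + 2, fun X hX => ?_⟩
  set K := |B0| + |B2| + (2 * R.g + 3) + 2 with hK
  have low : ∀ r, Outer r → ∀ B : ℝ, (∀ b ∈ Finset.Icc (R.lo r) (R.hi r),
      |∑ c ∈ Finset.Ico (R.lo r) b, p.rise r c| + |(b : ℝ)| * (2 * R.g + 3) ≤ B) →
      K - B ≤ R.rowMin (p.height K) r X := by
    intro r hr B hB
    obtain ⟨r0, r2⟩ := outer_bounds hr
    obtain ⟨b, hb⟩ := exists_isArg (R := R) (ω := p.height K) r0 r2 X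
    have hr1 : r ≠ 1 := by rcases hr with rfl | rfl <;> norm_num
    rw [hb.rowMin_eq, rowTerm, height]
    dsimp only
    rw [if_neg hr1]
    have e1 := hB b (Finset.mem_Icc.2 ⟨hb.1, hb.2.1⟩)
    have e2 := neg_abs_le (∑ c ∈ Finset.Ico (R.lo r) b, p.rise r c)
    have e3 := neg_abs_le ((b : ℝ) * X)
    rw [abs_mul] at e3
    have e4 : |(b : ℝ)| * |X| ≤ |(b : ℝ)| * (2 * R.g + 3) :=
      mul_le_mul_of_nonneg_left hX (abs_nonneg _)
    linarith
  have l0 := low 0 (Or.inl rfl) B0 hB0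
  have l2 := low 2 (Or.inr rfl) B2 hB2
  have l1 : R.rowMin (p.height K) 1 X ≤ _ :=
    rowMin_le (R := R) (r := 1) (b := 1) (by norm_num) (by norm_num) (by omega) (by omega)
  simp only [rowTerm, height, if_true] at l1
  push_cast at l1
  have := le_abs_self X
  have := le_abs_self B0
  have := le_abs_self B2
  have := abs_nonneg B0
  have := abs_nonneg B2
  unfold gapHeight
  linarith

/-- Every profile comes from a regular unimodular triangulation. -/
theorem exists_staircase {P : Set (ℝ × ℝ)} (hP : latticePoints P = R.pts) :
    ∃ S : Staircase R, IsRegularUnimodularTriangulation P S.triangulation ∧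
      (∀ r, Outer r → ∀ i, 0 ≤ i → i ≤ R.g → S.pos r i = p.pos r i) ∧
      ∀ i, R.lo 1 ≤ i → i < R.hi 1 → i ∉ S.split := by
  have hg := R.two_le
  have hl := Staircase.lo_one_eq R
  have hh := Staircase.hi_one_eq R
  obtain ⟨K, hK⟩ := p.exists_lift
  have hconv := p.convex_height_of_pos hK
  have hM : (0 : ℝ) < 2 * R.g + 3 := by
    have : (2 : ℝ) ≤ R.g := by exact_mod_cast hg
    linarith
  have hU := hconv.unimodularOn hM hP
  obtain ⟨S, hS, harg⟩ := hU.exists_staircase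
  refine ⟨S, ⟨⟨p.height K, hS⟩, hS ▸ hU.cells⟩, ?_, ?_⟩
  · intro r hr i h0 h1
    by_cases hi : i < R.lo 1
    · obtain rfl : i = 0 := by omega
      rw [(S.left_absent (by omega)).2 r hr, p.left (by omega) r hr]
    by_cases hi' : R.hi 1 ≤ i
    · obtain rfl : i = R.g := by omega
      rw [(S.right_absent (by omega)).2 r hr, p.right (by omega) r hr]
    have ha := (harg i (by omega) (by omega)).1 r hr
    have hX : p.height K (i, 1) - p.height K (i + 1, 1) = -(2 * i + 1) := p.slope_height_one K i
    rw [hX] at ha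
    have hal := ha.1
    have hau := ha.2.1
    obtain ⟨pl, pu⟩ := p.bounds r hr i h0 h1
    -- At the break `-(2 * i + 1)`, row steps before `p.pos r i` have `slot ≤ i`, so `rise` is too
    -- small, and later ones have `slot ≥ i + 1`, so it is too large. Hence the minimizer is exactly
    -- `p.pos r i`.
    rcases lt_trichotomy (S.pos r i) (p.pos r i) with hlt | heq | hlt
    · have e := ha.slope_le (by omega)
      rw [p.slope_height K hr hal, rise] at e
      have f := rise_frac hal (show S.pos r i < R.hi r by omega)
      have g' : (p.slot r (S.pos r i) : ℝ) ≤ i := by exact_mod_cast p.slot_le_of_lt hr h0 hlt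
      linarith
    · exact heq
    · obtain ⟨d, hd⟩ : ∃ d, S.pos r i = d + 1 := ⟨S.pos r i - 1, by ring⟩
      rw [hd] at ha hlt hau
      have e := ha.le_slope (by omega)
      rw [p.slope_height K hr (by omega), rise] at e
      have f := rise_frac (show R.lo r ≤ d by omega) (show d < R.hi r by omega)
      have g' : (i : ℝ) + 1 ≤ p.slot r d := by
        exact_mod_cast p.lt_slot hr h0 h1 (show p.pos r i ≤ d by omega)
      linarith
  · intro i h0 h1 hs
    have hneg := (harg i h0 h1).2 hs
    have hb := hconv.bound 1 (by norm_num) (by norm_num) i h0 h1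
    exact absurd hneg (not_lt.2 (hK _ hb.le).le)

end Profile

end Rows

end TropicalModuli

end


noncomputable section

namespace TropicalModuli

namespace Staircase

variable {R : Rows} {S : Staircase R}

/-! ### Lower bounds for the rank of the length functionals -/

/-- The gaps whose outer vertices have heights of sum zero whenever the lengths vanish and the
heights of the interior points are zero. -/
def Tight (R : Rows) (m : ℤ) : Prop :=
  (1 ≤ m ∧ m ≤ R.g - 1) ∨ (m = 0 ∧ R.lo 1 = 1) ∨ (m = R.g ∧ R.hi 1 = R.g)

/-- Without split gaps an inner cycle length is a second difference of the middle heights, so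
vanishing lengths make these an arithmetic progression, determined by its first two terms. -/
theorem middle_eq_zero (hsplit : ∀ i, R.lo 1 ≤ i → i < R.hi 1 → i ∉ S.split)
    {ω : ℤ × ℤ → ℝ} (hω : S.lengths ω = 0) (h1 : ω (1, 1) = 0) (h2 : ω (2, 1) = 0) :
    ∀ m, 1 ≤ m → m ≤ R.g → ω (m, 1) = 0 := by
  have hg := R.two_le
  have hl := lo_one_eq R
  have hh := hi_one_eq R
  obtain ⟨-, hcyc⟩ := lengths_eq_zero_iff.1 hω
  have key : ∀ m, 1 ≤ m → m ≤ R.g - 1 → ω (m, 1) = 0 ∧ ω (m + 1, 1) = 0 := by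
    intro m hm
    induction m, hm using Int.leInduction with
    | base => exact fun _ => ⟨h1, h2⟩
    | succ n hn ih =>
      intro hn'
      obtain ⟨e1, e2⟩ := ih (by omega)
      refine ⟨e2, ?_⟩
      have := hcyc (n + 1) (by omega) (by omega)
      rw [cycleLength, if_neg (by omega), if_neg (by omega), LinearMap.sub_apply, gapFar_apply,
        gapNear_apply, add_sub_cancel_right, if_neg (hsplit n (by omega) (by omega)),
        if_neg (hsplit (n + 1) (by omega) (by omega)), e1, e2] at this
      linarith
  intro m hm hm'
  rcases hm'.eq_or_lt with rfl | hlt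
  · simpa using (key (R.g - 1) (by omega) le_rfl).2
  · exact (key m hm (by omega)).1

/-- An interior rung gives the relation directly. At an end with a missing middle point the loop
replaces it, since there the loop is twice the outer sum up to sign and interior heights. -/
theorem outer_eq_zero (hsplit : ∀ i, R.lo 1 ≤ i → i < R.hi 1 → i ∉ S.split)
    {ω : ℤ × ℤ → ℝ} (hω : S.lengths ω = 0) (hmid : ∀ m, 1 ≤ m → m ≤ R.g → ω (m, 1) = 0) {m : ℤ}
    (hm : Tight R m) : ω (S.pos 0 m, 0) + ω (S.pos 2 m, 2) = 0 := by
  have hg := R.two_le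
  have hl := lo_one_eq R
  have hh := hi_one_eq R
  obtain ⟨hrung, hcyc⟩ := lengths_eq_zero_iff.1 hω
  rcases hm with ⟨h0, h1⟩ | ⟨rfl, h⟩ | ⟨rfl, h⟩
  · have := hrung m h0 h1
    rw [rungLength_apply, hmid m h0 (by omega), hmid (m + 1) (by omega) (by omega)] at this
    linarith
  · have := hcyc 1 le_rfl (by omega)
    rw [cycleLength, if_pos rfl, if_pos (S.left_absent h).1, add_zero, LinearMap.smul_apply,
      LinearMap.sub_apply, gapFar_apply, if_pos (S.left_absent h).1, gapNear_apply,
      if_neg (hsplit 1 (by omega) (by omega)), zero_add, hmid 1 le_rfl (by omega),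
      hmid (1 + 1) (by omega) (by omega)] at this
    simpa using this
  · have := hcyc R.g (by omega) le_rfl
    rw [cycleLength, if_neg (by omega), if_pos rfl, if_pos (S.right_absent h).1, add_zero,
      LinearMap.smul_apply, LinearMap.sub_apply, gapFar_apply,
      if_neg (hsplit (R.g - 1) (by omega) (by omega)), gapNear_apply, if_pos (S.right_absent h).1,
      sub_add_cancel, hmid (R.g - 1) (by omega) (by omega), hmid R.g (by omega) le_rfl] at this
    simpa using this

/-- All other heights in the first loop vanish, leaving `(0, 1)` with coefficient `pos 0 0 + pos 2
0`. -/
theorem first_eq_zero (hsplit : ∀ i, R.lo 1 ≤ i → i < R.hi 1 → i ∉ S.split)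
    {ω : ℤ × ℤ → ℝ} (hω : S.lengths ω = 0) (hmid : ∀ m, 1 ≤ m → m ≤ R.g → ω (m, 1) = 0)
    (hout : ω (S.pos 0 0, 0) = 0 ∧ ω (S.pos 2 0, 2) = 0) (h : R.lo 1 = 0)
    (hs : S.pos 0 0 + S.pos 2 0 ≠ 0) : ω (0, 1) = 0 := by
  have hg := R.two_le
  have hh := hi_one_eq R
  have hs' : (S.pos 0 0 : ℝ) + S.pos 2 0 ≠ 0 := by exact_mod_cast hs
  obtain ⟨-, hcyc⟩ := lengths_eq_zero_iff.1 hω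
  have h0 := hsplit 0 (by omega) (by omega)
  have := hcyc 1 le_rfl (by omega)
  rw [cycleLength, if_pos rfl, if_neg h0, LinearMap.add_apply, LinearMap.smul_apply,
    LinearMap.sub_apply, gapFar_apply, if_neg h0, gapNear_apply,
    if_neg (hsplit 1 (by omega) (by omega)), rungLength_apply, hout.1, hout.2, zero_add,
    hmid 1 le_rfl (by omega), hmid (1 + 1) (by omega) (by omega)] at this
  push_cast at this
  rw [smul_eq_mul] at this
  have e : ((S.pos 0 0 : ℝ) + S.pos 2 0) * ω (0, 1) = 0 := by linear_combination this
  exact (mul_eq_zero.1 e).resolve_left hs'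

/-- Mirror image of the first loop: the coefficient is, up to sign, `pos 0 g + pos 2 g - (2 * g +
2)`. -/
theorem last_eq_zero (hsplit : ∀ i, R.lo 1 ≤ i → i < R.hi 1 → i ∉ S.split)
    {ω : ℤ × ℤ → ℝ} (hω : S.lengths ω = 0) (hmid : ∀ m, 1 ≤ m → m ≤ R.g → ω (m, 1) = 0)
    (hout : ω (S.pos 0 R.g, 0) = 0 ∧ ω (S.pos 2 R.g, 2) = 0) (h : R.hi 1 = R.g + 1)
    (hs : S.pos 0 R.g + S.pos 2 R.g ≠ 2 * R.g + 2) : ω (R.g + 1, 1) = 0 := by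
  have hg := R.two_le
  have hl := lo_one_eq R
  have hs' : (S.pos 0 R.g : ℝ) + S.pos 2 R.g - (2 * R.g + 2) ≠ 0 :=
    sub_ne_zero.2 (by exact_mod_cast hs)
  obtain ⟨-, hcyc⟩ := lengths_eq_zero_iff.1 hω
  have h0 := hsplit R.g (by omega) (by omega)
  have := hcyc R.g (by omega) le_rfl
  rw [cycleLength, if_neg (by omega), if_pos rfl, if_neg h0, LinearMap.add_apply,
    LinearMap.smul_apply, LinearMap.sub_apply, gapFar_apply,
    if_neg (hsplit (R.g - 1) (by omega) (by omega)), gapNear_apply, if_neg h0, rungLength_apply,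
    hout.1, hout.2, sub_add_cancel, hmid (R.g - 1) (by omega) (by omega),
    hmid R.g (by omega) le_rfl, smul_eq_mul] at this
  have e : ((S.pos 0 R.g : ℝ) + S.pos 2 R.g - (2 * R.g + 2)) * ω (R.g + 1, 1) = 0 := by
    linear_combination -this
  exact (mul_eq_zero.1 e).resolve_left hs'

/-- The rank is bounded below by exhibiting a coordinate subspace on which the lengths are
injective. -/
theorem card_le_finrank_of_injective (Z : Finset (ℤ × ℤ))
    (hZ : ∀ ω : ℤ × ℤ → ℝ, (∀ z, z ∉ Z → ω z = 0) → S.lengths ω = 0 → ∀ z ∈ Z, ω z = 0) :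
    Z.card ≤ Module.finrank ℝ (LinearMap.range S.lengths) := by
  have hinj : Function.Injective (S.lengths ∘ₗ extendZero Z) := by
    rw [← LinearMap.ker_eq_bot, LinearMap.ker_eq_bot']
    intro f hf
    funext z
    have := hZ (extendZero Z f) (fun z hz => extendZero_of_notMem f hz) hf z z.2
    rwa [extendZero_of_mem f z.2] at this
  have e := LinearMap.finrank_range_of_inj hinj
  rw [Module.finrank_fintype_fun_eq_card, Fintype.card_coe] at e
  rw [← e]
  exact Submodule.finrank_mono (LinearMap.range_comp_le_range _ _)

/-- The rank of the length functionals is at least the number of points in a suitable set, with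
points `A` in the bottom row, `B` in the top row and `C` in the middle row. -/
theorem card_le_finrank (hsplit : ∀ i, R.lo 1 ≤ i → i < R.hi 1 → i ∉ S.split)
    {A B C : Finset ℤ} (hA : ∀ a ∈ A, ∃ m, Tight R m ∧ S.pos 0 m = a ∧ S.pos 2 m ∉ B)
    (hB : ∀ b ∈ B, ∃ m, Tight R m ∧ S.pos 2 m = b)
    (hC : ∀ m ∈ C, 0 ≤ m ∧ m ≤ R.g + 1 ∧ m ≠ 1 ∧ m ≠ 2)
    (hC0 : 0 ∈ C → R.lo 1 = 0 ∧ S.pos 0 0 + S.pos 2 0 ≠ 0)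
    (hCg : R.g + 1 ∈ C → R.hi 1 = R.g + 1 ∧ S.pos 0 R.g + S.pos 2 R.g ≠ 2 * R.g + 2) :
    A.card + B.card + C.card ≤ Module.finrank ℝ (LinearMap.range S.lengths) := by
  classical
  have hinj : ∀ r : ℤ, Function.Injective fun b : ℤ => (b, r) :=
    fun r a b h => (Prod.ext_iff.1 h).1
  set Z := (A.image fun a => (a, (0 : ℤ))) ∪ (B.image fun b => (b, (2 : ℤ))) ∪
    C.image fun m => (m, (1 : ℤ)) with hZ
  have hcard : Z.card = A.card + B.card + C.card := by
    rw [hZ, Finset.card_union_of_disjoint, Finset.card_union_of_disjoint,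
      Finset.card_image_of_injective _ (hinj 0), Finset.card_image_of_injective _ (hinj 1),
      Finset.card_image_of_injective _ (hinj 2)]
    · rw [Finset.disjoint_left]
      simp
    · rw [Finset.disjoint_left]
      rintro z hz hz'
      simp only [Finset.mem_union, Finset.mem_image] at hz hz'
      obtain ⟨m, -, rfl⟩ := hz'
      simp at hz
  rw [← hcard]
  refine card_le_finrank_of_injective Z fun ω hω hlen => ?_
  have mem0 : ∀ a, (a, (0 : ℤ)) ∈ Z ↔ a ∈ A := by intro a; simp [hZ]
  have mem2 : ∀ a, (a, (2 : ℤ)) ∈ Z ↔ a ∈ B := by intro a; simp [hZ]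
  have mem1 : ∀ a, (a, (1 : ℤ)) ∈ Z ↔ a ∈ C := by intro a; simp [hZ]
  have hmid := middle_eq_zero hsplit hlen
    (hω _ fun h => (hC 1 ((mem1 1).1 h)).2.2.1 rfl)
    (hω _ fun h => (hC 2 ((mem1 2).1 h)).2.2.2 rfl)
  -- The order matters. Bottom points are paired with top vertices outside `B`, so they vanish
  -- first; then the relations determine the points of `B`, and the loops the ends of the middle
  -- row.
  have z0 : ∀ a, ω (a, 0) = 0 := by
    intro a
    by_cases ha : a ∈ A
    · obtain ⟨m, hm, rfl, hmB⟩ := hA a ha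
      have := outer_eq_zero hsplit hlen hmid hm
      rwa [hω (S.pos 2 m, 2) (by rwa [mem2]), add_zero] at this
    · exact hω _ (by rwa [mem0])
  have z2 : ∀ a, ω (a, 2) = 0 := by
    intro a
    by_cases ha : a ∈ B
    · obtain ⟨m, hm, rfl⟩ := hB a ha
      have := outer_eq_zero hsplit hlen hmid hm
      rwa [z0, zero_add] at this
    · exact hω _ (by rwa [mem2])
  have z1 : ∀ a ∈ C, ω (a, 1) = 0 := by
    intro a ha
    obtain ⟨h0, h1, -, -⟩ := hC a ha
    by_cases c0 : a = 0
    · subst c0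
      exact first_eq_zero hsplit hlen hmid ⟨z0 _, z2 _⟩ (hC0 ha).1 (hC0 ha).2
    by_cases c1 : a = R.g + 1
    · subst c1
      exact last_eq_zero hsplit hlen hmid ⟨z0 _, z2 _⟩ (hCg ha).1 (hCg ha).2
    · exact hmid a (by omega) (by omega)
  intro z hz
  simp only [hZ, Finset.mem_union, Finset.mem_image] at hz
  rcases hz with (⟨a, -, rfl⟩ | ⟨a, -, rfl⟩) | ⟨a, ha, rfl⟩
  · exact z0 a
  · exact z2 a
  · exact z1 a ha

end Staircase

/-! ### Profiles through the bottom row, then the top row -/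

namespace Rows

variable (R : Rows)

/-- The profile that first runs through the bottom row and then through the top row, having
advanced by `n m` points at gap `m`. -/
def steps (n : ℤ → ℤ) (hn : ∀ i, 0 ≤ i → i < R.g → n i ≤ n (i + 1))
    (h0 : ∀ i, 0 ≤ i → i ≤ R.g → 0 ≤ n i) (hl : R.lo 1 = 1 → n 0 = 0)
    (hr : R.hi 1 = R.g → (R.hi 0 - R.lo 0) + (R.hi 2 - R.lo 2) ≤ n R.g) : R.Profile where
  pos r m := if r = 0 then R.lo 0 + min (R.hi 0 - R.lo 0) (n m)
    else R.lo 2 + min (R.hi 2 - R.lo 2) (max 0 (n m - (R.hi 0 - R.lo 0)))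
  le_succ := by
    intro r _ i hi hi'
    have := hn i hi hi'
    split_ifs <;> omega
  bounds := by
    have := R.lo_le_hi 0 (Or.inl rfl)
    have := R.lo_le_hi 2 (Or.inr rfl)
    rintro r (rfl | rfl) i hi hi' <;> have := h0 i hi hi'
    · simp only [if_true]; omega
    · rw [if_neg (by norm_num)]; omega
  left := by
    intro h
    have := R.lo_le_hi 0 (Or.inl rfl)
    have := R.lo_le_hi 2 (Or.inr rfl)
    have := hl h
    rintro r (rfl | rfl)
    · simp only [if_true]; omega
    · rw [if_neg (by norm_num)]; omega
  right := by
    intro h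
    have := R.lo_le_hi 0 (Or.inl rfl)
    have := R.lo_le_hi 2 (Or.inr rfl)
    have := hr h
    rintro r (rfl | rfl)
    · simp only [if_true]; omega
    · rw [if_neg (by norm_num)]; omega

/-- The rank obtained from a stepwise profile that takes all values between `s` and `t`. -/
theorem exists_le_dim_of_steps {P : Set (ℝ × ℝ)} (hP : latticePoints P = R.pts) (n : ℤ → ℤ)
    (hn : ∀ i, 0 ≤ i → i < R.g → n i ≤ n (i + 1)) (h0 : ∀ i, 0 ≤ i → i ≤ R.g → 0 ≤ n i)
    (hl : R.lo 1 = 1 → n 0 = 0) (hr : R.hi 1 = R.g + 1) {s t : ℤ} (hst : s ≤ t)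
    (hs' : s ≤ R.hi 0 - R.lo 0) (hval : ∀ u, s ≤ u → u ≤ t → ∃ m, Staircase.Tight R m ∧ n m = u)
    (hlast : n R.g = t) (hlast' : R.lo 0 + R.lo 2 + t < 2 * R.g + 2) {C : Finset ℤ}
    (hC : ∀ m ∈ C, 0 ≤ m ∧ m ≤ R.g + 1 ∧ m ≠ 1 ∧ m ≠ 2)
    (hC0 : 0 ∈ C → R.lo 1 = 0 ∧
      R.lo 0 + min (R.hi 0 - R.lo 0) (n 0) +
        (R.lo 2 + min (R.hi 2 - R.lo 2) (max 0 (n 0 - (R.hi 0 - R.lo 0)))) ≠ 0) :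
    ∃ T, IsRegularUnimodularTriangulation P T ∧
      (min ((R.hi 0 - R.lo 0) + (R.hi 2 - R.lo 2)) t + 1 - s).toNat + C.card ≤
        triangulationModuliDim P T := by
  have hg := R.two_le
  have l0 := R.lo_le_hi 0 (Or.inl rfl)
  have l2 := R.lo_le_hi 2 (Or.inr rfl)
  obtain ⟨S, hT, hpos, hsplit⟩ := (R.steps n hn h0 hl (by omega)).exists_staircase hP
  refine ⟨_, hT, ?_⟩
  rw [S.triangulationModuliDim_eq (by rw [hP]; exact R.finite_pts) hT]
  have pos0 : ∀ m, 0 ≤ m → m ≤ R.g → S.pos 0 m = R.lo 0 + min (R.hi 0 - R.lo 0) (n m) :=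
    fun m hm hm' => hpos 0 (Or.inl rfl) m hm hm'
  have pos2 : ∀ m, 0 ≤ m → m ≤ R.g →
      S.pos 2 m = R.lo 2 + min (R.hi 2 - R.lo 2) (max 0 (n m - (R.hi 0 - R.lo 0))) :=
    fun m hm hm' => hpos 2 (Or.inr rfl) m hm hm'
  have tight : ∀ m, Staircase.Tight R m → 0 ≤ m ∧ m ≤ R.g := by
    rintro m (h | h | h) <;> omega
  -- While the bottom row is traversed, the top vertex stays at `lo 2`; therefore `B` starts at `lo
  -- 2 + 1`, and one new outer point is gained per step.
  refine le_trans ?_ (Staircase.card_le_finrank hsplit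
    (A := Finset.Icc (R.lo 0 + s) (R.lo 0 + min (R.hi 0 - R.lo 0) t))
    (B := Finset.Icc (R.lo 2 + 1) (R.lo 2 + min (R.hi 2 - R.lo 2) (t - (R.hi 0 - R.lo 0))))
    (C := C) ?_ ?_ hC ?_ ?_)
  · rw [Int.card_Icc, Int.card_Icc]
    omega
  · intro a ha
    rw [Finset.mem_Icc] at ha
    obtain ⟨m, hm, hnm⟩ := hval (a - R.lo 0) (by omega) (by omega)
    obtain ⟨m0, m1⟩ := tight m hm
    refine ⟨m, hm, ?_, ?_⟩
    · rw [pos0 m m0 m1, hnm]; omega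
    · rw [pos2 m m0 m1, hnm, Finset.mem_Icc]; omega
  · intro b hb
    rw [Finset.mem_Icc] at hb
    obtain ⟨m, hm, hnm⟩ := hval (b - R.lo 2 + (R.hi 0 - R.lo 0)) (by omega) (by omega)
    obtain ⟨m0, m1⟩ := tight m hm
    exact ⟨m, hm, by rw [pos2 m m0 m1, hnm]; omega⟩
  · intro h
    rw [pos0 0 le_rfl (by omega), pos2 0 le_rfl (by omega)]
    exact hC0 h
  · intro _
    refine ⟨hr, ?_⟩
    rw [pos0 R.g (by omega) le_rfl, pos2 R.g (by omega) le_rfl, hlast]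
    omega

end Rows

end TropicalModuli

end


/-! ### Dimensions for the three shapes of polygons -/

noncomputable section

namespace TropicalModuli

namespace Rows

variable {R : Rows} {P : Set (ℝ × ℝ)}

/-- Reduces the supremum over triangulations to a rank bound for all staircases and one
triangulation attaining it. -/
theorem moduliDim_eq (hP : latticePoints P = R.pts) {d : ℕ}
    (hupper : ∀ S : Staircase R, Module.finrank ℝ (LinearMap.range S.lengths) ≤ d)
    (hlower : ∃ T, IsRegularUnimodularTriangulation P T ∧ d ≤ triangulationModuliDim P T) :
    moduliDim P = d := by
  have hle : ∀ T, IsRegularUnimodularTriangulation P T → triangulationModuliDim P T ≤ d := by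
    rintro T ⟨⟨ω, rfl⟩, hT⟩
    obtain ⟨S, hS, -⟩ := (UnimodularOn.mk hP hT).exists_staircase
    rw [hS, S.triangulationModuliDim_eq (by rw [hP]; exact R.finite_pts) ⟨⟨ω, hS⟩, hS ▸ hT⟩]
    exact hupper S
  obtain ⟨T, hT, hd⟩ := hlower
  refine IsGreatest.csSup_eq ⟨⟨T, hT, le_antisymm hd (hle T hT)⟩, ?_⟩
  rintro _ ⟨U, hU, rfl⟩
  exact hle U hU

/-- The polygons without points `(0, 1)` and `(g + 1, 1)`. -/
def trapezoid (g i : ℕ) (hg : 2 ≤ g) (hi : i ≤ 2 * g) : Rows where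
  g := g
  lo r := if r = 0 then 0 else 1
  hi r := if r = 0 then i else if r = 1 then g else 2 * g + 1 - i
  two_le := by exact_mod_cast hg
  lo_le_hi := by rintro r (rfl | rfl) <;> simp; omega
  left := by simp
  right := by simp

/-- The polygons with the point `(g + 1, 1)` but without `(0, 1)`. -/
def pentagon (g i j : ℕ) (hg : 2 ≤ g) (hij : i + j ≤ 2 * g + 1) : Rows where
  g := g
  lo r := if r = 0 then 0 else 1
  hi r := if r = 0 then i else if r = 1 then g + 1 else 1 + j
  two_le := by exact_mod_cast hg
  lo_le_hi := by rintro r (rfl | rfl) <;> simp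
  left := by simp
  right := by simp; omega

/-- The polygons with the points `(0, 1)` and `(g + 1, 1)`. -/
def hexagon (g i j k : ℕ) (hg : 2 ≤ g) (hij : i + j + k ≤ 2 * g + 2) : Rows where
  g := g
  lo r := if r = 2 then k else 0
  hi r := if r = 0 then i else if r = 1 then g + 1 else k + j
  two_le := by exact_mod_cast hg
  lo_le_hi := by rintro r (rfl | rfl) <;> simp
  left := by simp
  right := by simp; omega

theorem moduliDim_trapezoid {g i : ℕ} (hg : 2 ≤ g) (hgi : g ≤ i) (hi : i ≤ 2 * g)
    (hP : latticePoints P = (trapezoid g i hg hi).pts) : moduliDim P = 2 * g - 1 := by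
  have Rg : (trapezoid g i hg hi).g = g := rfl
  have lo0 : (trapezoid g i hg hi).lo 0 = 0 := rfl
  have lo1 : (trapezoid g i hg hi).lo 1 = 1 := rfl
  have lo2 : (trapezoid g i hg hi).lo 2 = 1 := rfl
  have hi0 : (trapezoid g i hg hi).hi 0 = i := rfl
  have hi1 : (trapezoid g i hg hi).hi 1 = g := rfl
  have hi2 : (trapezoid g i hg hi).hi 2 = 2 * g + 1 - i := rfl
  refine moduliDim_eq hP (fun S => ?_) ?_
  · have := S.finrank_lengths_le_label
    omega
  -- Gaps `0, …, g - 1` visit `(0, 0), …, (g - 1, 0)`, which exist since `i ≥ g`. As `(g + 1, 1)` is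
  -- missing, gap `g` must be at the far ends, which are `i + (2 * g - i) = 2 * g` steps away. The
  -- count is `(g + 1) + (g - 2)`.
  obtain ⟨S, hT, hpos, hsplit⟩ := ((trapezoid g i hg hi).steps
    (fun m => if m < g then m else 2 * g) (by intro m _ _; split_ifs <;> omega)
    (by intro m _ _; split_ifs <;> omega) (by intro _; simp)
    (by intro _; simp only [hi0, lo0, hi2, lo2, Rg]; simp; omega)).exists_staircase hP
  refine ⟨_, hT, ?_⟩
  rw [S.triangulationModuliDim_eq (by rw [hP]; exact finite_pts _) hT]
  have pos0 : ∀ m : ℤ, 0 ≤ m → m ≤ g → S.pos 0 m = if m < g then m else i := by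
    intro m hm hm'
    refine (hpos 0 (Or.inl rfl) m hm hm').trans ?_
    simp only [steps, lo0, hi0, if_true]
    split_ifs <;> omega
  refine le_trans ?_ (Staircase.card_le_finrank hsplit (A := insert (i : ℤ) (Finset.Ico 0 (g : ℤ)))
    (B := ∅) (C := Finset.Icc 3 (g : ℤ)) ?_ (by simp) ?_ ?_ ?_)
  · rw [Finset.card_insert_of_notMem (by simp; omega), Int.card_Ico, Int.card_Icc]
    simp only [Finset.card_empty]
    omega
  · intro a ha
    rw [Finset.mem_insert, Finset.mem_Ico] at ha
    rcases ha with rfl | ha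
    · exact ⟨g, Or.inr (Or.inr ⟨rfl, rfl⟩), by rw [pos0 _ (by omega) le_rfl]; simp, by simp⟩
    · refine ⟨a, ?_, by rw [pos0 _ (by omega) (by omega), if_pos ha.2], by simp⟩
      rcases ha.1.eq_or_lt with h | h
      · exact Or.inr (Or.inl ⟨h.symm, rfl⟩)
      · exact Or.inl ⟨h, by rw [Rg]; omega⟩
  · intro m hm
    rw [Finset.mem_Icc] at hm
    rw [Rg]
    omega
  · intro h
    rw [Finset.mem_Icc] at h
    omega
  · intro h
    rw [Finset.mem_Icc, Rg] at h
    omega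

theorem moduliDim_pentagon {g i j : ℕ} (hg : 2 ≤ g) (hij : i + j ≤ 2 * g + 1)
    (hP : latticePoints P = (pentagon g i j hg hij).pts) :
    moduliDim P = min (g + i + j) (2 * g - 1) := by
  have Rg : (pentagon g i j hg hij).g = g := rfl
  have lo0 : (pentagon g i j hg hij).lo 0 = 0 := rfl
  have lo1 : (pentagon g i j hg hij).lo 1 = 1 := rfl
  have lo2 : (pentagon g i j hg hij).lo 2 = 1 := rfl
  have hi0 : (pentagon g i j hg hij).hi 0 = i := rfl
  have hi1 : (pentagon g i j hg hij).hi 1 = g + 1 := rfl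
  have hi2 : (pentagon g i j hg hij).hi 2 = 1 + j := rfl
  refine moduliDim_eq hP (fun S => ?_) ?_
  · have := S.finrank_lengths_le_label
    have := S.finrank_lengths_le_points
    have := (pentagon g i j hg hij).card_points
    omega
  -- As `(0, 1)` is missing, gap `0` is tight too, and the gaps `0, …, g - 1` supply up to `g` outer
  -- points; `C` adds `g - 1` middle points.
  obtain ⟨T, hT, h⟩ := (pentagon g i j hg hij).exists_le_dim_of_steps hP
    (fun m => min m (g - 1)) (s := 0) (t := g - 1) (C := Finset.Icc 3 (g + 1 : ℤ))
    (by intro m _ _; omega) (by intro m _ _; omega)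
    (by intro _; omega) (by omega) (by omega) (by omega)
    (by
      intro u hu hu'
      refine ⟨u, ?_, by omega⟩
      unfold Staircase.Tight
      omega)
    (by rw [Rg]; omega) (by omega)
    (by intro m hm; rw [Finset.mem_Icc] at hm; omega)
    (by intro h; rw [Finset.mem_Icc] at h; omega)
  refine ⟨T, hT, le_trans ?_ h⟩
  rw [Int.card_Icc]
  omega

theorem moduliDim_hexagon_of_pos {g i j k : ℕ} (hg : 2 ≤ g) (hij : i + j + k ≤ 2 * g + 2)
    (hk : k ≠ 0) (hkg : k ≤ g + 1) (hP : latticePoints P = (hexagon g i j k hg hij).pts) :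
    moduliDim P = min (g + i + j + 1) (2 * g - 1) := by
  have Rg : (hexagon g i j k hg hij).g = g := rfl
  have lo0 : (hexagon g i j k hg hij).lo 0 = 0 := rfl
  have lo1 : (hexagon g i j k hg hij).lo 1 = 0 := rfl
  have lo2 : (hexagon g i j k hg hij).lo 2 = k := rfl
  have hi0 : (hexagon g i j k hg hij).hi 0 = i := rfl
  have hi1 : (hexagon g i j k hg hij).hi 1 = g + 1 := rfl
  have hi2 : (hexagon g i j k hg hij).hi 2 = k + j := rfl
  refine moduliDim_eq hP (fun S => ?_) ?_
  · have := S.finrank_lengths_le_label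
    have := S.finrank_lengths_le_points
    have := (hexagon g i j k hg hij).card_points
    omega
  -- Gap `0` gives no relation between outer heights, so the walk starts at gap `1`. Since the first
  -- gap has outer sum `k ≠ 0`, the point `(0, 1)` can be added to `C`.
  obtain ⟨T, hT, h⟩ := (hexagon g i j k hg hij).exists_le_dim_of_steps hP
    (fun m => min (max 0 (m - 1)) (g - 2)) (s := 0) (t := g - 2)
    (C := insert 0 (Finset.Icc 3 (g + 1 : ℤ)))
    (by intro m _ _; omega) (by intro m _ _; omega)
    (by intro _; omega) (by omega) (by omega) (by omega)
    (by
      intro u hu hu'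
      refine ⟨u + 1, ?_, by omega⟩
      unfold Staircase.Tight
      omega)
    (by rw [Rg]; omega) (by omega)
    (by intro m hm; rw [Finset.mem_insert, Finset.mem_Icc] at hm; omega)
    (by intro h; omega)
  refine ⟨T, hT, le_trans ?_ h⟩
  rw [Finset.card_insert_of_notMem (by simp), Int.card_Icc]
  omega

theorem moduliDim_hexagon_zero {g i j : ℕ} (hg : 2 ≤ g) (hij : i + j + 0 ≤ 2 * g + 2)
    (hji : i = 0 → j = 0) (hP : latticePoints P = (hexagon g i j 0 hg hij).pts) :
    moduliDim P = min (g + i + j) (2 * g - 1) := by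
  have Rg : (hexagon g i j 0 hg hij).g = g := rfl
  have lo0 : (hexagon g i j 0 hg hij).lo 0 = 0 := rfl
  have lo1 : (hexagon g i j 0 hg hij).lo 1 = 0 := rfl
  have lo2 : (hexagon g i j 0 hg hij).lo 2 = 0 := rfl
  have hi0 : (hexagon g i j 0 hg hij).hi 0 = i := rfl
  have hi1 : (hexagon g i j 0 hg hij).hi 1 = g + 1 := rfl
  have hi2 : (hexagon g i j 0 hg hij).hi 2 = j := by simp [hexagon]
  refine moduliDim_eq hP (fun S => ?_) ?_
  · have := S.finrank_lengths_le_label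
    have := S.finrank_lengths_lt_points lo1 lo0 lo2
    have := (hexagon g i j 0 hg hij).card_points
    omega
  rcases Nat.eq_zero_or_pos i with hi | hi
  · have hj := hji hi
    -- Both outer rows are single points: one outer height and `g - 1` middle ones remain.
    obtain ⟨T, hT, h⟩ := (hexagon g i j 0 hg hij).exists_le_dim_of_steps hP
      (fun m => 0) (s := 0) (t := 0) (C := Finset.Icc 3 (g + 1 : ℤ))
      (by intro m _ _; omega) (by intro m _ _; omega)
      (by intro _; dsimp only) (by omega) (by omega) (by omega)
      (by
        intro u hu hu'
        refine ⟨1, ?_, by omega⟩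
        unfold Staircase.Tight
        omega)
      (by dsimp only) (by omega)
      (by intro m hm; rw [Finset.mem_Icc] at hm; omega)
      (by intro h; rw [Finset.mem_Icc] at h; omega)
    refine ⟨T, hT, le_trans ?_ h⟩
    rw [Int.card_Icc]
    omega
  -- Starting at `1` instead of `0` makes the coefficient of `(0, 1)` nonzero. This trades the
  -- corner `(0, 0)` for `(0, 1)` and lets the outer points reach position `g - 1`.
  · obtain ⟨T, hT, h⟩ := (hexagon g i j 0 hg hij).exists_le_dim_of_steps hP
      (fun m => min (max 1 m) (g - 1)) (s := 1) (t := g - 1)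
      (C := insert 0 (Finset.Icc 3 (g + 1 : ℤ)))
      (by intro m _ _; omega) (by intro m _ _; omega)
      (by intro _; omega) (by omega) (by omega) (by omega)
      (by
        intro u hu hu'
        refine ⟨u, ?_, by omega⟩
        unfold Staircase.Tight
        omega)
      (by rw [Rg]; omega) (by omega)
      (by intro m hm; rw [Finset.mem_insert, Finset.mem_Icc] at hm; omega)
      (by intro h; omega)
    refine ⟨T, hT, le_trans ?_ h⟩
    rw [Finset.card_insert_of_notMem (by simp), Int.card_Icc]
    omega

end Rows

end TropicalModuli

end


noncomputable section

namespace TropicalModuli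

theorem finrank_vectorSpan_image {V W : Type*} [AddCommGroup V] [Module ℝ V] [AddCommGroup W]
    [Module ℝ W] (L : V ≃ₗ[ℝ] W) (s : Set V) :
    Module.finrank ℝ (vectorSpan ℝ (L '' s)) = Module.finrank ℝ (vectorSpan ℝ s) := by
  have : vectorSpan ℝ (L '' s) = (vectorSpan ℝ s).map (L : V →ₗ[ℝ] W) :=
    (AffineMap.map_vectorSpan (L : V →ₗ[ℝ] W).toAffineMap).symm
  rw [this, LinearEquiv.finrank_map_eq L (vectorSpan ℝ s)]

/-! ### Transport along bijections of the lattice -/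

/-- The image of a family of sets of lattice points. -/
abbrev transport (e : ℤ × ℤ ≃ ℤ × ℤ) (T : Set (Set (ℤ × ℤ))) : Set (Set (ℤ × ℤ)) :=
  (fun t => e '' t) '' T

variable (e : ℤ × ℤ ≃ ℤ × ℤ) {T : Set (Set (ℤ × ℤ))}

theorem mem_transport {t : Set (ℤ × ℤ)} : e '' t ∈ transport e T ↔ t ∈ T :=
  (Set.image_injective.2 e.injective).mem_set_image

theorem mem_boundedEdges_transport {f : Set (ℤ × ℤ)} :
    e '' f ∈ boundedEdges (transport e T) ↔ f ∈ boundedEdges T := by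
  simp only [boundedEdges, transport, Set.mem_ofPred_eq, Set.exists_mem_image, ne_eq,
    Set.ncard_image_of_injective _ e.injective, Set.image_subset_image_iff e.injective,
    (Set.image_injective.2 e.injective).eq_iff]

/-- The core depends only on incidences between vertex sets, so any bijection of the lattice
respects it. -/
theorem mem_coreEdges_transport {f : Set (ℤ × ℤ)} :
    e '' f ∈ coreEdges (transport e T) ↔ f ∈ coreEdges T := by
  have hE : Function.Injective fun t : Set (ℤ × ℤ) => e '' t :=
    Set.image_injective.2 e.injective
  constructor
  · rintro ⟨F, ⟨hF, hdeg⟩, hf⟩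
    refine ⟨{f | e '' f ∈ F}, ⟨fun f hf => ?_, fun f hf t ht hft => ?_⟩, hf⟩
    · exact (mem_boundedEdges_transport e).1 (hF hf)
    · obtain ⟨f', hf', hne, hsub⟩ := hdeg (e '' f) hf (e '' t) ((mem_transport e).2 ht)
        (Set.image_mono hft)
      obtain ⟨f'', rfl⟩ : ∃ f'', f' = e '' f'' := ⟨e.symm '' f', by rw [e.image_symm_image]⟩
      exact ⟨f'', hf', fun h => hne (by rw [h]),
        (Set.image_subset_image_iff e.injective).1 hsub⟩
  · rintro ⟨F, ⟨hF, hdeg⟩, hf⟩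
    refine ⟨transport e F, ⟨?_, ?_⟩, (mem_transport e).2 hf⟩
    · rintro _ ⟨f, hf, rfl⟩
      exact (mem_boundedEdges_transport e).2 (hF hf)
    · rintro _ ⟨f, hf, rfl⟩ _ ⟨t, ht, rfl⟩ hft
      obtain ⟨f', hf', hne, hsub⟩ := hdeg f hf t ht
        ((Set.image_subset_image_iff e.injective).1 hft)
      exact ⟨e '' f', (mem_transport e).2 hf', fun h => hne (hE h), Set.image_mono hsub⟩

/-- The bijection of remaining edges. -/
def coreEquiv (T : Set (Set (ℤ × ℤ))) : coreEdges T ≃ coreEdges (transport e T) :=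
  (Equiv.Set.congr e).subtypeEquiv fun _ => (mem_coreEdges_transport e).symm

theorem coreEquiv_apply (f : coreEdges T) : (coreEquiv e T f).1 = e '' f.1 := rfl

theorem concatenated_transport (f f' : coreEdges T) :
    Concatenated T f f' ↔ Concatenated (transport e T) (coreEquiv e T f) (coreEquiv e T f') := by
  have hE : Function.Injective fun t : Set (ℤ × ℤ) => e '' t :=
    Set.image_injective.2 e.injective
  have hn : ∀ t : Set (ℤ × ℤ),
      {g | g ∈ coreEdges (transport e T) ∧ g ⊆ e '' t}.ncard =
        {g | g ∈ coreEdges T ∧ g ⊆ t}.ncard := by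
    intro t
    rw [← Set.ncard_image_of_injective {g | g ∈ coreEdges T ∧ g ⊆ t} hE]
    congr 1
    ext g
    obtain ⟨g, rfl⟩ : ∃ g', g = e '' g' := ⟨e.symm '' g, by rw [e.image_symm_image]⟩
    rw [hE.mem_set_image (a := g)]
    simp only [Set.mem_ofPred_eq, mem_coreEdges_transport, Set.image_subset_image_iff e.injective]
  simp only [Concatenated, transport, Set.exists_mem_image, coreEquiv_apply,
    Set.image_subset_image_iff e.injective]
  simp only [hn]

/-- The bijection of edges of the skeleton. -/
def skeletonEquiv (T : Set (Set (ℤ × ℤ))) : SkeletonEdge T ≃ SkeletonEdge (transport e T) :=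
  Quot.congr (coreEquiv e T) (concatenated_transport e)

theorem skeletonLength_transport {P Q : Set (ℝ × ℝ)} {ω ω' : ℤ × ℤ → ℝ}
    (h : ∀ f : Set (ℤ × ℤ), latticeLength (dualEdge Q ω' (e '' f)) = latticeLength (dualEdge P ω f))
    (c : SkeletonEdge T) :
    skeletonLength Q (transport e T) ω' (skeletonEquiv e T c) = skeletonLength P T ω c := by
  unfold skeletonLength
  symm
  refine finsum_eq_of_bijective
    (fun f : {f : coreEdges T // Quot.mk (Concatenated T) f = c} =>
      (⟨coreEquiv e T f.1, congrArg (skeletonEquiv e T) f.2⟩ :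
        {f : coreEdges (transport e T) // Quot.mk _ f = skeletonEquiv e T c})) ⟨?_, ?_⟩ ?_
  · intro f f' hff
    exact Subtype.ext ((coreEquiv e T).injective (congrArg Subtype.val hff))
  · rintro ⟨f, hf⟩
    obtain ⟨f, rfl⟩ := (coreEquiv e T).surjective f
    exact ⟨⟨f, (skeletonEquiv e T).injective hf⟩, rfl⟩
  · intro f
    exact (h _).symm

theorem triangulationModuliDim_transport {P Q : Set (ℝ × ℝ)}
    (hsub : ∀ ω, inducedSubdivision Q ω = transport e (inducedSubdivision P (ω ∘ e)))
    (hlen : ∀ (ω : ℤ × ℤ → ℝ) (f : Set (ℤ × ℤ)),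
      latticeLength (dualEdge Q ω (e '' f)) = latticeLength (dualEdge P (ω ∘ e) f))
    (T : Set (Set (ℤ × ℤ))) :
    triangulationModuliDim Q (transport e T) = triangulationModuliDim P T := by
  have hE : Function.Injective (transport e) :=
    Set.image_injective.2 (Set.image_injective.2 e.injective)
  -- Relabelling coordinates is taken as a homeomorphism, because it has to commute with the closure
  -- in `moduliSpace`.
  let L : (SkeletonEdge (transport e T) → ℝ) ≃L[ℝ] (SkeletonEdge T → ℝ) :=
    ContinuousLinearEquiv.piCongrLeft ℝ (fun _ => ℝ) (skeletonEquiv e T).symm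
  have hL : ∀ x c, L x c = x (skeletonEquiv e T c) := by
    intro x c
    obtain ⟨c, rfl⟩ := (skeletonEquiv e T).symm.surjective c
    rw [Equiv.apply_symm_apply]
    exact Equiv.piCongrLeft_apply_apply (fun _ => ℝ) (skeletonEquiv e T).symm x c
  have hLs : ∀ ω, L (skeletonLength Q (transport e T) ω) = skeletonLength P T (ω ∘ e) := by
    intro ω
    funext c
    rw [hL, skeletonLength_transport e (hlen ω)]
  have himg : L '' moduliSpace Q (transport e T) = moduliSpace P T := by
    have : L '' moduliSpace Q (transport e T) = _ := L.toHomeomorph.image_closure _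
    rw [this, moduliSpace]
    congr 1
    ext x
    constructor
    · rintro ⟨_, ⟨ω, hω, rfl⟩, rfl⟩
      exact ⟨ω ∘ e, hE (by rw [← hsub, hω]), hLs ω⟩
    · rintro ⟨ω, hω, rfl⟩
      have hc : (ω ∘ e.symm) ∘ e = ω := by ext z; simp
      exact ⟨_, ⟨ω ∘ e.symm, by rw [hsub, hc, hω], rfl⟩, (hLs _).trans (by rw [hc])⟩
  unfold triangulationModuliDim
  rw [← himg]
  exact (finrank_vectorSpan_image L.toLinearEquiv _).symm

end TropicalModuli

end


noncomputable section

namespace TropicalModuli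

/-! ### Invariance under unimodular transformations -/

/-- Lengths of subsegments are preserved by integral matrices with determinant `±1`. -/
theorem latticeLength_set_subset {a b c d : ℤ} (h : a * d - b * c = 1 ∨ a * d - b * c = -1)
    {f : ℝ × ℝ → ℝ × ℝ} (hf : ∀ v, f v = (a * v.1 + b * v.2, c * v.1 + d * v.2))
    (s : Set (ℝ × ℝ)) :
    {l : ℝ | ∃ x ∈ s, ∃ y ∈ s, ∃ z : ℤ × ℤ, IsCoprime z.1 z.2 ∧ y - x = l • toPlane z} ⊆
      {l : ℝ | ∃ x ∈ f '' s, ∃ y ∈ f '' s, ∃ z : ℤ × ℤ, IsCoprime z.1 z.2 ∧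
        y - x = l • toPlane z} := by
  rintro l ⟨x, hx, y, hy, z, ⟨m, n, hmn⟩, hxy⟩
  have e1 := congrArg Prod.fst hxy
  have e2 := congrArg Prod.snd hxy
  simp only [toPlane, Prod.fst_sub, Prod.snd_sub, Prod.smul_mk, smul_eq_mul] at e1 e2
  refine ⟨_, ⟨x, hx, rfl⟩, _, ⟨y, hy, rfl⟩, (a * z.1 + b * z.2, c * z.1 + d * z.2), ?_, ?_⟩
  · have hδ : (a * d - b * c) * (a * d - b * c) = 1 := by rcases h with h | h <;> rw [h] <;> rfl
    refine ⟨(a * d - b * c) * (m * d - n * c), (a * d - b * c) * (n * a - m * b), ?_⟩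
    dsimp only
    linear_combination (m * z.1 + n * z.2) * hδ + hmn
  · rw [hf, hf]
    ext
    · simp only [toPlane, Prod.fst_sub, Prod.smul_mk, smul_eq_mul]
      push_cast
      linear_combination a * e1 + b * e2
    · simp only [toPlane, Prod.snd_sub, Prod.smul_mk, smul_eq_mul]
      push_cast
      linear_combination c * e1 + d * e2

theorem latticeLength_image {a b c d : ℤ} (h : a * d - b * c = 1 ∨ a * d - b * c = -1)
    {f : ℝ × ℝ → ℝ × ℝ} (hf : ∀ v, f v = (a * v.1 + b * v.2, c * v.1 + d * v.2))
    (s : Set (ℝ × ℝ)) : latticeLength (f '' s) = latticeLength s := by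
  obtain ⟨δ, hδ, hδ2⟩ : ∃ δ : ℤ, a * d - b * c = δ ∧ δ * δ = 1 :=
    ⟨_, rfl, by rcases h with h | h <;> rw [h] <;> rfl⟩
  have hδ' : (a : ℝ) * d - b * c = δ := by exact_mod_cast hδ
  have hδ2' : (δ : ℝ) * δ = 1 := by exact_mod_cast hδ2
  have hinv : (δ * d) * (δ * a) - (-δ * b) * (-δ * c) = 1 ∨
      (δ * d) * (δ * a) - (-δ * b) * (-δ * c) = -1 := by
    have : (δ * d) * (δ * a) - (-δ * b) * (-δ * c) = δ := by
      linear_combination (δ * δ) * hδ + δ * hδ2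
    rw [this, ← hδ]
    exact h
  unfold latticeLength
  congr 1
  -- The two sets of lengths are equal, by applying the inclusion also to the inverse matrix, so no
  -- boundedness is needed for the suprema.
  refine Set.Subset.antisymm ?_ (latticeLength_set_subset h hf s)
  refine (latticeLength_set_subset hinv (f := fun v => (((δ * d : ℤ) : ℝ) * v.1 +
    ((-δ * b : ℤ) : ℝ) * v.2, ((-δ * c : ℤ) : ℝ) * v.1 + ((δ * a : ℤ) : ℝ) * v.2))
    (fun v => rfl) (f '' s)).trans (le_of_eq ?_)
  rw [← Set.image_comp, (funext fun v => ?_ : _ ∘ f = id), Set.image_id]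
  rw [Function.comp_apply, hf]
  ext
  · dsimp only [id]
    push_cast
    linear_combination δ * v.1 * hδ' + v.1 * hδ2'
  · dsimp only [id]
    push_cast
    linear_combination v.2 * hδ2' + hδ' * (δ * v.2)

/-- The bijection of the lattice given by an integral affine map with determinant `δ = ±1`. -/
def latticeEquiv (a b c d u w δ : ℤ) (h : a * d - b * c = δ) (hδ : δ * δ = 1) :
    ℤ × ℤ ≃ ℤ × ℤ where
  toFun z := (a * z.1 + b * z.2 + u, c * z.1 + d * z.2 + w)
  invFun y := (δ * (d * (y.1 - u) - b * (y.2 - w)), δ * (a * (y.2 - w) - c * (y.1 - u)))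
  left_inv z := by
    ext
    · dsimp only
      linear_combination δ * z.1 * h + z.1 * hδ
    · dsimp only
      linear_combination δ * z.2 * h + z.2 * hδ
  right_inv y := by
    ext
    · dsimp only
      linear_combination δ * (y.1 - u) * h + (y.1 - u) * hδ
    · dsimp only
      linear_combination δ * (y.2 - w) * h + (y.2 - w) * hδ

/-- An affine lattice map on exponents acts on the dual plane by the transposed matrix; the
translation only adds to all terms a quantity independent of the exponent. Thus minimizers, cells
and lattice lengths correspond. -/
theorem moduliDim_eq_of_equivalent {P Q : Set (ℝ × ℝ)} (h : Equivalent P Q) :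
    moduliDim P = moduliDim Q := by
  obtain ⟨a, b, c, d, u, w, hdet, hPQ⟩ := h
  obtain ⟨δ, hδ, hδ2⟩ : ∃ δ : ℤ, a * d - b * c = δ ∧ δ * δ = 1 :=
    ⟨_, rfl, by rcases hdet with h | h <;> rw [h] <;> rfl⟩
  have hδ' : (a : ℝ) * d - b * c = δ := by exact_mod_cast hδ
  have hδ2' : (δ : ℝ) * δ = 1 := by exact_mod_cast hδ2
  set e := latticeEquiv a b c d u w δ hδ hδ2 with he
  have e1 : ∀ z, (e z).1 = a * z.1 + b * z.2 + u := fun z => rfl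
  have e2 : ∀ z, (e z).2 = c * z.1 + d * z.2 + w := fun z => rfl
  set φ : ℝ × ℝ → ℝ × ℝ := fun p => (a * p.1 + b * p.2 + u, c * p.1 + d * p.2 + w) with hφ
  have hφe : ∀ z, φ (toPlane z) = toPlane (e z) := by
    intro z
    simp only [hφ, toPlane, e1, e2]
    push_cast
    rfl
  have hφinj : Function.Injective φ := by
    intro p q hpq
    have h1 := congrArg Prod.fst hpq
    have h2 := congrArg Prod.snd hpq
    simp only [hφ] at h1 h2
    ext
    · linear_combination δ * (d * h1 - b * h2) - δ * (p.1 - q.1) * hδ' - (p.1 - q.1) * hδ2'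
    · linear_combination δ * (a * h2 - c * h1) - δ * (p.2 - q.2) * hδ' - (p.2 - q.2) * hδ2'
  have hmem : ∀ z, e z ∈ latticePoints Q ↔ z ∈ latticePoints P := by
    intro z
    simp only [latticePoints, Set.mem_ofPred_eq]
    rw [← hφe, ← hPQ, hφinj.mem_set_image]
  set ψ : ℝ × ℝ → ℝ × ℝ := fun v => (a * v.1 + c * v.2, b * v.1 + d * v.2) with hψ
  have hψsurj : Function.Surjective ψ := by
    intro v
    refine ⟨(δ * (d * v.1 - c * v.2), δ * (a * v.2 - b * v.1)), ?_⟩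
    ext
    · simp only [hψ]
      linear_combination δ * v.1 * hδ' + v.1 * hδ2'
    · simp only [hψ]
      linear_combination δ * v.2 * hδ' + v.2 * hδ2'
  have hterm : ∀ (ω : ℤ × ℤ → ℝ) v z,
      tropTerm ω v (e z) = tropTerm (ω ∘ e) (ψ v) z + (u * v.1 + w * v.2) := by
    intro ω v z
    simp only [tropTerm, Function.comp_apply, e1, e2, hψ]
    push_cast
    ring
  have hmin : ∀ (ω : ℤ × ℤ → ℝ) v z,
      e z ∈ minimizers Q ω v ↔ z ∈ minimizers P (ω ∘ e) (ψ v) := by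
    intro ω v z
    simp only [minimizers, Set.mem_ofPred_eq, hmem]
    refine and_congr_right fun _ => ⟨fun h y hy => ?_, fun h y hy => ?_⟩
    · have := h (e y) ((hmem y).2 hy)
      rw [hterm, hterm] at this
      linarith
    · obtain ⟨y, rfl⟩ := e.surjective y
      have := h y ((hmem y).1 hy)
      rw [hterm, hterm]
      linarith
  have hmin' : ∀ (ω : ℤ × ℤ → ℝ) v,
      minimizers Q ω v = e '' minimizers P (ω ∘ e) (ψ v) := by
    intro ω v
    ext z
    obtain ⟨z, rfl⟩ := e.surjective z
    rw [hmin, e.injective.mem_set_image]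
  have harea : ∀ p q r, area2 (e p) (e q) (e r) = δ * area2 p q r := by
    intro p q r
    simp only [area2, e1, e2]
    linear_combination ((q.1 - p.1) * (r.2 - p.2) - (q.2 - p.2) * (r.1 - p.1)) * hδ
  have hδ0 : δ ≠ 0 := by rintro rfl; simp at hδ2
  have hcol : ∀ t : Set (ℤ × ℤ), Collinear ℝ (toPlane '' (e '' t)) ↔ Collinear ℝ (toPlane '' t) := by
    intro t
    simp only [collinear_toPlane_iff, Set.forall_mem_image, harea, mul_eq_zero, hδ0, false_or]
  have hsub : ∀ ω, inducedSubdivision Q ω = transport e (inducedSubdivision P (ω ∘ e)) := by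
    intro ω
    ext t
    constructor
    · rintro ⟨ht, v, rfl⟩
      rw [hmin', hcol] at ht
      exact ⟨_, ⟨ht, ψ v, rfl⟩, (hmin' ω v).symm⟩
    · rintro ⟨t, ⟨ht, v, rfl⟩, rfl⟩
      obtain ⟨v, rfl⟩ := hψsurj v
      exact ⟨by rwa [hcol], v, (hmin' ω v).symm⟩
  have hdual : ∀ (ω : ℤ × ℤ → ℝ) (f : Set (ℤ × ℤ)),
      dualEdge P (ω ∘ e) f = ψ '' dualEdge Q ω (e '' f) := by
    intro ω f
    ext v
    constructor
    · intro hv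
      obtain ⟨v, rfl⟩ := hψsurj v
      refine ⟨v, ?_, rfl⟩
      change e '' f ⊆ minimizers Q ω v
      rw [hmin']
      exact Set.image_mono hv
    · rintro ⟨v, hv, rfl⟩
      change e '' f ⊆ minimizers Q ω v at hv
      rw [hmin'] at hv
      exact (Set.image_subset_image_iff e.injective).1 hv
  have hlen : ∀ (ω : ℤ × ℤ → ℝ) (f : Set (ℤ × ℤ)),
      latticeLength (dualEdge Q ω (e '' f)) = latticeLength (dualEdge P (ω ∘ e) f) := by
    intro ω f
    rw [hdual, latticeLength_image (a := a) (b := c) (c := b) (d := d)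
      (by rwa [mul_comm c b]) (fun v => rfl)]
  have hunim : ∀ t : Set (ℤ × ℤ), IsUnimodularTriangle (e '' t) ↔ IsUnimodularTriangle t := by
    intro t
    have habs : |δ| = 1 := by rw [← hδ]; rcases hdet with h | h <;> rw [h] <;> rfl
    have habs' : ∀ p q r, |area2 (e p) (e q) (e r)| = |area2 p q r| := by
      intro p q r
      rw [harea, abs_mul, habs, one_mul]
    constructor
    · rintro ⟨p, q, r, ht, hp⟩
      obtain ⟨p, rfl⟩ := e.surjective p
      obtain ⟨q, rfl⟩ := e.surjective q
      obtain ⟨r, rfl⟩ := e.surjective r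
      refine ⟨p, q, r, Set.image_injective.2 e.injective ?_, (habs' p q r).symm.trans hp⟩
      rw [ht, Set.image_insert_eq, Set.image_pair]
    · rintro ⟨p, q, r, rfl, hp⟩
      refine ⟨e p, e q, e r, ?_, (habs' p q r).trans hp⟩
      rw [Set.image_insert_eq, Set.image_pair]
  unfold moduliDim
  congr 1
  ext n
  constructor
  · rintro ⟨T, ⟨⟨ω, rfl⟩, hT⟩, rfl⟩
    have hc : (ω ∘ e.symm) ∘ e = ω := by ext z; simp
    refine ⟨transport e (inducedSubdivision P ω), ⟨⟨ω ∘ e.symm, by rw [hsub, hc]⟩, ?_⟩,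
      (triangulationModuliDim_transport e hsub hlen _).symm⟩
    rintro _ ⟨t, ht, rfl⟩
    exact (hunim t).2 (hT t ht)
  · rintro ⟨T, ⟨⟨ω, rfl⟩, hT⟩, rfl⟩
    refine ⟨inducedSubdivision P (ω ∘ e), ⟨⟨_, rfl⟩, fun t ht => ?_⟩, ?_⟩
    · refine (hunim t).1 (hT _ ?_)
      rw [hsub]
      exact ⟨t, ht, rfl⟩
    · rw [hsub]
      exact triangulationModuliDim_transport e hsub hlen _

end TropicalModuli

end


noncomputable section

namespace TropicalModuli

/-! ### Lattice points of the standard polygons -/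

theorem toPlane_mem_latticeHull {V : Set (ℤ × ℤ)} {z : ℤ × ℤ} (h : z ∈ V) :
    toPlane z ∈ latticeHull V := subset_convexHull ℝ _ ⟨z, h, rfl⟩

theorem halfplane_of_mem {V : Set (ℤ × ℤ)} {z : ℤ × ℤ} (hz : z ∈ latticePoints (latticeHull V))
    (a b c : ℤ) (h : ∀ y ∈ V, a * y.1 + b * y.2 ≤ c) : a * z.1 + b * z.2 ≤ c := by
  have hconv : Convex ℝ {p : ℝ × ℝ | (a : ℝ) * p.1 + b * p.2 ≤ c} := by
    refine convex_halfSpace_le (f := fun p : ℝ × ℝ => (a : ℝ) * p.1 + b * p.2) ⟨?_, ?_⟩ _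
    · intro x y
      simp only [Prod.fst_add, Prod.snd_add]
      ring
    · intro k x
      simp only [Prod.smul_fst, Prod.smul_snd, smul_eq_mul]
      ring
  have hsub : latticeHull V ⊆ {p : ℝ × ℝ | (a : ℝ) * p.1 + b * p.2 ≤ c} := by
    refine convexHull_min ?_ hconv
    rintro _ ⟨y, hy, rfl⟩
    have := h y hy
    change (a : ℝ) * (y.1 : ℝ) + b * (y.2 : ℝ) ≤ c
    exact_mod_cast this
  have : (a : ℝ) * (z.1 : ℝ) + b * (z.2 : ℝ) ≤ c := hsub hz
  exact_mod_cast this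

/-- Convex sets contain horizontal segments between their points. -/
theorem horizontal_mem {K : Set (ℝ × ℝ)} (hK : Convex ℝ K) {α β x y : ℝ} (hα : (α, y) ∈ K)
    (hβ : (β, y) ∈ K) (h1 : α ≤ x) (h2 : x ≤ β) : (x, y) ∈ K := by
  rcases h1.eq_or_lt with rfl | h1
  · exact hα
  have hpos : 0 < β - α := by linarith
  have := hK hα hβ (a := (β - x) / (β - α)) (b := (x - α) / (β - α))
    (div_nonneg (by linarith) hpos.le) (div_nonneg (by linarith) hpos.le)
    (by rw [← add_div, div_eq_one_iff_eq hpos.ne']; ring)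
  convert this using 1
  ext
  · simp only [Prod.smul_mk, Prod.mk_add_mk, smul_eq_mul]
    field_simp
    ring
  · simp only [Prod.smul_mk, Prod.mk_add_mk, smul_eq_mul]
    field_simp
    ring

/-- Lattice points of a hull in three rows: it is enough to have the bounds on the vertices and
the ends of the rows. -/
theorem latticePoints_latticeHull_eq {V : Set (ℤ × ℤ)} {R : Rows}
    (hsub : ∀ z ∈ latticePoints (latticeHull V), 0 ≤ z.2 → z.2 ≤ 2 →
      R.lo z.2 ≤ z.1 ∧ z.1 ≤ R.hi z.2)
    (hV : ∀ y ∈ V, 0 ≤ y.2 ∧ y.2 ≤ 2)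
    (h0 : (R.lo 0, 0) ∈ V ∧ (R.hi 0, 0) ∈ V) (h2 : (R.lo 2, 2) ∈ V ∧ (R.hi 2, 2) ∈ V)
    (h1 : ∃ α β : ℝ, (α, 1) ∈ latticeHull V ∧ (β, 1) ∈ latticeHull V ∧ α ≤ R.lo 1 ∧
      R.hi 1 ≤ β) : latticePoints (latticeHull V) = R.pts := by
  have hK : Convex ℝ (latticeHull V) := convex_convexHull ℝ _
  ext ⟨x, y⟩
  constructor
  · intro hz
    have b0 := halfplane_of_mem hz 0 (-1) 0 fun y hy => by have := hV y hy; omega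
    have b2 := halfplane_of_mem hz 0 1 2 fun y hy => by have := hV y hy; omega
    dsimp only at b0 b2
    exact ⟨by dsimp only; omega, by dsimp only; omega,
      hsub _ hz (by dsimp only; omega) (by dsimp only; omega)⟩
  · rintro ⟨y0, y2, hl, hu⟩
    dsimp only at y0 y2 hl hu
    have hl' : (R.lo y : ℝ) ≤ x := by exact_mod_cast hl
    have hu' : (x : ℝ) ≤ R.hi y := by exact_mod_cast hu
    change ((x : ℝ), (y : ℝ)) ∈ latticeHull V
    obtain rfl | rfl | rfl : y = 0 ∨ y = 1 ∨ y = 2 := by omega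
    · exact horizontal_mem hK (toPlane_mem_latticeHull h0.1) (toPlane_mem_latticeHull h0.2) hl' hu'
    · obtain ⟨α, β, hα, hβ, h, h'⟩ := h1
      rw [Int.cast_one]
      exact horizontal_mem hK hα hβ (h.trans hl') (hu'.trans h')
    · exact horizontal_mem hK (toPlane_mem_latticeHull h2.1) (toPlane_mem_latticeHull h2.2) hl' hu'

theorem midpoint_mem_latticeHull {V : Set (ℤ × ℤ)} {a b : ℤ} (ha : (a, 0) ∈ V) (hb : (b, 2) ∈ V) :
    (((a + b) / 2 : ℝ), (1 : ℝ)) ∈ latticeHull V := by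
  have := (convex_convexHull ℝ (toPlane '' V)) (toPlane_mem_latticeHull ha)
    (toPlane_mem_latticeHull hb) (a := 1 / 2) (b := 1 / 2) (by norm_num) (by norm_num)
    (by norm_num)
  have e : (((a + b) / 2 : ℝ), (1 : ℝ)) =
      (1 / 2 : ℝ) • toPlane (a, 0) + (1 / 2 : ℝ) • toPlane (b, 2) := by
    refine Prod.ext ?_ ?_
    · simp only [toPlane, Prod.smul_mk, Prod.mk_add_mk, smul_eq_mul]
      ring
    · simp [toPlane]
  rwa [e]

theorem latticePoints_trapezoid {g i : ℕ} (hg : 2 ≤ g) (hi : i ≤ 2 * g) :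
    latticePoints (latticeHull {(0, 0), ((i : ℤ), 0), (2 * (g : ℤ) + 1 - i, 2), (1, 2)}) =
      (Rows.trapezoid g i hg hi).pts := by
  refine latticePoints_latticeHull_eq ?_ (by simp) (by simp [Rows.trapezoid])
    (by simp [Rows.trapezoid]) ⟨_, _, midpoint_mem_latticeHull (a := 0) (b := 1) (by simp) (by simp),
      midpoint_mem_latticeHull (a := i) (b := 2 * g + 1 - i) (by simp) (by simp), ?_, ?_⟩
  · rintro ⟨x, y⟩ hz h0 h2
    -- The half-planes of the two slanted edges; they cut the middle row at `1/2` and `g + 1/2`.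
    have b1 := halfplane_of_mem hz (-2) 1 0 (by simp; omega)
    have b2 := halfplane_of_mem hz 2 (2 * i - (2 * g + 1)) (2 * i) (by simp; omega)
    dsimp only at *
    obtain rfl | rfl | rfl : y = 0 ∨ y = 1 ∨ y = 2 := by omega
    all_goals simp only [Rows.trapezoid]; norm_num; omega
  · norm_num [Rows.trapezoid]
  · simp [Rows.trapezoid]
    linarith

theorem latticePoints_pentagon {g i j : ℕ} (hg : 2 ≤ g) (hij : i + j ≤ 2 * g + 1) :
    latticePoints (class2Polygon g i j) = (Rows.pentagon g i j hg hij).pts := by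
  refine latticePoints_latticeHull_eq ?_ (by simp) (by simp [Rows.pentagon])
    (by simp [Rows.pentagon]) ⟨_, _, midpoint_mem_latticeHull (a := 0) (b := 1) (by simp) (by simp),
      by simpa [toPlane] using toPlane_mem_latticeHull (z := ((g : ℤ) + 1, 1)) (by simp), ?_, ?_⟩
  · rintro ⟨x, y⟩ hz h0 h2
    have b1 := halfplane_of_mem hz (-2) 1 0 (by simp; omega)
    -- The lines through `(g + 1, 1)` and the right end of each outer row; `i + j ≤ 2 * g + 1` makes
    -- both half-planes contain all vertices.
    have b2 := halfplane_of_mem hz 1 (i - (g + 1)) i (by simp; omega)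
    have b3 := halfplane_of_mem hz 1 (g - j) (g + 1 + (g - j)) (by simp; omega)
    dsimp only at *
    obtain rfl | rfl | rfl : y = 0 ∨ y = 1 ∨ y = 2 := by omega
    all_goals simp only [Rows.pentagon]; norm_num; omega
  · norm_num [Rows.pentagon]
  · simp [Rows.pentagon]

theorem latticePoints_hexagon {g i j k : ℕ} (hg : 2 ≤ g) (hij : i + j + k ≤ 2 * g + 2) :
    latticePoints (class3Polygon g i j k) = (Rows.hexagon g i j k hg hij).pts := by
  refine latticePoints_latticeHull_eq ?_ (by simp) (by simp [Rows.hexagon])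
    (by simp [Rows.hexagon]) ⟨_, _,
      by simpa [toPlane] using toPlane_mem_latticeHull (z := ((0 : ℤ), 1)) (by simp),
      by simpa [toPlane] using toPlane_mem_latticeHull (z := ((g : ℤ) + 1, 1)) (by simp), ?_, ?_⟩
  · rintro ⟨x, y⟩ hz h0 h2
    have b0 := halfplane_of_mem hz (-1) 0 0 (by simp; omega)
    have b1 := halfplane_of_mem hz (-1) k k (by simp; omega)
    have b2 := halfplane_of_mem hz 1 (i - (g + 1)) i (by simp; omega)
    have b3 := halfplane_of_mem hz 1 (g + 1 - (k + j)) (g + 1 + (g + 1 - (k + j)))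
      (by simp; omega)
    dsimp only at *
    obtain rfl | rfl | rfl : y = 0 ∨ y = 1 ∨ y = 2 := by omega
    all_goals simp only [Rows.hexagon]; norm_num; omega
  · simp [Rows.hexagon]
  · simp [Rows.hexagon]

end TropicalModuli

end


/-! ### The dimension formula -/

open TropicalModuli in
theorem mainTheorem4 (g : ℕ) (hg : 2 ≤ g) (P : Set (ℝ × ℝ)) (hP : IsLatticePolygon P)
    (hyp : IsHyperelliptic P) (hgenus : genus P = g) :
    (∀ i : ℕ, InClass1 g i P → moduliDim P = 2 * g - 1) ∧
    (∀ i j : ℕ, InClass2a g i j P → moduliDim P = min (g + i + j) (2 * g - 1)) ∧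
    (∀ i j : ℕ, InClass2b g i j P → moduliDim P = 2 * g - 1) ∧
    (∀ i j k : ℕ, InClass3a g i j k P → k ≠ 0 →
      moduliDim P = min (g + i + j + 1) (2 * g - 1)) ∧
    (∀ i j k : ℕ, InClass3a g i j k P → k = 0 →
      moduliDim P = min (g + i + j) (2 * g - 1)) ∧
    (∀ i j k : ℕ, InClass3b g i j k P →
      moduliDim P = min (g + i + j + 1) (2 * g - 1)) := by
  refine ⟨?_, ?_, ?_, ?_, ?_, ?_⟩
  · rintro i ⟨hgi, hi, he⟩
    rw [moduliDim_eq_of_equivalent he]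
    exact Rows.moduliDim_trapezoid hg hgi hi (latticePoints_trapezoid hg hi)
  · rintro i j ⟨hi, hj, he⟩
    rw [moduliDim_eq_of_equivalent he]
    exact Rows.moduliDim_pentagon hg (by omega) (latticePoints_pentagon hg _)
  · rintro i j ⟨hgi, hi, hij, he⟩
    rw [moduliDim_eq_of_equivalent he,
      Rows.moduliDim_pentagon hg (by omega) (latticePoints_pentagon hg hij)]
    -- Since `i > g`, the minimum is `2 * g - 1`.
    omega
  · rintro i j k ⟨hk, hik, hj, he⟩ hk0
    rw [moduliDim_eq_of_equivalent he]
    exact Rows.moduliDim_hexagon_of_pos hg (by omega) hk0 hk (latticePoints_hexagon hg _)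
  · rintro i j k ⟨hk, hik, hj, he⟩ rfl
    rw [moduliDim_eq_of_equivalent he]
    exact Rows.moduliDim_hexagon_zero hg (by omega) (by omega) (latticePoints_hexagon hg _)
  · rintro i j k ⟨hk, hik, hi, hij, he⟩
    rw [moduliDim_eq_of_equivalent he]
    rcases Nat.eq_zero_or_pos k with rfl | hk0
    -- For `k = 0` the extra loss of one is invisible: `i > g + 1`, so both minima equal `2 * g -
    -- 1`.
    · rw [Rows.moduliDim_hexagon_zero hg (by omega) (by omega)
        (latticePoints_hexagon hg (by omega))]
      omega
    · exact Rows.moduliDim_hexagon_of_pos hg (by omega) (by omega) hk (latticePoints_hexagon hg _)
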